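/- Let $X$ be an oriented smooth manifold of dimension $n$ and $i\colon Y\hookrightarrow X$ a closed smooth submanifold of even codimension $m=2r$, $r\ge 1$. Let $\mu\colon X\to\mathbb R_{\ge0}$ be a nonnegative Morse–Bott function with zero set $Y$: $\mu$ is smooth, vanishes exactly on $Y$, and its Hessian has rank $m$ at every point of $Y$. Differential forms are complex valued, and $\mathrm{or}_Y$ is the orientation bundle of $Y$. For an $n$-form $\eta$ on $X\smallsetminus Y$ such that, for some $N$, $\mu^N\eta$ extends to a compactly supported smooth form on $X$, let $$I_0(\mu,\eta)=\mathrm{res}_{s=0}\,\zeta(s;\mu,\eta),$$ where $\zeta(s;\mu,\eta)$ is the meromorphic continuation to $\mathbb C$ of $\int_X\mu^{s/2}\eta$, $\mathrm{Re}\,s\gg0$; it has at most a simple pole at $s=0$. Let $\omega$ be a $p$-form on $X\smallsetminus Y$ with tame singularities: $\mu^r\omega$ and $\mu^{r-1}d\mu\wedge\omega$ extend to smooth forms on $X$. The residue $R(\omega)$ is the unique smooth section of $\mathrm{or}_Y\otimes\wedge^{p-m}T^*Y$ such that $$I_0(\mu,\omega\wedge\varphi)=\int_Y R(\omega)\wedge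 i^*\varphi$$ for all compactly supported smooth $(n-p)$-forms $\varphi$ on $X$ (for $p<m$ this means $R(\omega)=0$, i.e. $I_0(\mu,\omega\wedge\varphi)=0$ for all such $\varphi$). Half of the Hessian, $\frac12\mathrm{Hess}(\mu)$, induces a euclidean metric on the normal bundle of $Y$ (so that $\mu=x_1^2+\cdots+x_m^2$ corresponds to the standard metric in the $x_1,\dots,x_m$ directions). A local orientation of $Y$ and the orientation of $X$ orient the normal bundle (normal frame followed by tangent frame). The resulting volume form on the normal bundle is denoted $V(\mu)$; it is viewed as a section of $\mathrm{or}_Y\otimes\wedge^mT^*X|_Y$ vanishing on vectors tangent to $Y$. **Theorem.** The residue $R(\omega)$ exists and is unique. The restriction to $Y$ of (the smooth extension of) $\mu^r\omega$, as a section of $\wedge^pT^*X|_Y$, is of the form $$(\mu^r\omega)|_Y=V(\mu)\wedge\alpha$$ for a smooth section $\alpha$ of $\mathrm{or}_Y\otimes\wedge^{p-m}T^*Y$ (for $p<m$ it vanishes), and $$R(\omega)=\frac{2\pi^r}{(r-1)!}\,\alpha .$$ -/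

import Mathlib

open scoped Manifold ContDiff Topology

noncomputable section

namespace MorseBottResidue

/-- The model space `ℝ^d`. -/
abbrev E (d : ℕ) : Type := EuclideanSpace ℝ (Fin d)

/-- The standard basis vectors of `ℝ^d`. -/
def stdVec (d : ℕ) (a : Fin d) : E d := EuclideanSpace.single a (1 : ℝ)

/-! ### Alternating forms -/

section Algebra

variable {T : Type*} [AddCommGroup T] [Module ℝ T] {p q d : ℕ}

/-- The wedge product of complex valued alternating forms (sum over shuffles, no factorials:
`(dx ∧ dy)(v, w) = dx v * dy w - dx w * dy v`). -/
def wedge (a : T [⋀^Fin p]→ₗ[ℝ] ℂ) (b : T [⋀^Fin q]→ₗ[ℝ] ℂ) : T [⋀^Fin (p + q)]→ₗ[ℝ] ℂ :=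
  ((LinearMap.mul' ℝ ℂ).compAlternatingMap (a.domCoprod b)).domDomCongr finSumFinEquiv

/-- The wedge product, regarded as a form of degree `d = p + q`. -/
def wedgeCast (h : p + q = d) (a : T [⋀^Fin p]→ₗ[ℝ] ℂ) (b : T [⋀^Fin q]→ₗ[ℝ] ℂ) :
    T [⋀^Fin d]→ₗ[ℝ] ℂ :=
  (wedge a b).domDomCongr (finCongr h)

end Algebra

/-! ### Differential forms, twisted forms and integration on a `d`-dimensional manifold

In Mathlib the tangent space `T_xM` is a copy of `ℝ^d`, via the preferred chart `chartAt _ x`. -/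

section Forms

variable {d : ℕ} {M : Type*} [TopologicalSpace M] [ChartedSpace (E d) M]

/-- The atlas of `M` is oriented: all its coordinate changes have positive Jacobian. The
orientation of `T_xM` is then the one of `ℝ^d`. -/
def IsOrientedAtlas (d : ℕ) (M : Type*) [TopologicalSpace M] [ChartedSpace (E d) M] : Prop :=
  ∀ e ∈ atlas (E d) M, ∀ e' ∈ atlas (E d) M, ∀ x ∈ e.source ∩ e'.source,
    0 < LinearMap.det (fderiv ℝ (e' ∘ e.symm) (e x) : E d →ₗ[ℝ] E d)

/-- (Not necessarily smooth) complex valued differential `p`-forms. -/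
abbrev DForm (d : ℕ) (M : Type*) [TopologicalSpace M] [ChartedSpace (E d) M] (p : ℕ) :=
  (x : M) → (TangentSpace (𝓡 d) x) [⋀^Fin p]→ₗ[ℝ] ℂ

/-- The differential at `z` of the inverse of the chart at `x₀`. -/
def chartJac (x₀ : M) (z : E d) : E d →L[ℝ] TangentSpace (𝓡 d) ((chartAt (E d) x₀).symm z) :=
  mfderiv 𝓘(ℝ, E d) (𝓡 d) (chartAt (E d) x₀).symm z

/-- The sign of the Jacobian determinant between the chart at `x₀` and the preferred chart at the
point with coordinate `z`: this is the transition function of the orientation bundle. -/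
def chartSign (x₀ : M) (z : E d) : ℝ :=
  SignType.sign (LinearMap.det
    (show E d →ₗ[ℝ] E d from (show E d →L[ℝ] E d from chartJac x₀ z).toLinearMap))

/-- The form `w` in the coordinates of the chart at `x₀` (pullback by the inverse of the chart). -/
def inChart {p : ℕ} (w : DForm d M p) (x₀ : M) (z : E d) : E d [⋀^Fin p]→ₗ[ℝ] ℂ :=
  (w ((chartAt (E d) x₀).symm z)).compLinearMap (chartJac x₀ z).toLinearMap

/-- Smooth differential forms: the coefficients in the charts are smooth. -/
def IsSmoothForm {p : ℕ} (w : DForm d M p) : Prop :=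
  ∀ x₀ : M, ∀ v : Fin p → E d,
    ContDiffOn ℝ ∞ (fun z => inChart w x₀ z v) (chartAt (E d) x₀).target

/-- A section `τ` of `or_M ⊗ Λ^p T^*M` (a twisted form) is recorded by its values `τ x` relative to
the orientation of `T_xM` given by the preferred chart at `x`. This is its expression
relative to the coordinates and the orientation of the chart at `x₀`. -/
def twistedInChart {p : ℕ} (τ : DForm d M p) (x₀ : M) (z : E d) : E d [⋀^Fin p]→ₗ[ℝ] ℂ :=
  chartSign x₀ z • inChart τ x₀ z

/-- Smooth sections of `or_M ⊗ Λ^p T^*M`. -/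
def IsSmoothTwistedForm {p : ℕ} (τ : DForm d M p) : Prop :=
  ∀ x₀ : M, ∀ v : Fin p → E d,
    ContDiffOn ℝ ∞ (fun z => twistedInChart τ x₀ z v) (chartAt (E d) x₀).target

/-- Compactly supported forms. -/
def IsCompactlySupported {p : ℕ} (w : DForm d M p) : Prop :=
  ∃ K : Set M, IsCompact K ∧ ∀ x ∉ K, w x = 0

/-- The differential of a real function, as a (complex valued) 1-form. -/
def dFun (f : M → ℝ) : DForm d M 1 := fun x =>
  AlternatingMap.ofSubsingleton ℝ (TangentSpace (𝓡 d) x) ℂ (0 : Fin 1)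
    (Complex.ofRealCLM.toLinearMap ∘ₗ
      (mfderiv (𝓡 d) 𝓘(ℝ, ℝ) f x : TangentSpace (𝓡 d) x →L[ℝ] ℝ).toLinearMap)

section Integral

variable [IsManifold (𝓡 d) ∞ M] [T2Space M] [SigmaCompactSpace M]

/-- A smooth partition of unity subordinate to the preferred charts. -/
def chartPartition (d : ℕ) (M : Type*) [TopologicalSpace M] [ChartedSpace (E d) M]
    [IsManifold (𝓡 d) ∞ M] [T2Space M] [SigmaCompactSpace M] :
    SmoothPartitionOfUnity M (𝓡 d) M Set.univ :=
  (SmoothPartitionOfUnity.exists_isSubordinate_chartAt_source (𝓡 d) M).choose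

/-- The integral over `M` of the object given by the coefficient function `f x₀ z` in the
coordinates `z` of the chart at `x₀`, by means of a partition of unity. -/
def chartIntegral (f : M → E d → ℂ) : ℂ :=
  ∑ᶠ x₀ : M, ∫ z in (chartAt (E d) x₀).target,
    ((chartPartition d M x₀ ((chartAt (E d) x₀).symm z) : ℝ) : ℂ) * f x₀ z

/-- The integral of a `d`-form over a manifold with an oriented atlas. -/
def formIntegral (η : DForm d M d) : ℂ :=
  chartIntegral fun x₀ z => inChart η x₀ z (stdVec d)

/-- The integral of a section of `or_M ⊗ Λ^d T^*M`; no orientation is needed. -/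
def twistedIntegral (τ : DForm d M d) : ℂ :=
  chartIntegral fun x₀ z => twistedInChart τ x₀ z (stdVec d)

end Integral

/-- The matrix of second derivatives of `f`, as a bilinear form on `T_xM`, in the preferred chart at
`x`. It is the intrinsic Hessian if `x` is a critical point. -/
def hessian (f : M → ℝ) (x : M) :
    TangentSpace (𝓡 d) x →ₗ[ℝ] TangentSpace (𝓡 d) x →ₗ[ℝ] ℝ :=
  show E d →ₗ[ℝ] E d →ₗ[ℝ] ℝ from
    (fderiv ℝ (fderiv ℝ (f ∘ (chartAt (E d) x).symm)) (chartAt (E d) x x)).toLinearMap₁₂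

end Forms

/-! ### Morse-Bott functions and forms with tame singularities

`X` is `n`-dimensional and `i : Y → X` is the inclusion of the `k`-dimensional submanifold. -/

section MorseBott

variable {n k : ℕ} {X Y : Type*} [TopologicalSpace X] [ChartedSpace (E n) X]
  [TopologicalSpace Y] [ChartedSpace (E k) Y]

/-- `μ` is a nonnegative Morse-Bott function on `X` with zero set `i(Y)`, `Y` of codimension
`m`. -/
structure IsMorseBott (i : Y → X) (μ : X → ℝ) (m : ℕ) : Prop where
  smooth : ContMDiff (𝓡 n) 𝓘(ℝ, ℝ) ∞ μ
  nonneg : ∀ x, 0 ≤ μ x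
  zero_iff : ∀ x, μ x = 0 ↔ x ∈ Set.range i
  rank_hessian : ∀ y, Module.finrank ℝ (LinearMap.range (hessian (d := n) μ (i y))) = m

/-- `ψ` is a smooth form on `X` that extends the form `θ`, which is defined on `X ∖ i(Y)` (the
values of `θ` on `i(Y)` are irrelevant). -/
def IsSmoothExtension {p : ℕ} (i : Y → X) (ψ θ : DForm n X p) : Prop :=
  IsSmoothForm ψ ∧ ∀ x ∉ Set.range i, ψ x = θ x

/-- The form `w` on `X ∖ i(Y)` has tame singularities, for the half-codimension `r`:
`μ^r w` and `μ^(r-1) dμ ∧ w` extend smoothly to `X`. -/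
def IsTame {p : ℕ} (i : Y → X) (μ : X → ℝ) (r : ℕ) (w : DForm n X p) : Prop :=
  (∃ ψ : DForm n X p, IsSmoothExtension i ψ fun x => μ x ^ r • w x) ∧
  (∃ χ : DForm n X (1 + p),
    IsSmoothExtension i χ fun x => μ x ^ (r - 1) • wedge (dFun μ x) (w x))

section Residue

variable [IsManifold (𝓡 n) ∞ X] [T2Space X] [SigmaCompactSpace X]

/-- `I₀(μ, η) = c`: the function `s ↦ ∫_X μ^(s/2) η`, defined for `Re s ≫ 0`, has a meromorphic
continuation `Z` to the complex plane, with at most a simple pole at `s = 0`, with residue `c`. -/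
def HasI0 (μ : X → ℝ) (η : DForm n X n) (c : ℂ) : Prop :=
  ∃ Z : ℂ → ℂ, Meromorphic Z ∧
    (∃ C : ℝ, ∀ s : ℂ, C < s.re → Z s = formIntegral fun x => ((μ x : ℂ) ^ (s / 2)) • η x) ∧
    Filter.Tendsto (fun s => s * Z s) (𝓝[≠] 0) (𝓝 c)

variable [IsManifold (𝓡 k) ∞ Y] [T2Space Y] [SigmaCompactSpace Y]

/-- The pullback of differential forms to the submanifold. -/
def restrict (i : Y → X) {p : ℕ} (φ : DForm n X p) : DForm k Y p := fun y =>
  (φ (i y)).compLinearMap (mfderiv (𝓡 k) (𝓡 n) i y).toLinearMap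

/-- `ρ = R(w)`: the smooth section `ρ` of `or_Y ⊗ Λ^q T^*Y` represents the current
`φ ↦ I₀(μ, w ∧ φ)`, that is `I₀(μ, w ∧ φ) = ∫_Y ρ ∧ φ` for all compactly supported smooth forms
`φ` of complementary degree. -/
def IsResidue (i : Y → X) (μ : X → ℝ) {p q : ℕ} (w : DForm n X p) (ρ : DForm k Y q) : Prop :=
  IsSmoothTwistedForm ρ ∧
  ∀ (j : ℕ) (hX : p + j = n) (hY : q + j = k) (φ : DForm n X j),
    IsSmoothForm φ → IsCompactlySupported φ →
      HasI0 μ (fun x => wedgeCast hX (w x) (φ x))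
        (twistedIntegral fun y => wedgeCast hY (ρ y) (restrict i φ y))

end Residue

/-- `e` is a frame of a complement of `T_yY` in `T_xX`, `x = i(y)`, which is orthonormal for the
euclidean metric `½ Hess μ` on the normal space (so that `μ = |v|² + O(|v|³)`), and which
is positively oriented: `e`, followed by the positively oriented basis of `T_yY` given by
the preferred chart at `y`, is a positively oriented basis of `T_xX`. -/
structure IsNormalFrame {m : ℕ} (h : m + k = n) (i : Y → X) (μ : X → ℝ) (y : Y)
    (e : Fin m → TangentSpace (𝓡 n) (i y)) : Prop where
  orthonormal : ∀ a b, hessian (d := n) μ (i y) (e a) (e b) / 2 = if a = b then 1 else 0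
  oriented : 0 < (EuclideanSpace.basisFun (Fin n) ℝ).toBasis.det
    ((show Fin (m + k) → E n from
      Fin.append e fun a => mfderiv (𝓡 k) (𝓡 n) i y (stdVec k a)) ∘ finCongr h.symm)

/-- The `m`-form `e₁^* ∧ ⋯ ∧ e_m^*`, where `e_b^* = ½ Hess μ (·, e_b)`:
`(v₁, …, v_m) ↦ det (½ Hess μ (v_a, e_b))`. -/
def coframeVolume {m : ℕ} (i : Y → X) (μ : X → ℝ) (y : Y)
    (e : Fin m → TangentSpace (𝓡 n) (i y)) :
    (TangentSpace (𝓡 n) (i y)) [⋀^Fin m]→ₗ[ℝ] ℂ :=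
  Complex.ofRealCLM.toLinearMap.compAlternatingMap
    ((Matrix.detRowAlternating (n := Fin m) (R := ℝ)).compLinearMap
      (LinearMap.pi fun b =>
        ((1 / 2 : ℝ) • (hessian (d := n) μ (i y)).flip (e b))))

open Classical in
/-- The normal volume form `V(μ)`, a section of `or_Y ⊗ Λ^m T^*X|_Y` (recorded by its values
relative to the orientations of `T_yY` given by the preferred charts). It does not depend on the
choice of the frame. -/
def normalVolume {m : ℕ} (h : m + k = n) (i : Y → X) (μ : X → ℝ) (y : Y) :
    (TangentSpace (𝓡 n) (i y)) [⋀^Fin m]→ₗ[ℝ] ℂ :=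
  if hex : ∃ e, IsNormalFrame (n := n) h i μ y e then coframeVolume i μ y hex.choose else 0

/-- The restriction `ψ|_Y` of the form `ψ`, a section of `Λ^p T^*X|_Y`, equals `V(μ) ∧ α`. Since
`V(μ)` vanishes on vectors tangent to `Y`, the product `V(μ) ∧ α` is `V(μ) ∧ β` for any lift `β`
of the form `α y` on `T_yY` to a form on `T_xX`, `x = i(y)`. -/
def RestrictsTo {m p q : ℕ} (h : m + k = n) (hp : m + q = p) (i : Y → X) (μ : X → ℝ)
    (ψ : DForm n X p) (α : DForm k Y q) : Prop :=
  ∀ y : Y, ∃ β : (TangentSpace (𝓡 n) (i y)) [⋀^Fin q]→ₗ[ℝ] ℂ,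
    β.compLinearMap (mfderiv (𝓡 k) (𝓡 n) i y).toLinearMap = α y ∧
    ψ (i y) = wedgeCast hp (normalVolume h i μ y) β

end MorseBott

end MorseBottResidue

end

/-!
For a form `w` with smooth extension `ψ` of `μ^r w` and a test form `φ`, the integral of
`μ^(s/2) w ∧ φ` is, for large `Re s`, the integral of `μ^(s/2 - r) η` with the smooth compactly
supported form `η = ψ ∧ φ` of top degree (`cpow_smul_wedgeCast_eq`). The theorem splits into the
computation of the residue of such integrals and a statement on the restriction of `ψ` to `Y`.

*The residue of a smooth form.* By the Morse-Bott lemma there are coordinates `(x, u)` near each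
point of `Y` in which `μ = |x|²`, and `(0, u)` is the point of `Y` with coordinates `u`
(`IsMorseBott.exists_adaptedChart`). For a form supported in such a chart, polar coordinates in `x`
turn the integral into the Mellin transform at `s` of a smooth compactly supported function of the
radius, because the volume element `ρ^(2r-1) dρ` of the radius cancels the factor `ρ^(-2r)` up to
`ρ^(-1) dρ`. Such a Mellin transform continues meromorphically by partial integration, and its
residue at `0` is the value of the function at `0`, that is the area `2 π^r / (r-1)!` of the unit
sphere in `ℝ^(2r)` times the integral over `x = 0` (`exists_meromorphic_mellin`,
`exists_meromorphic_integral_prod`). Away from `Y` the integral is entire. A partition of unity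
shows that the residue of `∫ μ^(s/2 - r) η` is `2 π^r / (r-1)!` times the integral over `Y` of the
contraction of `η` with the orthonormal normal frames (`hasResidueZero_powerIntegral`). The
contraction of `V(μ) ∧ α ∧ φ` is `α ∧ i^*φ` (`isNormalContraction_wedgeCast`).

*The restriction of `ψ`.* Let `χ` be the smooth extension of `μ^(r-1) dμ ∧ w`. Off `Y` one has
`μ χ = dμ ∧ ψ`, and on the line `x = t e_b` this reads `t² χ = 2 t dx_b ∧ ψ`. Dividing by `t` and
letting `t` tend to `0` gives `dx_b ∧ ψ = 0` on `Y` for all normal coordinates `x_b`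
(`IsAdaptedChart.wedge_normalCovector_eq_zero`). By linear algebra `ψ` is then divisible by
`dx₁ ∧ ⋯ ∧ dx_m`, and it vanishes if its degree is less than `m`
(`eq_wedge_normalVol`, `eq_zero_of_wedge_normalCovector_of_lt`). In adapted coordinates the Hessian
of `μ` is twice the standard form in the normal directions, so that `dx₁ ∧ ⋯ ∧ dx_m` is `V(μ)` up to
the sign that compares orientations (`IsAdaptedChart.normalVolume_frameMap`); this sign makes `α` a
twisted form.

*Uniqueness.* The residue of a function given on a half plane is unique by the identity theorem
(`HasResidueZero.unique`), and a smooth twisted form on `Y` is determined by its integrals against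
restrictions of test forms on `X`, since functions on `Y` extend locally to `X`
(`eq_zero_of_twistedIntegral_eq_zero`).
-/

noncomputable section

namespace MorseBottResidue

open Set Filter MeasureTheory
open scoped RealInnerProductSpace

set_option linter.unusedSectionVars false
set_option maxSynthPendingDepth 3

/-! ### Smoothness of parametric integrals -/

/-- Differentiation under the integral sign, for an integrand that depends on the integration
variable through a map `q` with values in a compact set. -/
theorem contDiff_integral_of_contDiff {P Q : Type} [NormedAddCommGroup P] [NormedSpace ℝ P]
    [FiniteDimensional ℝ P] [NormedAddCommGroup Q] [NormedSpace ℝ Q]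
    {A : Type*} [MeasurableSpace A] (ν : Measure A) [IsFiniteMeasure ν]
    {q : A → Q} (hq : AEStronglyMeasurable q ν) {K : Set Q} (hK : IsCompact K)
    (hqK : ∀ a, q a ∈ K) {F : Type} [NormedAddCommGroup F] [NormedSpace ℝ F]
    {Φ : P × Q → F} (hΦ : ContDiff ℝ ∞ Φ) :
    ContDiff ℝ ∞ fun p => ∫ a, Φ (p, q a) ∂ν := by
  have key : ∀ (F : Type) [NormedAddCommGroup F] [NormedSpace ℝ F] (Φ : P × Q → F),
      ContDiff ℝ ∞ Φ → ∀ p₀ : P, HasFDerivAt (fun p => ∫ a, Φ (p, q a) ∂ν)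
        (∫ a, (fderiv ℝ Φ (p₀, q a)).comp (ContinuousLinearMap.inl ℝ P Q) ∂ν) p₀ := by
    intro F _ _ Φ hΦ p₀
    have hc : Continuous Φ := hΦ.continuous
    have hc' : Continuous fun z : P × Q => (fderiv ℝ Φ z).comp (ContinuousLinearMap.inl ℝ P Q) :=
      (hΦ.continuous_fderiv (by simp)).clm_comp continuous_const
    have hm : ∀ p : P, AEStronglyMeasurable (fun a => (p, q a)) ν := fun p =>
      (continuous_const.prodMk continuous_id).comp_aestronglyMeasurable hq
    obtain ⟨C, hC⟩ := ((isCompact_closedBall p₀ 1).prod hK).exists_bound_of_continuousOn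
      hc'.continuousOn
    obtain ⟨C₀, hC₀⟩ := ((isCompact_closedBall p₀ 1).prod hK).exists_bound_of_continuousOn
      hc.continuousOn
    refine hasFDerivAt_integral_of_dominated_of_fderiv_le (bound := fun _ => C)
      (F' := fun p a => (fderiv ℝ Φ (p, q a)).comp (ContinuousLinearMap.inl ℝ P Q))
      (Metric.closedBall_mem_nhds p₀ one_pos) (Eventually.of_forall fun p =>
        hc.comp_aestronglyMeasurable (hm p)) ?_ (hc'.comp_aestronglyMeasurable (hm p₀)) ?_
      (integrable_const _) ?_
    · exact Integrable.of_bound (hc.comp_aestronglyMeasurable (hm p₀)) C₀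
        (Eventually.of_forall fun a => hC₀ _ ⟨Metric.mem_closedBall_self zero_le_one, hqK a⟩)
    · exact Eventually.of_forall fun a p hp => hC _ ⟨hp, hqK a⟩
    · refine Eventually.of_forall fun a p _ => ?_
      have h1 := ((hΦ.differentiable (by simp)) (p, q a)).hasFDerivAt
      exact h1.comp p ((hasFDerivAt_id p).prodMk (hasFDerivAt_const (q a) p))
  rw [contDiff_infty]
  intro n
  induction n generalizing F with
  | zero =>
    exact contDiff_zero.2 (continuous_iff_continuousAt.2 fun p => (key F Φ hΦ p).continuousAt)
  | succ n ih =>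
    have h2 : ContDiff ℝ ∞ fun z : P × Q =>
        (fderiv ℝ Φ z).comp (ContinuousLinearMap.inl ℝ P Q) :=
      (hΦ.fderiv_right (by simp)).clm_comp contDiff_const
    rw [Nat.cast_succ, contDiff_succ_iff_hasFDerivAt]
    exact ⟨_, ih h2, key F Φ hΦ⟩

/-! ### The Mellin transform of a smooth compactly supported function -/

theorem eventuallyEq_zero_atTop_of_hasCompactSupport {G : ℝ → ℂ} (hs : HasCompactSupport G) :
    G =ᶠ[atTop] fun _ => 0 :=
  (hasCompactSupport_iff_eventuallyEq.1 hs).filter_mono (by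
    rw [coclosedCompact_eq_cocompact]; exact atTop_le_cocompact)

theorem isBigO_rpow_atTop_of_hasCompactSupport {G : ℝ → ℂ} (hs : HasCompactSupport G) (a : ℝ) :
    G =O[atTop] fun x : ℝ => x ^ (-a) :=
  (eventuallyEq_zero_atTop_of_hasCompactSupport hs).trans_isBigO (Asymptotics.isBigO_zero _ _)

theorem isBigO_rpow_zero_of_continuous {G : ℝ → ℂ} (hG : Continuous G) :
    G =O[𝓝[>] 0] fun x : ℝ => x ^ (-(0 : ℝ)) := by
  simp only [neg_zero, Real.rpow_zero]
  exact (hG.tendsto 0).isBigO_one ℝ |>.mono nhdsWithin_le_nhds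

theorem mellinConvergent_of_continuous {G : ℝ → ℂ} (hG : Continuous G) (hs : HasCompactSupport G)
    {s : ℂ} (h : 0 < s.re) : MellinConvergent G s :=
  mellinConvergent_of_isBigO_rpow (a := s.re + 1) (b := 0)
    (hG.locallyIntegrable.locallyIntegrableOn _)
    (isBigO_rpow_atTop_of_hasCompactSupport hs _) (by linarith)
    (isBigO_rpow_zero_of_continuous hG) h

theorem differentiableAt_mellin_of_continuous {G : ℝ → ℂ} (hG : Continuous G)
    (hs : HasCompactSupport G) {s : ℂ} (h : 0 < s.re) : DifferentiableAt ℂ (mellin G) s :=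
  mellin_differentiableAt_of_isBigO_rpow (a := s.re + 1) (b := 0)
    (hG.locallyIntegrable.locallyIntegrableOn _)
    (isBigO_rpow_atTop_of_hasCompactSupport hs _) (by linarith)
    (isBigO_rpow_zero_of_continuous hG) h

/-- Partial integration: the recursion that continues the Mellin transform to the left. -/
theorem mellin_deriv_add_one {G : ℝ → ℂ} (hG : ContDiff ℝ ∞ G) (hs : HasCompactSupport G)
    {s : ℂ} (h : 0 < s.re) : mellin (deriv G) (s + 1) = -(s * mellin G s) := by
  have hs0 : s ≠ 0 := by rintro rfl; simp at h
  have hG' : Continuous (deriv G) := hG.continuous_deriv (by simp)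
  have h1 := mellinConvergent_of_continuous hG.continuous hs h
  have h2 := mellinConvergent_of_continuous hG' hs.deriv (s := s + 1) (by simp; linarith)
  unfold mellin
  unfold MellinConvergent at h1 h2
  simp only [add_sub_cancel_right, smul_eq_mul] at h1 h2 ⊢
  have key := integral_Ioi_mul_deriv_eq_deriv_mul (a := (0 : ℝ)) (a' := (0 : ℂ)) (b' := (0 : ℂ))
    (u := fun t : ℝ => (t : ℂ) ^ s) (v := G) (u' := fun t : ℝ => s * (t : ℂ) ^ (s - 1))
    (v' := deriv G) (fun x hx => hasDerivAt_ofReal_cpow_const (ne_of_gt hx) hs0)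
    (fun x _ => (hG.differentiable (by simp) x).hasDerivAt) h2
    (by
      have := h1.const_mul s
      simp only [← mul_assoc] at this
      exact this) ?_ ?_
  · rw [key]
    simp only [sub_self, zero_sub, mul_assoc]
    rw [integral_const_mul]
  · have hc : ContinuousAt (fun t : ℝ => (t : ℂ) ^ s * G t) 0 :=
      (Complex.continuousAt_ofReal_cpow_const 0 s (Or.inl h)).mul hG.continuous.continuousAt
    have := hc.tendsto.mono_left (nhdsWithin_le_nhds (s := Ioi 0))
    simpa [Complex.zero_cpow hs0, Pi.mul_def] using this
  · refine tendsto_const_nhds.congr' ?_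
    filter_upwards [eventuallyEq_zero_atTop_of_hasCompactSupport hs] with t ht
    simp [ht]

/-- The boundary term of the partial integration, which is the source of the residue. -/
theorem mellin_deriv_one {G : ℝ → ℂ} (hG : ContDiff ℝ ∞ G) (hs : HasCompactSupport G) :
    mellin (deriv G) 1 = - G 0 := by
  have hG' : Continuous (deriv G) := hG.continuous_deriv (by simp)
  have h2 := mellinConvergent_of_continuous hG' hs.deriv (s := 1) (by simp)
  unfold mellin
  unfold MellinConvergent at h2
  simp only [sub_self, Complex.cpow_zero, one_smul] at h2 ⊢
  rw [integral_Ioi_of_hasDerivAt_of_tendsto (f := G) (m := 0)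
    hG.continuous.continuousWithinAt
    (fun x _ => (hG.differentiable (by simp) x).hasDerivAt) h2
    (tendsto_const_nhds.congr' (eventuallyEq_zero_atTop_of_hasCompactSupport hs).symm)]
  simp

theorem hasCompactSupport_iterate_deriv {G : ℝ → ℂ} (hs : HasCompactSupport G) (N : ℕ) :
    HasCompactSupport (deriv^[N] G) := by
  induction N with
  | zero => exact hs
  | succ N ih => rw [Function.iterate_succ_apply']; exact ih.deriv

/-- `(-1)^N / Γ(s + N)` times the Mellin transform of the `N`-th derivative at `s + N`.  By partial
integration this does not depend on `N > - Re s`, and it is the Mellin transform divided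
by `Γ(s)` if `Re s > 0`. -/
def mellinGammaAux (G : ℝ → ℂ) (N : ℕ) (s : ℂ) : ℂ :=
  (-1) ^ N * (Complex.Gamma (s + N))⁻¹ * mellin (deriv^[N] G) (s + N)

theorem mellinGammaAux_succ {G : ℝ → ℂ} (hG : ContDiff ℝ ∞ G) (hs : HasCompactSupport G)
    (N : ℕ) {s : ℂ} (h : 0 < s.re + N) :
    mellinGammaAux G (N + 1) s = mellinGammaAux G N s := by
  have hN : ContDiff ℝ ∞ (deriv^[N] G) := hG.iterate_deriv N
  have hre : 0 < (s + N).re := by simpa using h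
  have h0 : s + N ≠ 0 := by intro h'; rw [h'] at hre; simp at hre
  unfold mellinGammaAux
  rw [Function.iterate_succ_apply', Nat.cast_succ, ← add_assoc,
    mellin_deriv_add_one hN (hasCompactSupport_iterate_deriv hs N) hre,
    Complex.Gamma_add_one _ h0, pow_succ]
  field_simp

theorem mellinGammaAux_eq {G : ℝ → ℂ} (hG : ContDiff ℝ ∞ G) (hs : HasCompactSupport G)
    {N N' : ℕ} (hN : N ≤ N') {s : ℂ} (h : 0 < s.re + N) :
    mellinGammaAux G N' s = mellinGammaAux G N s := by
  induction N', hN using Nat.le_induction with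
  | base => rfl
  | succ K hK ih =>
    rw [mellinGammaAux_succ hG hs K (lt_of_lt_of_le h (by gcongr)), ih]

theorem differentiableAt_mellinGammaAux {G : ℝ → ℂ} (hG : ContDiff ℝ ∞ G)
    (hs : HasCompactSupport G) (N : ℕ) {s : ℂ} (h : 0 < s.re + N) :
    DifferentiableAt ℂ (mellinGammaAux G N) s := by
  have hN : ContDiff ℝ ∞ (deriv^[N] G) := hG.iterate_deriv N
  have hre : 0 < (s + N).re := by simpa using h
  have h1 := differentiableAt_mellin_of_continuous hN.continuous
    (hasCompactSupport_iterate_deriv hs N) hre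
  have h2 := Complex.differentiable_one_div_Gamma (s + N)
  have h3 : DifferentiableAt ℂ (fun s : ℂ => s + N) s := by fun_prop
  exact ((h2.comp s h3).const_mul _).mul (DifferentiableAt.comp (g := mellin (deriv^[N] G)) s h1 h3)

/-- The Mellin transform of a smooth compactly supported function on the real line extends to a
meromorphic function on the plane, and `s = 0` is a simple pole with residue `G 0`. -/
theorem exists_meromorphic_mellin {G : ℝ → ℂ} (hG : ContDiff ℝ ∞ G) (hs : HasCompactSupport G) :
    ∃ Z : ℂ → ℂ, Meromorphic Z ∧ (∀ s : ℂ, 0 < s.re → Z s = mellin G s) ∧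
      Tendsto (fun s => s * Z s) (𝓝[≠] 0) (𝓝 (G 0)) := by
  set D : ℂ → ℂ := fun s => mellinGammaAux G (⌈-s.re⌉₊ + 1) s with hD
  have hDN : ∀ (N : ℕ) (s : ℂ), 0 < s.re + N → D s = mellinGammaAux G N s := by
    intro N s h
    have h' : 0 < s.re + ((⌈-s.re⌉₊ + 1 : ℕ) : ℝ) := by
      have := Nat.le_ceil (-s.re)
      push_cast; linarith
    rcases le_total N (⌈-s.re⌉₊ + 1) with hle | hle
    · exact mellinGammaAux_eq hG hs hle h
    · exact (mellinGammaAux_eq hG hs hle h').symm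
  have hdiff : Differentiable ℂ D := by
    intro s
    obtain ⟨N, hN⟩ := exists_nat_gt (-s.re)
    have hN' : 0 < s.re + N := by linarith
    refine (differentiableAt_mellinGammaAux hG hs N hN').congr_of_eventuallyEq ?_
    have : ∀ᶠ t : ℂ in 𝓝 s, 0 < t.re + N :=
      (Complex.continuous_re.add continuous_const).continuousAt.eventually (lt_mem_nhds hN')
    filter_upwards [this] with t ht using hDN N t ht
  refine ⟨fun s => Complex.Gamma s * D s, ?_, ?_, ?_⟩
  · intro s
    have h1 : MeromorphicAt (fun s => (Complex.Gamma s)⁻¹) s :=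
      (Complex.differentiable_one_div_Gamma.analyticAt s).meromorphicAt
    have h2 : MeromorphicAt Complex.Gamma s := by
      have := h1.inv
      simpa [Pi.inv_def] using this
    exact h2.mul (hdiff.analyticAt s).meromorphicAt
  · intro s h
    simp only [hDN 0 s (by simpa using h), mellinGammaAux]
    have := Complex.Gamma_ne_zero_of_re_pos h
    simp [this]
  · have h0 : D 0 = G 0 := by
      rw [hDN 1 0 (by simp)]
      simp [mellinGammaAux, mellin_deriv_one hG hs]
    have hc : Tendsto (fun s : ℂ => Complex.Gamma (s + 1) * D s) (𝓝[≠] 0) (𝓝 (G 0)) := by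
      have h1 : ContinuousAt (fun s : ℂ => Complex.Gamma (s + 1)) 0 := by
        refine ContinuousAt.comp (f := fun s : ℂ => s + 1) ?_ (by fun_prop)
        exact (Complex.differentiableAt_Gamma _ (fun m => by
          intro h
          have := congrArg Complex.re h
          simp at this
          have h3 : (0:ℝ) ≤ m := Nat.cast_nonneg m
          linarith)).continuousAt
      have : Tendsto (fun s : ℂ => Complex.Gamma (s + 1) * D s) (𝓝 0)
          (𝓝 (Complex.Gamma (0 + 1) * D 0)) := h1.mul (hdiff 0).continuousAt
      rw [zero_add, Complex.Gamma_one, h0, one_mul] at this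
      exact this.mono_left nhdsWithin_le_nhds
    refine hc.congr' ?_
    filter_upwards [self_mem_nhdsWithin] with s hs0
    rw [Complex.Gamma_add_one s hs0]; ring

/-! ### Integration in polar coordinates -/

/-- Integration in polar coordinates. -/
theorem integral_eq_integral_sphere {V : Type*} [NormedAddCommGroup V] [InnerProductSpace ℝ V]
    [FiniteDimensional ℝ V] [Nontrivial V] [MeasurableSpace V] [BorelSpace V]
    {f : V → ℂ} (hf : Integrable f) :
    ∫ x, f x = ∫ ρ in Ioi (0 : ℝ), ((ρ ^ (Module.finrank ℝ V - 1) : ℝ) : ℂ) *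
      ∫ θ : Metric.sphere (0 : V) 1, f (ρ • (θ : V)) ∂(volume : Measure V).toSphere := by
  set μ : Measure V := volume
  have hmp := μ.measurePreserving_homeomorphUnitSphereProd
  have hemb : MeasurableEmbedding (homeomorphUnitSphereProd V) :=
    Homeomorph.measurableEmbedding _
  set F : Metric.sphere (0 : V) 1 × Ioi (0 : ℝ) → ℂ := fun z => f ((z.2 : ℝ) • (z.1 : V)) with hF
  have hFx : ∀ x : ({(0)}ᶜ : Set V), F (homeomorphUnitSphereProd V x) = f x := by
    intro x
    have hx : ‖(x : V)‖ ≠ 0 := norm_ne_zero_iff.2 x.2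
    simp [F, homeomorphUnitSphereProd, smul_smul, hx]
  have hFi : Integrable F (μ.toSphere.prod (.volumeIoiPow (Module.finrank ℝ V - 1))) := by
    rw [← hmp.integrable_comp_emb hemb]
    have h1 : IntegrableOn f ({0}ᶜ : Set V) μ := hf.integrableOn
    rw [integrableOn_iff_comap_subtypeVal (measurableSet_singleton _).compl] at h1
    exact h1.congr (Eventually.of_forall fun x => (hFx x).symm)
  calc ∫ x, f x = ∫ x : ({(0)}ᶜ : Set V), f x.1 ∂(μ.comap (↑)) := by
        rw [integral_subtype_comap (measurableSet_singleton _).compl f,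
          restrict_compl_singleton]
    _ = ∫ z, F z ∂μ.toSphere.prod (.volumeIoiPow (Module.finrank ℝ V - 1)) := by
        rw [← hmp.integral_comp hemb F]
        exact integral_congr_ae (Eventually.of_forall fun x => (hFx x).symm)
    _ = ∫ ρ, (∫ θ, F (θ, ρ) ∂μ.toSphere) ∂(.volumeIoiPow (Module.finrank ℝ V - 1)) :=
        integral_prod_symm F hFi
    _ = _ := by
        simp only [Measure.volumeIoiPow, ENNReal.ofReal]
        rw [integral_withDensity_eq_integral_smul,
          integral_subtype_comap measurableSet_Ioi fun a : ℝ =>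
            Real.toNNReal (a ^ (Module.finrank ℝ V - 1)) •
              ∫ θ : Metric.sphere (0 : V) 1, f (a • (θ : V)) ∂μ.toSphere]
        · refine setIntegral_congr_fun measurableSet_Ioi fun x hx => ?_
          rw [NNReal.smul_def, Real.coe_toNNReal _ (pow_nonneg hx.out.le _), Complex.real_smul]
        · exact (measurable_subtype_coe.pow_const _).real_toNNReal

theorem continuous_norm_cpow {V : Type*} [NormedAddCommGroup V] {a : ℂ} (h : 0 < a.re) :
    Continuous fun x : V => (‖x‖ : ℂ) ^ a := by
  have h1 : Continuous fun y : ℝ => (y : ℂ) ^ a := continuous_iff_continuousAt.2 fun y =>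
    Complex.continuousAt_ofReal_cpow_const y a (Or.inl h)
  exact h1.comp continuous_norm

/-- The area of the unit sphere in `ℝ^(2r)`; this is the constant in the residue formula. -/
theorem toSphere_real_univ {r : ℕ} (hr : 1 ≤ r) :
    ((volume : Measure (E (2 * r))).toSphere).real univ = 2 * Real.pi ^ r / (r - 1).factorial := by
  have : Nontrivial (E (2 * r)) := by
    have : Nonempty (Fin (2 * r)) := ⟨⟨0, by omega⟩⟩
    infer_instance
  rw [Measure.toSphere_real_apply_univ, Measure.real,
    InnerProductSpace.volume_ball_of_dim_even (k := r) (by simp)]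
  obtain ⟨r, rfl⟩ : ∃ r', r = r' + 1 := ⟨r - 1, by omega⟩
  simp only [ENNReal.ofReal_one, one_pow, one_mul, finrank_euclideanSpace, Fintype.card_fin]
  rw [ENNReal.toReal_ofReal (by positivity)]
  simp only [Nat.factorial_succ, Nat.add_sub_cancel]
  push_cast
  field_simp

/-- Meromorphic continuation of `s ↦ ∫ ‖x‖^(s - 2r) g(x) dx` on `ℝ^(2r)`: in polar coordinates this
is the Mellin transform at `s` of the integral of `g` over the sphere of radius `ρ`, rescaled to the
unit sphere. -/
theorem exists_meromorphic_integral_norm_cpow {r : ℕ} (hr : 1 ≤ r) {g : E (2 * r) → ℂ}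
    (hg : ContDiff ℝ ∞ g) (hs : HasCompactSupport g) :
    ∃ Z : ℂ → ℂ, Meromorphic Z ∧
      (∀ s : ℂ, 2 * r < s.re → Z s = ∫ x, (‖x‖ : ℂ) ^ (s - 2 * r) * g x) ∧
      Tendsto (fun s => s * Z s) (𝓝[≠] 0)
        (𝓝 ((2 * Real.pi ^ r / (r - 1).factorial : ℝ) * g 0)) := by
  have : Nontrivial (E (2 * r)) := by
    have : Nonempty (Fin (2 * r)) := ⟨⟨0, by omega⟩⟩
    infer_instance
  set ν := (volume : Measure (E (2 * r))).toSphere with hν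
  -- `G` is smooth on the whole line, in particular up to `ρ = 0`
  set G : ℝ → ℂ := fun ρ => ∫ θ : Metric.sphere (0 : E (2 * r)) 1, g (ρ • (θ : E (2 * r))) ∂ν
    with hGdef
  have hG : ContDiff ℝ ∞ G := by
    refine contDiff_integral_of_contDiff (P := ℝ) (Q := E (2 * r)) ν
      (q := fun θ : Metric.sphere (0 : E (2 * r)) 1 => (θ : E (2 * r)))
      continuous_subtype_val.aestronglyMeasurable (isCompact_sphere 0 1) (fun a => a.2)
      (Φ := fun z : ℝ × E (2 * r) => g (z.1 • z.2)) ?_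
    exact hg.comp (contDiff_fst.smul contDiff_snd)
  have hGs : HasCompactSupport G := by
    obtain ⟨R, hR⟩ := hs.isBounded.subset_closedBall 0
    refine HasCompactSupport.intro (isCompact_closedBall (0 : ℝ) R) fun ρ hρ => ?_
    have h0 : ∀ θ : Metric.sphere (0 : E (2 * r)) 1, g (ρ • (θ : E (2 * r))) = 0 := by
      intro θ
      by_contra hne
      have := hR (subset_tsupport _ hne)
      simp [norm_smul] at this
      exact hρ (by simpa using this)
    simp [G, h0]
  obtain ⟨Z, hZ, hZm, hZ0⟩ := exists_meromorphic_mellin hG hGs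
  refine ⟨Z, hZ, fun s hsre => ?_, ?_⟩
  · have hre : 0 < (s - 2 * r).re := by simpa using hsre
    rw [hZm s (by have : (0 : ℝ) ≤ r := Nat.cast_nonneg r; linarith)]
    have hc : Continuous fun x : E (2 * r) => (‖x‖ : ℂ) ^ (s - 2 * r) * g x :=
      (continuous_norm_cpow hre).mul hg.continuous
    rw [integral_eq_integral_sphere (hc.integrable_of_hasCompactSupport hs.mul_left), mellin]
    refine setIntegral_congr_fun measurableSet_Ioi fun ρ hρ => ?_
    have hρ' : (0 : ℝ) < ρ := hρ
    have h1 : ∀ θ : Metric.sphere (0 : E (2 * r)) 1, ‖ρ • (θ : E (2 * r))‖ = ρ := by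
      intro θ; simp [norm_smul, abs_of_pos hρ']
    simp only [h1, smul_eq_mul]
    rw [integral_const_mul, ← mul_assoc]
    congr 1
    have h2 : ((ρ ^ (Module.finrank ℝ (E (2 * r)) - 1) : ℝ) : ℂ) = (ρ : ℂ) ^ ((2 * r : ℂ) - 1) := by
      simp only [finrank_euclideanSpace, Fintype.card_fin]
      rw [Complex.ofReal_pow, ← Complex.cpow_natCast]
      congr 1
      rw [Nat.cast_sub (by omega)]
      push_cast; ring
    rw [h2, ← Complex.cpow_add _ _ (by exact_mod_cast hρ'.ne')]
    congr 1; ring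
  · have : G 0 = (2 * Real.pi ^ r / (r - 1).factorial : ℝ) * g 0 := by
      simp only [G, zero_smul, integral_const, ← toSphere_real_univ hr, Complex.real_smul, ν]
    rwa [this] at hZ0

/-- Meromorphic continuation of `s ↦ ∫ (‖x‖²)^(s/2 - r) g(x, u) dx du` on `ℝ^(2r) × ℝ^k`. -/
theorem exists_meromorphic_integral_prod {r k : ℕ} (hr : 1 ≤ r) {g : E (2 * r) × E k → ℂ}
    (hg : ContDiff ℝ ∞ g) (hs : HasCompactSupport g) :
    ∃ Z : ℂ → ℂ, Meromorphic Z ∧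
      (∀ s : ℂ, 2 * r < s.re → Z s = ∫ z, ((‖z.1‖ ^ 2 : ℝ) : ℂ) ^ (s / 2 - r) * g z) ∧
      Tendsto (fun s => s * Z s) (𝓝[≠] 0)
        (𝓝 ((2 * Real.pi ^ r / (r - 1).factorial : ℝ) * ∫ u, g (0, u))) := by
  set h : E (2 * r) → ℂ := fun x => ∫ u, g (x, u) with hh
  have hK : IsCompact (Prod.snd '' tsupport g) := hs.image continuous_snd
  have hset : ∀ x, ∫ u, g (x, u) = ∫ u in Prod.snd '' tsupport g, g (x, u) := fun x => by
    refine (setIntegral_eq_integral_of_forall_compl_eq_zero fun u hu => ?_).symm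
    by_contra hne
    exact hu ⟨(x, u), subset_tsupport _ hne, rfl⟩
  have hmeas : MeasurableSet (Prod.snd '' tsupport g) := hK.measurableSet
  have hhd : ContDiff ℝ ∞ h := by
    have : h = fun x => ∫ u : (Prod.snd '' tsupport g : Set (E k)), g (x, u)
        ∂(Measure.comap Subtype.val volume) := by
      ext x
      rw [hh]
      simp only
      rw [hset x, integral_subtype_comap hmeas fun u => g (x, u)]
    rw [this]
    have : IsFiniteMeasure (Measure.comap (Subtype.val : (Prod.snd '' tsupport g : Set (E k)) → E k)
        volume) := ⟨by
      rw [Measure.comap_apply _ Subtype.val_injective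
        (fun s hs' => MeasurableEmbedding.subtype_coe hmeas |>.measurableSet_image.2 hs')
        _ MeasurableSet.univ]
      rw [image_univ, Subtype.range_coe]
      exact hK.measure_lt_top⟩
    exact contDiff_integral_of_contDiff (Measure.comap Subtype.val volume)
      (q := (Subtype.val : (Prod.snd '' tsupport g : Set (E k)) → E k))
      continuous_subtype_val.aestronglyMeasurable hK (fun a => a.2) hg
  have hhs : HasCompactSupport h := by
    refine HasCompactSupport.intro (hs.image continuous_fst) fun x hx => ?_
    have : ∀ u, g (x, u) = 0 := fun u => by
      by_contra hne
      exact hx ⟨(x, u), subset_tsupport _ hne, rfl⟩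
    simp [h, this]
  obtain ⟨Z, hZ, hZi, hZ0⟩ := exists_meromorphic_integral_norm_cpow hr hhd hhs
  refine ⟨Z, hZ, fun s hsre => ?_, hZ0⟩
  have hre : 0 < (s - 2 * r).re := by simpa using hsre
  have hpow : ∀ x : E (2 * r), ((‖x‖ ^ 2 : ℝ) : ℂ) ^ (s / 2 - r) = (‖x‖ : ℂ) ^ (s - 2 * r) := by
    intro x
    rw [Complex.ofReal_pow, ← Complex.cpow_nat_mul' (by
      rw [Complex.arg_ofReal_of_nonneg (norm_nonneg x)]; simp [Real.pi_pos]) (by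
      rw [Complex.arg_ofReal_of_nonneg (norm_nonneg x)]; simp [Real.pi_pos.le])]
    congr 1; push_cast; ring
  have hc : Continuous fun z : E (2 * r) × E k => (‖z.1‖ : ℂ) ^ (s - 2 * r) * g z :=
    ((continuous_norm_cpow hre).comp continuous_fst).mul hg.continuous
  rw [hZi s hsre]
  simp only [hpow]
  rw [Measure.volume_eq_prod, integral_prod _ (hc.integrable_of_hasCompactSupport hs.mul_left)]
  simp only [integral_const_mul, h]

/-! ### The splitting of a Euclidean space -/

/-- The identification `ℝ^m × ℝ^k ≃ ℝ^(m + k)`. -/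
def joinEquiv (m k : ℕ) : (E m × E k) ≃L[ℝ] E (m + k) :=
  (EuclideanSpace.finAddEquivProd (𝕜 := ℝ) (n := m) (m := k)).symm

theorem joinEquiv_stdVec_left {m k : ℕ} (a : Fin m) :
    joinEquiv m k (stdVec m a, 0) = stdVec (m + k) (Fin.castAdd k a) := by
  unfold joinEquiv
  rw [ContinuousLinearEquiv.symm_apply_eq]
  ext b <;> simp [stdVec, EuclideanSpace.finAddEquivProd]

theorem joinEquiv_stdVec_right {m k : ℕ} (b : Fin k) :
    joinEquiv m k (0, stdVec k b) = stdVec (m + k) (Fin.natAdd m b) := by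
  unfold joinEquiv
  rw [ContinuousLinearEquiv.symm_apply_eq]
  ext b <;> simp [stdVec, EuclideanSpace.finAddEquivProd]

theorem measurePreserving_joinEquiv (m k : ℕ) :
    MeasurePreserving (joinEquiv m k) volume volume := by
  have h1 : MeasurePreserving (EuclideanSpace.finAddEquivProd (𝕜 := ℝ) (n := m) (m := k))
      volume volume := by
    have h2 := (WithLp.volume_preserving_ofLp (E m) (E k)).comp
      ((PiLp.sumPiLpEquivProdLpPiLp (𝕜 := ℝ) (ι := Fin m) (κ := Fin k) 2
        (fun _ => ℝ)).measurePreserving.comp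
        (LinearIsometryEquiv.piLpCongrLeft 2 ℝ ℝ (finSumFinEquiv (m := m)
          (n := k)).symm).measurePreserving)
    exact h2
  exact h1.symm (EuclideanSpace.finAddEquivProd (𝕜 := ℝ) (n := m) (m := k)).toHomeomorph.toMeasurableEquiv

/-! ### Residues at zero of meromorphic continuations -/

/-- The function `f`, given on a right half plane, extends to a meromorphic function on the plane
with at most a simple pole at `0`, of residue `c`. -/
def HasResidueZero (f : ℂ → ℂ) (c : ℂ) : Prop :=
  ∃ Z : ℂ → ℂ, Meromorphic Z ∧ (∃ C : ℝ, ∀ s : ℂ, C < s.re → Z s = f s) ∧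
    Tendsto (fun s => s * Z s) (𝓝[≠] 0) (𝓝 c)

theorem HasResidueZero.congr {f g : ℂ → ℂ} {c : ℂ} (hf : HasResidueZero f c) {C : ℝ}
    (h : ∀ s : ℂ, C < s.re → f s = g s) : HasResidueZero g c := by
  obtain ⟨Z, hZ, ⟨C', hC'⟩, hc⟩ := hf
  exact ⟨Z, hZ, ⟨max C C', fun s hs => by
    rw [hC' s (lt_of_le_of_lt (le_max_right _ _) hs), h s (lt_of_le_of_lt (le_max_left _ _) hs)]⟩,
    hc⟩

theorem HasResidueZero.zero : HasResidueZero (fun _ => 0) 0 :=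
  ⟨fun _ => 0, fun _ => MeromorphicAt.const 0 _, ⟨0, fun _ _ => rfl⟩, by simp⟩

theorem HasResidueZero.add {f g : ℂ → ℂ} {c d : ℂ} (hf : HasResidueZero f c)
    (hg : HasResidueZero g d) : HasResidueZero (fun s => f s + g s) (c + d) := by
  obtain ⟨Z, hZ, ⟨C, hC⟩, hc⟩ := hf
  obtain ⟨Z', hZ', ⟨C', hC'⟩, hc'⟩ := hg
  refine ⟨fun s => Z s + Z' s, fun s => (hZ s).add (hZ' s), ⟨max C C', fun s hs => ?_⟩, ?_⟩
  · simp only [hC s (lt_of_le_of_lt (le_max_left _ _) hs),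
      hC' s (lt_of_le_of_lt (le_max_right _ _) hs)]
  · simpa only [mul_add] using hc.add hc'

theorem HasResidueZero.sum {ι : Type*} (t : Finset ι) {f : ι → ℂ → ℂ} {c : ι → ℂ}
    (h : ∀ a ∈ t, HasResidueZero (f a) (c a)) :
    HasResidueZero (fun s => ∑ a ∈ t, f a s) (∑ a ∈ t, c a) := by
  classical
  induction t using Finset.induction_on with
  | empty => simpa using HasResidueZero.zero
  | insert a t ha ih =>
    simp only [Finset.sum_insert ha]
    exact (h a (by simp)).add (ih fun b hb => h b (by simp [hb]))

/-- By the identity theorem, the residue is determined by the function on a half plane. -/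
theorem HasResidueZero.unique {f : ℂ → ℂ} {c d : ℂ} (hf : HasResidueZero f c)
    (hg : HasResidueZero f d) : c = d := by
  obtain ⟨Z, hZ, ⟨C, hC⟩, hc⟩ := hf
  obtain ⟨Z', hZ', ⟨C', hC'⟩, hc'⟩ := hg
  have hm : Meromorphic fun s => Z s - Z' s := fun s => (hZ s).sub (hZ' s)
  have hmo : MeromorphicOn (fun s => Z s - Z' s) univ := fun s _ => hm s
  have h1 : meromorphicOrderAt (fun s => Z s - Z' s) ((max C C' + 1 : ℝ) : ℂ) = ⊤ := by
    rw [meromorphicOrderAt_eq_top_iff]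
    refine Filter.Eventually.filter_mono nhdsWithin_le_nhds ?_
    have : ∀ᶠ s : ℂ in 𝓝 ((max C C' + 1 : ℝ) : ℂ), max C C' < s.re :=
      Complex.continuous_re.continuousAt.eventually (lt_mem_nhds (by simp))
    filter_upwards [this] with s hs
    rw [hC s (lt_of_le_of_lt (le_max_left _ _) hs), hC' s (lt_of_le_of_lt (le_max_right _ _) hs),
      sub_self]
  have h0 : meromorphicOrderAt (fun s => Z s - Z' s) 0 = ⊤ := by
    by_contra hne
    have := (hmo.exists_meromorphicOrderAt_ne_top_iff_forall isConnected_univ).1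
      ⟨⟨0, mem_univ _⟩, hne⟩ ⟨_, mem_univ ((max C C' + 1 : ℝ) : ℂ)⟩
    exact this h1
  rw [meromorphicOrderAt_eq_top_iff] at h0
  refine tendsto_nhds_unique hc (hc'.congr' ?_)
  filter_upwards [h0] with s hs
  rw [sub_eq_zero.1 hs]

/-- Integrals of complex powers of a positive function are entire functions of the exponent. -/
theorem differentiable_integral_cpow {V : Type*} [NormedAddCommGroup V] [MeasurableSpace V]
    [BorelSpace V] [SecondCountableTopology V] {ν : Measure V} [IsFiniteMeasureOnCompacts ν]
    {K : Set V} (hK : IsCompact K)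
    {m : V → ℝ} (hm : ContinuousOn m K) (hpos : ∀ z ∈ K, 0 < m z) {g : V → ℂ}
    (hg : ContinuousOn g K) (r : ℂ) :
    Differentiable ℂ fun s : ℂ => ∫ z in K, (m z : ℂ) ^ (s / 2 - r) * g z ∂ν := by
  have hKm : MeasurableSet K := hK.measurableSet
  have : IsFiniteMeasure (ν.restrict K) := ⟨by simpa using hK.measure_lt_top⟩
  have hlog : ContinuousOn (fun z => Complex.log (m z)) K := by
    have h1 : ContinuousOn (fun z => ((Real.log (m z) : ℝ) : ℂ)) K :=
      Complex.continuous_ofReal.comp_continuousOn (hm.log fun z hz => (hpos z hz).ne')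
    exact h1.congr fun z hz => (Complex.ofReal_log (hpos z hz).le).symm
  have hcp : ∀ s : ℂ, ContinuousOn (fun z => (m z : ℂ) ^ (s / 2 - r) * g z) K := fun s =>
    ((hlog.mul (continuousOn_const (c := s / 2 - r))).cexp.congr fun z hz => by
      rw [Complex.cpow_def_of_ne_zero (by exact_mod_cast (hpos z hz).ne')]; rfl).mul hg
  obtain ⟨L, hL⟩ := hK.exists_bound_of_continuousOn hlog
  obtain ⟨B, hB⟩ := hK.exists_bound_of_continuousOn hg
  intro s₀
  have hd : ∀ z ∈ K, ∀ s : ℂ, HasDerivAt (fun s : ℂ => (m z : ℂ) ^ (s / 2 - r) * g z)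
      (Complex.log (m z) * 2⁻¹ * ((m z : ℂ) ^ (s / 2 - r) * g z)) s := by
    intro z hz s
    have h0 : (m z : ℂ) ≠ 0 := by exact_mod_cast (hpos z hz).ne'
    have h1 : HasDerivAt (fun s : ℂ => s / 2 - r) (2⁻¹) s := by
      simpa using ((hasDerivAt_id s).div_const 2).sub_const r
    convert! (h1.const_cpow (Or.inl h0)).mul_const (g z) using 1
    ring
  refine (hasDerivAt_integral_of_dominated_loc_of_deriv_le (μ := ν.restrict K)
    (bound := fun _ => L * 2⁻¹ * (Real.exp (L * ((‖s₀‖ + 1) / 2 + ‖r‖)) * B))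
    (F' := fun s z => Complex.log (m z) * 2⁻¹ * ((m z : ℂ) ^ (s / 2 - r) * g z))
    (Metric.ball_mem_nhds s₀ one_pos)
    (Eventually.of_forall fun s => (hcp s).aestronglyMeasurable hKm)
    ((hcp s₀).integrableOn_compact hK)
    (((hlog.mul continuousOn_const).mul (hcp s₀)).aestronglyMeasurable hKm) ?_
    (integrable_const _) ?_).2.differentiableAt
  · filter_upwards [ae_restrict_mem hKm] with z hz s hs
    have hs1 : ‖s‖ ≤ ‖s₀‖ + 1 := by
      have : ‖s - s₀‖ < 1 := by simpa [dist_eq_norm] using hs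
      have := norm_sub_norm_le s s₀
      linarith
    have hL0 : 0 ≤ L := (norm_nonneg _).trans (hL z hz)
    have h0 : (m z : ℂ) ≠ 0 := by exact_mod_cast (hpos z hz).ne'
    rw [norm_mul, norm_mul, norm_mul, Complex.cpow_def_of_ne_zero h0]
    have hn : ‖Complex.exp (Complex.log (m z) * (s / 2 - r))‖ ≤
        Real.exp (L * ((‖s₀‖ + 1) / 2 + ‖r‖)) := by
      refine (Complex.norm_exp_le_exp_norm _).trans (Real.exp_le_exp.2 ?_)
      rw [norm_mul]
      refine mul_le_mul (hL z hz) ?_ (norm_nonneg _) hL0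
      refine (norm_sub_le _ _).trans ?_
      rw [norm_div]
      simp only [Complex.norm_ofNat]
      gcongr
    have h2 : ‖(2⁻¹ : ℂ)‖ = 2⁻¹ := by simp
    rw [h2]
    gcongr
    · exact hL z hz
    · exact hB z hz
  · filter_upwards [ae_restrict_mem hKm] with z hz s _ using hd z hz s

/-- Entire functions contribute nothing to the residue. -/
theorem HasResidueZero.of_differentiable {f : ℂ → ℂ} (hf : Differentiable ℂ f) :
    HasResidueZero f 0 := by
  refine ⟨f, fun s => (hf.analyticAt s).meromorphicAt, ⟨0, fun _ _ => rfl⟩, ?_⟩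
  have : Tendsto (fun s : ℂ => s * f s) (𝓝 0) (𝓝 (0 * f 0)) :=
    (continuous_id.mul hf.continuous).continuousAt
  rw [zero_mul] at this
  exact this.mono_left nhdsWithin_le_nhds

/-! ### Algebra of the wedge product -/

theorem append_comp_finSumFinEquiv {T : Type*} {p q : ℕ} (x : Fin p → T)
    (y : Fin q → T) :
    (fun i => Fin.append x y (finSumFinEquiv i)) = Sum.elim x y := by
  ext i; rcases i with i | i <;> simp

section Algebra

variable {T T' : Type*} [AddCommGroup T] [Module ℝ T] [AddCommGroup T'] [Module ℝ T']

/-- The wedge product, with arbitrary finite index types for the arguments. -/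
def sumWedge {ι κ : Type*} [Fintype ι] [Fintype κ] [DecidableEq ι] [DecidableEq κ]
    (a : T [⋀^ι]→ₗ[ℝ] ℂ) (b : T [⋀^κ]→ₗ[ℝ] ℂ) : T [⋀^ι ⊕ κ]→ₗ[ℝ] ℂ :=
  (LinearMap.mul' ℝ ℂ).compAlternatingMap (a.domCoprod b)

/-- The tensor product of complex valued multilinear forms. -/
def mulMultilinear {ι κ : Type*} (a : MultilinearMap ℝ (fun _ : ι => T) ℂ)
    (b : MultilinearMap ℝ (fun _ : κ => T) ℂ) : MultilinearMap ℝ (fun _ : ι ⊕ κ => T) ℂ :=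
  (LinearMap.mul' ℝ ℂ).compMultilinearMap (a.domCoprod b)

theorem mulMultilinear_apply {ι κ : Type*} (a : MultilinearMap ℝ (fun _ : ι => T) ℂ)
    (b : MultilinearMap ℝ (fun _ : κ => T) ℂ) (v : ι ⊕ κ → T) :
    mulMultilinear a b v = a (fun i => v (Sum.inl i)) * b (fun i => v (Sum.inr i)) := rfl

section

variable {ι κ τ : Type*} [Fintype ι] [Fintype κ] [Fintype τ] [DecidableEq ι] [DecidableEq κ]
  [DecidableEq τ]

/-- The wedge product of two alternatizations is the alternatization of the tensor product. In this
form associativity is inherited from the tensor product. -/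
theorem sumWedge_alternatization (a : MultilinearMap ℝ (fun _ : ι => T) ℂ)
    (b : MultilinearMap ℝ (fun _ : κ => T) ℂ) :
    sumWedge (MultilinearMap.alternatization a) (MultilinearMap.alternatization b) =
      MultilinearMap.alternatization (mulMultilinear a b) := by
  unfold sumWedge mulMultilinear
  rw [← MultilinearMap.domCoprod_alternization, LinearMap.compMultilinearMap_alternatization]

/-- Up to factorials, the wedge product is the alternatization of the tensor product. -/
theorem sumWedge_eq_alternatization (a : T [⋀^ι]→ₗ[ℝ] ℂ) (b : T [⋀^κ]→ₗ[ℝ] ℂ) :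
    ((Fintype.card ι).factorial * (Fintype.card κ).factorial) • sumWedge a b =
      MultilinearMap.alternatization (mulMultilinear (a : MultilinearMap ℝ (fun _ : ι => T) ℂ)
        (b : MultilinearMap ℝ (fun _ : κ => T) ℂ)) := by
  unfold sumWedge mulMultilinear
  rw [LinearMap.compMultilinearMap_alternatization, MultilinearMap.domCoprod_alternization_eq]
  ext v
  simp

/-- The wedge product as a sum over all permutations, divided by the order of the subgroup that
preserves the two blocks. -/
theorem sumWedge_apply (a : T [⋀^ι]→ₗ[ℝ] ℂ) (b : T [⋀^κ]→ₗ[ℝ] ℂ) (v : ι ⊕ κ → T) :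
    sumWedge a b v =
      (((Fintype.card ι).factorial * (Fintype.card κ).factorial : ℕ) : ℂ)⁻¹ *
        ∑ σ : Equiv.Perm (ι ⊕ κ), ((Equiv.Perm.sign σ : ℤ) : ℂ) *
          (a (fun i => v (σ (Sum.inl i))) * b (fun i => v (σ (Sum.inr i)))) := by
  have h := congrArg (fun f => f v) (sumWedge_eq_alternatization a b)
  simp only [AlternatingMap.smul_apply, nsmul_eq_mul, MultilinearMap.alternatization_apply] at h
  rw [eq_inv_mul_iff_mul_eq₀ (by
    exact_mod_cast mul_ne_zero (Nat.factorial_ne_zero _) (Nat.factorial_ne_zero _)), h]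
  refine Finset.sum_congr rfl fun σ _ => ?_
  rw [MultilinearMap.domDomCongr_apply, mulMultilinear_apply, Units.smul_def, zsmul_eq_mul]
  rfl

theorem sumWedge_nsmul_left (N : ℕ) (a : T [⋀^ι]→ₗ[ℝ] ℂ) (b : T [⋀^κ]→ₗ[ℝ] ℂ) :
    sumWedge (N • a) b = N • sumWedge a b := by
  ext v
  simp only [sumWedge_apply, AlternatingMap.smul_apply, nsmul_eq_mul, Finset.mul_sum]
  exact Finset.sum_congr rfl fun σ _ => by ring

theorem sumWedge_nsmul_right (N : ℕ) (a : T [⋀^ι]→ₗ[ℝ] ℂ) (b : T [⋀^κ]→ₗ[ℝ] ℂ) :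
    sumWedge a (N • b) = N • sumWedge a b := by
  ext v
  simp only [sumWedge_apply, AlternatingMap.smul_apply, nsmul_eq_mul, Finset.mul_sum]
  exact Finset.sum_congr rfl fun σ _ => by ring

theorem alternatization_domDomCongr (e : ι ≃ κ) (a : MultilinearMap ℝ (fun _ : ι => T) ℂ) :
    MultilinearMap.alternatization (a.domDomCongr e) =
      (MultilinearMap.alternatization a).domDomCongr e := by
  ext v
  simp only [MultilinearMap.alternatization_apply, AlternatingMap.domDomCongr_apply,
    MultilinearMap.domDomCongr_apply]
  refine Fintype.sum_equiv e.symm.permCongr _ _ fun σ => ?_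
  simp [Equiv.permCongr_apply]

/-- Associativity of the wedge product. Every alternating form is, up to a factorial, an
alternatization, so that it suffices to multiply alternatizations. -/
theorem sumWedge_assoc (a : T [⋀^ι]→ₗ[ℝ] ℂ) (b : T [⋀^κ]→ₗ[ℝ] ℂ) (c : T [⋀^τ]→ₗ[ℝ] ℂ) :
    (sumWedge (sumWedge a b) c).domDomCongr (Equiv.sumAssoc ι κ τ) =
      sumWedge a (sumWedge b c) := by
  set A := (Fintype.card ι).factorial
  set B := (Fintype.card κ).factorial
  set C := (Fintype.card τ).factorial
  have hA : A • a = MultilinearMap.alternatization (a : MultilinearMap ℝ (fun _ : ι => T) ℂ) :=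
    (AlternatingMap.coe_alternatization a).symm
  have hB : B • b = MultilinearMap.alternatization (b : MultilinearMap ℝ (fun _ : κ => T) ℂ) :=
    (AlternatingMap.coe_alternatization b).symm
  have hC : C • c = MultilinearMap.alternatization (c : MultilinearMap ℝ (fun _ : τ => T) ℂ) :=
    (AlternatingMap.coe_alternatization c).symm
  have key : (sumWedge (sumWedge (A • a) (B • b)) (C • c)).domDomCongr (Equiv.sumAssoc ι κ τ) =
      sumWedge (A • a) (sumWedge (B • b) (C • c)) := by
    rw [hA, hB, hC, sumWedge_alternatization, sumWedge_alternatization, sumWedge_alternatization,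
      sumWedge_alternatization, ← alternatization_domDomCongr]
    congr 1
    ext v
    simp only [MultilinearMap.domDomCongr_apply, mulMultilinear_apply, mul_assoc]
    rfl
  ext v
  have h := congrArg (fun f => f v) key
  simp only [sumWedge_nsmul_left, sumWedge_nsmul_right, AlternatingMap.domDomCongr_apply,
    AlternatingMap.smul_apply, nsmul_eq_mul] at h ⊢
  have hA0 : (A : ℂ) ≠ 0 := by exact_mod_cast Nat.factorial_ne_zero _
  have hB0 : (B : ℂ) ≠ 0 := by exact_mod_cast Nat.factorial_ne_zero _
  have hC0 : (C : ℂ) ≠ 0 := by exact_mod_cast Nat.factorial_ne_zero _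
  field_simp at h
  exact h

theorem sumWedge_domDomCongr {ι' κ' : Type*} [Fintype ι'] [Fintype κ'] [DecidableEq ι']
    [DecidableEq κ'] (e : ι ≃ ι') (e' : κ ≃ κ') (a : T [⋀^ι]→ₗ[ℝ] ℂ) (b : T [⋀^κ]→ₗ[ℝ] ℂ) :
    sumWedge (a.domDomCongr e) (b.domDomCongr e') =
      (sumWedge a b).domDomCongr (Equiv.sumCongr e e') := by
  ext v
  rw [AlternatingMap.domDomCongr_apply, sumWedge_apply, sumWedge_apply, Fintype.card_congr e,
    Fintype.card_congr e']
  congr 1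
  refine Fintype.sum_equiv (Equiv.sumCongr e e').symm.permCongr _ _ fun σ => ?_
  rw [Equiv.Perm.sign_permCongr]
  simp [Equiv.permCongr_apply]
  rfl

/-- If the products belonging to nontrivial shuffles vanish, `a ∧ b` is the product of the values
of `a` and `b`. -/
theorem sumWedge_eq_mul (a : T [⋀^ι]→ₗ[ℝ] ℂ) (b : T [⋀^κ]→ₗ[ℝ] ℂ) (v : ι ⊕ κ → T)
    (h : ∀ σ : Equiv.Perm (ι ⊕ κ), (∃ i j, σ (Sum.inl i) = Sum.inr j) →
      a (fun i => v (σ (Sum.inl i))) * b (fun j => v (σ (Sum.inr j))) = 0) :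
    sumWedge a b v = a (fun i => v (Sum.inl i)) * b (fun j => v (Sum.inr j)) := by
  unfold sumWedge
  rw [LinearMap.compAlternatingMap_apply, AlternatingMap.domCoprod_apply, sum_apply, map_sum]
  refine (Finset.sum_eq_single
    (Quotient.mk'' (1 : Equiv.Perm (ι ⊕ κ)) : Equiv.Perm.ModSumCongr ι κ) ?_ ?_).trans ?_
  · intro σ _ hσ
    induction σ using Quotient.inductionOn' with | _ σ
    rw [AlternatingMap.domCoprod.summand_mk'']
    have hex : ∃ i j, σ (Sum.inl i) = Sum.inr j := by
      by_contra hcon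
      push Not at hcon
      apply hσ
      have hmaps : Set.MapsTo σ (Set.range (Sum.inl : ι → ι ⊕ κ))
          (Set.range (Sum.inl : ι → ι ⊕ κ)) := by
        rintro _ ⟨i, rfl⟩
        rcases hi : σ (Sum.inl i) with i' | j
        · exact ⟨i', rfl⟩
        · exact absurd hi (hcon i j)
      have := Equiv.Perm.mem_sumCongrHom_range_of_perm_mapsTo_inl hmaps
      refine (Quotient.sound' ?_).symm
      rw [QuotientGroup.leftRel_apply]
      simpa using this
    have h0 := h σ hex
    rw [_root_.smul_apply, MultilinearMap.domDomCongr_apply, MultilinearMap.domCoprod_apply,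
      Units.smul_def, map_zsmul, LinearMap.mul'_apply]
    simp only [AlternatingMap.coe_multilinearMap, h0, smul_zero]
  · exact fun hne => absurd (Finset.mem_univ _) hne
  · rw [AlternatingMap.domCoprod.summand_mk'']
    simp

/-- A permutation that moves an element of the first summand to the second one also moves an
element of the second summand to the first one. -/
theorem exists_inr_eq_inl {σ : Equiv.Perm (ι ⊕ κ)} (h : ∃ i j, σ (Sum.inl i) = Sum.inr j) :
    ∃ j i, σ (Sum.inr j) = Sum.inl i := by
  by_contra hcon
  push Not at hcon
  have h1 : ∀ j, ∃ j', σ (Sum.inr j) = Sum.inr j' := fun j => by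
    rcases hj : σ (Sum.inr j) with i | j'
    · exact absurd hj (hcon j i)
    · exact ⟨j', rfl⟩
  choose f hf using h1
  have hfi : Function.Injective f := fun j j' hjj => by
    have := (hf j).trans ((congrArg Sum.inr hjj).trans (hf j').symm)
    simpa using this
  obtain ⟨i, j, hij⟩ := h
  obtain ⟨j', rfl⟩ := Finite.surjective_of_injective hfi j
  rw [← hf j'] at hij
  simp at hij

theorem sumWedge_elim_of_left (a : T [⋀^ι]→ₗ[ℝ] ℂ) (b : T [⋀^κ]→ₗ[ℝ] ℂ) (x : ι → T) (y : κ → T)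
    (h : ∀ (w : ι → T) (i : ι) (j : κ), w i = y j → a w = 0) :
    sumWedge a b (Sum.elim x y) = a x * b y :=
  sumWedge_eq_mul a b _ fun σ ⟨i, j, hij⟩ => by
    rw [h _ i j (by simp [hij]), zero_mul]

theorem sumWedge_elim_of_right (a : T [⋀^ι]→ₗ[ℝ] ℂ) (b : T [⋀^κ]→ₗ[ℝ] ℂ) (x : ι → T) (y : κ → T)
    (h : ∀ (w : κ → T) (i : ι) (j : κ), w j = x i → b w = 0) :
    sumWedge a b (Sum.elim x y) = a x * b y :=
  sumWedge_eq_mul a b _ fun σ hσ => by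
    obtain ⟨j, i, hij⟩ := exists_inr_eq_inl hσ
    rw [h _ i j (by simp [hij]), mul_zero]

end

/-! The same statements for the wedge product of forms indexed by `Fin p` and `Fin q`. -/

variable {p q s d b e : ℕ}

theorem wedgeCast_apply (h : p + q = d) (x : T [⋀^Fin p]→ₗ[ℝ] ℂ) (y : T [⋀^Fin q]→ₗ[ℝ] ℂ)
    (v : Fin d → T) :
    wedgeCast h x y v =
      sumWedge x y fun i => v (finCongr h (finSumFinEquiv i)) := rfl

theorem wedge_apply (x : T [⋀^Fin p]→ₗ[ℝ] ℂ) (y : T [⋀^Fin q]→ₗ[ℝ] ℂ)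
    (v : Fin (p + q) → T) :
    wedge x y v = sumWedge x y fun i => v (finSumFinEquiv i) := rfl

theorem wedgeCast_rfl (x : T [⋀^Fin p]→ₗ[ℝ] ℂ) (y : T [⋀^Fin q]→ₗ[ℝ] ℂ) :
    wedgeCast rfl x y = wedge x y := rfl

theorem wedgeCast_assoc (h₁ : p + q = b) (h₂ : b + s = d) (h₃ : q + s = e) (h₄ : p + e = d)
    (x : T [⋀^Fin p]→ₗ[ℝ] ℂ) (y : T [⋀^Fin q]→ₗ[ℝ] ℂ) (z : T [⋀^Fin s]→ₗ[ℝ] ℂ) :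
    wedgeCast h₂ (wedgeCast h₁ x y) z = wedgeCast h₄ x (wedgeCast h₃ y z) := by
  subst h₁ h₂ h₃
  have hl : sumWedge (wedgeCast rfl x y) z =
      (sumWedge (sumWedge x y) z).domDomCongr (Equiv.sumCongr finSumFinEquiv (Equiv.refl _)) :=
    sumWedge_domDomCongr finSumFinEquiv (Equiv.refl _) (sumWedge x y) z
  have hr : sumWedge x (wedgeCast rfl y z) =
      (sumWedge x (sumWedge y z)).domDomCongr (Equiv.sumCongr (Equiv.refl _) finSumFinEquiv) :=
    sumWedge_domDomCongr (Equiv.refl _) finSumFinEquiv x (sumWedge y z)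
  ext v
  rw [wedgeCast_apply, wedgeCast_apply, hl, hr, ← sumWedge_assoc]
  simp only [AlternatingMap.domDomCongr_apply]
  congr 1
  ext i
  rcases i with (i | i) | i <;> exact congrArg v (Fin.ext (by simp [add_assoc]))

theorem compLinearMap_wedgeCast (h : p + q = d) (x : T [⋀^Fin p]→ₗ[ℝ] ℂ)
    (y : T [⋀^Fin q]→ₗ[ℝ] ℂ) (f : T' →ₗ[ℝ] T) :
    (wedgeCast h x y).compLinearMap f = wedgeCast h (x.compLinearMap f) (y.compLinearMap f) := by
  ext v
  rw [AlternatingMap.compLinearMap_apply, wedgeCast_apply, wedgeCast_apply, sumWedge_apply,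
    sumWedge_apply]
  rfl

theorem compLinearMap_wedge (x : T [⋀^Fin p]→ₗ[ℝ] ℂ)
    (y : T [⋀^Fin q]→ₗ[ℝ] ℂ) (f : T' →ₗ[ℝ] T) :
    (wedge x y).compLinearMap f = wedge (x.compLinearMap f) (y.compLinearMap f) :=
  compLinearMap_wedgeCast rfl x y f

theorem wedgeCast_smul_left (h : p + q = d) (c : ℝ) (x : T [⋀^Fin p]→ₗ[ℝ] ℂ)
    (y : T [⋀^Fin q]→ₗ[ℝ] ℂ) : wedgeCast h (c • x) y = c • wedgeCast h x y := by
  ext v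
  simp only [wedgeCast_apply, AlternatingMap.smul_apply, sumWedge_apply, Complex.real_smul,
    Finset.mul_sum]
  exact Finset.sum_congr rfl fun σ _ => by ring

theorem wedgeCast_smul_right (h : p + q = d) (c : ℝ) (x : T [⋀^Fin p]→ₗ[ℝ] ℂ)
    (y : T [⋀^Fin q]→ₗ[ℝ] ℂ) : wedgeCast h x (c • y) = c • wedgeCast h x y := by
  ext v
  simp only [wedgeCast_apply, AlternatingMap.smul_apply, sumWedge_apply, Complex.real_smul,
    Finset.mul_sum]
  exact Finset.sum_congr rfl fun σ _ => by ring

theorem wedgeCast_sub_left (h : p + q = d) (x x' : T [⋀^Fin p]→ₗ[ℝ] ℂ)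
    (y : T [⋀^Fin q]→ₗ[ℝ] ℂ) : wedgeCast h (x - x') y = wedgeCast h x y - wedgeCast h x' y := by
  ext v
  simp only [wedgeCast_apply, AlternatingMap.sub_apply, sumWedge_apply, ← mul_sub,
    ← Finset.sum_sub_distrib, sub_mul]

theorem wedgeCast_zero_left (h : p + q = d) (y : T [⋀^Fin q]→ₗ[ℝ] ℂ) :
    wedgeCast h (0 : T [⋀^Fin p]→ₗ[ℝ] ℂ) y = 0 := by
  simpa using wedgeCast_smul_left h 0 0 y

theorem wedgeCast_zero_right (h : p + q = d) (x : T [⋀^Fin p]→ₗ[ℝ] ℂ) :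
    wedgeCast h x (0 : T [⋀^Fin q]→ₗ[ℝ] ℂ) = 0 := by
  simpa using wedgeCast_smul_right h 0 x 0

/-- If `a` vanishes as soon as one of its arguments is one of the `y j`, only the trivial shuffle
contributes to `(a ∧ b)(x, y)`. -/
theorem wedge_append_of_left (a : T [⋀^Fin p]→ₗ[ℝ] ℂ) (b : T [⋀^Fin q]→ₗ[ℝ] ℂ) (x : Fin p → T)
    (y : Fin q → T) (h : ∀ (w : Fin p → T) (i : Fin p) (j : Fin q), w i = y j → a w = 0) :
    wedge a b (Fin.append x y) = a x * b y := by
  rw [wedge_apply, append_comp_finSumFinEquiv, sumWedge_elim_of_left a b x y h]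

/-- If `b` vanishes as soon as one of its arguments is one of the `x i`, only the trivial shuffle
contributes to `(a ∧ b)(x, y)`. -/
theorem wedge_append_of_right (a : T [⋀^Fin p]→ₗ[ℝ] ℂ) (b : T [⋀^Fin q]→ₗ[ℝ] ℂ) (x : Fin p → T)
    (y : Fin q → T) (h : ∀ (w : Fin q → T) (i : Fin p) (j : Fin q), w j = x i → b w = 0) :
    wedge a b (Fin.append x y) = a x * b y := by
  rw [wedge_apply, append_comp_finSumFinEquiv, sumWedge_elim_of_right a b x y h]

end Algebra

/-- A form of top degree is multiplied by the determinant under pullback. -/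
theorem map_comp_stdVec {d : ℕ} (Θ : E d [⋀^Fin d]→ₗ[ℝ] ℂ) (f : E d →ₗ[ℝ] E d) :
    Θ (fun a => f (stdVec d a)) = LinearMap.det f • Θ (stdVec d) := by
  set B := (EuclideanSpace.basisFun (Fin d) ℝ).toBasis with hB
  have hBs : ⇑B = stdVec d := by
    ext a; simp [B, stdVec]
  have key : ∀ Θ' : E d [⋀^Fin d]→ₗ[ℝ] ℝ, Θ' (fun a => f (stdVec d a)) =
      LinearMap.det f * Θ' (stdVec d) := by
    intro Θ'
    conv_lhs => rw [Θ'.eq_smul_basis_det B]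
    rw [AlternatingMap.smul_apply, ← hBs]
    have := B.det_comp f B
    rw [Module.Basis.det_self, mul_one] at this
    change _ • B.det (f ∘ B) = _
    rw [this, smul_eq_mul, mul_comm]
  have h1 := key (Complex.reLm.compAlternatingMap Θ)
  have h2 := key (Complex.imLm.compAlternatingMap Θ)
  apply Complex.ext
  · simpa using h1
  · simpa using h2

/-! ### Forms on a product space annihilated by normal covectors -/

section Normal

variable {m k p q : ℕ}

/-- The `b`-th coordinate covector on the first factor of `ℝ^m × ℝ^k`. -/
def normalCovector (m k : ℕ) (b : Fin m) : (E m × E k) [⋀^Fin 1]→ₗ[ℝ] ℂ :=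
  AlternatingMap.ofSubsingleton ℝ (E m × E k) ℂ (0 : Fin 1)
    (Complex.ofRealCLM.toLinearMap ∘ₗ (EuclideanSpace.proj b : E m →L[ℝ] ℝ).toLinearMap ∘ₗ
      LinearMap.fst ℝ (E m) (E k))

theorem normalCovector_apply (b : Fin m) (v : Fin 1 → E m × E k) :
    normalCovector m k b v = (((v 0).1 b : ℝ) : ℂ) := rfl

/-- The volume form `dx₁ ∧ ⋯ ∧ dx_m` of the first factor of `ℝ^m × ℝ^k`. -/
def normalVol (m k : ℕ) : (E m × E k) [⋀^Fin m]→ₗ[ℝ] ℂ :=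
  Complex.ofRealCLM.toLinearMap.compAlternatingMap
    ((Matrix.detRowAlternating (n := Fin m) (R := ℝ)).compLinearMap
      (LinearMap.pi fun b => (EuclideanSpace.proj b : E m →L[ℝ] ℝ).toLinearMap ∘ₗ
        LinearMap.fst ℝ (E m) (E k)))

theorem normalVol_apply (v : Fin m → E m × E k) :
    normalVol m k v = ((Matrix.of fun a b => (v a).1 b).det : ℂ) := rfl

theorem normalVol_eq_zero_of_fst (v : Fin m → E m × E k) (i : Fin m) (h : (v i).1 = 0) :
    normalVol m k v = 0 := by
  rw [normalVol_apply, Matrix.det_eq_zero_of_row_eq_zero i (by simp [h])]; simp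

theorem normalVol_eq_zero_of_coord (v : Fin m → E m × E k) (b : Fin m) (h : ∀ i, (v i).1 b = 0) :
    normalVol m k v = 0 := by
  rw [normalVol_apply, Matrix.det_eq_zero_of_column_eq_zero b (by simp [h])]; simp

theorem normalVol_std : normalVol m k (fun a => (stdVec m a, 0)) = 1 := by
  rw [normalVol_apply]
  have : (Matrix.of fun a b : Fin m => (stdVec m a) b) = 1 := by
    ext a b
    simp [stdVec, Matrix.one_apply, eq_comm]
  simp [this]

/-- Contraction of `dx₁ ∧ ⋯ ∧ dx_m ∧ y` with the standard frame of the first factor. -/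
theorem wedge_normalVol_append (y : (E m × E k) [⋀^Fin q]→ₗ[ℝ] ℂ) (t : Fin q → E k) :
    wedge (normalVol m k) y (Fin.append (fun a => (stdVec m a, 0)) fun j => (0, t j)) =
      y fun j => (0, t j) := by
  rw [wedge_append_of_left, normalVol_std, one_mul]
  intro w i j h
  exact normalVol_eq_zero_of_fst w i (by rw [h])

/-- A form annihilated by the `b`-th normal covector vanishes on vectors whose `b`-th normal
coordinates vanish. -/
theorem eq_zero_of_wedge_normalCovector (ψ : (E m × E k) [⋀^Fin p]→ₗ[ℝ] ℂ) (b : Fin m)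
    (h : wedge (normalCovector m k b) ψ = 0) (v : Fin p → E m × E k)
    (hv : ∀ i, (v i).1 b = 0) : ψ v = 0 := by
  have h1 := wedge_append_of_left (normalCovector m k b) ψ (fun _ => (stdVec m b, 0)) v
    (fun w i j hw => by
      have : i = 0 := Subsingleton.elim _ _
      subst this
      rw [normalCovector_apply, hw, hv]; simp)
  rw [h, normalCovector_apply] at h1
  simpa [stdVec] using h1.symm

/-- The standard basis of `ℝ^m × ℝ^k`. -/
def prodBasis (m k : ℕ) : Module.Basis (Fin m ⊕ Fin k) ℝ (E m × E k) :=
  (EuclideanSpace.basisFun (Fin m) ℝ).toBasis.prod (EuclideanSpace.basisFun (Fin k) ℝ).toBasis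

theorem prodBasis_inl (a : Fin m) : prodBasis m k (Sum.inl a) = (stdVec m a, 0) := by
  simp [prodBasis, stdVec]

theorem prodBasis_inr (b : Fin k) : prodBasis m k (Sum.inr b) = (0, stdVec k b) := by
  simp [prodBasis, stdVec]

theorem prodBasis_fst_eq_zero {i : Fin m ⊕ Fin k} {b : Fin m} (h : i ≠ Sum.inl b) :
    (prodBasis m k i).1 b = 0 := by
  rcases i with a | j
  · rw [prodBasis_inl]
    have : b ≠ a := fun hab => h (by rw [hab])
    simp [stdVec, this]
  · simp [prodBasis_inr]

/-- Among fewer than `m` basis vectors, one of the `m` normal directions is missing; hence a form of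
degree less than `m` annihilated by all normal covectors vanishes. -/
theorem eq_zero_of_wedge_normalCovector_of_lt (hp : p < m) (ψ : (E m × E k) [⋀^Fin p]→ₗ[ℝ] ℂ)
    (h : ∀ b, wedge (normalCovector m k b) ψ = 0) : ψ = 0 := by
  refine (prodBasis m k).ext_alternating fun f hf => ?_
  have : ∃ b : Fin m, ∀ i, f i ≠ Sum.inl b := by
    by_contra hcon
    push Not at hcon
    choose s hs using hcon
    have hsi : Function.Injective s := fun a b hab => by
      have := (hs a).symm.trans ((congrArg f hab).trans (hs b))
      simpa using this
    have := Fintype.card_le_of_injective s hsi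
    simp at this
    omega
  obtain ⟨b, hb⟩ := this
  exact eq_zero_of_wedge_normalCovector ψ b (h b) _ fun i => prodBasis_fst_eq_zero (hb i)

/-- A form annihilated by all normal covectors is divisible by the normal volume form; the
quotient `β` matters only on the second factor, where it is the contraction of the form with the
standard frame of the first factor. -/
theorem eq_wedge_normalVol (ψ : (E m × E k) [⋀^Fin (m + q)]→ₗ[ℝ] ℂ)
    (h : ∀ b, wedge (normalCovector m k b) ψ = 0) (β : (E m × E k) [⋀^Fin q]→ₗ[ℝ] ℂ)
    (hβ : ∀ t : Fin q → E k, β (fun j => (0, t j)) =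
      ψ (Fin.append (fun a => (stdVec m a, 0)) fun j => (0, t j))) :
    ψ = wedge (normalVol m k) β := by
  refine (prodBasis m k).ext_alternating fun f hf => ?_
  by_cases hex : ∃ b : Fin m, ∀ i, f i ≠ Sum.inl b
  · obtain ⟨b, hb⟩ := hex
    rw [eq_zero_of_wedge_normalCovector ψ b (h b) _ fun i => prodBasis_fst_eq_zero (hb i),
      wedge_apply, sumWedge_apply]
    rw [Finset.sum_eq_zero, mul_zero]
    intro σ _
    rw [normalVol_eq_zero_of_coord _ b fun i => prodBasis_fst_eq_zero (hb _), zero_mul, mul_zero]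
  · push Not at hex
    choose s hs using hex
    have hsi : Function.Injective s := fun a b hab => by
      have := (hs a).symm.trans ((congrArg f hab).trans (hs b))
      simpa using this
    -- Reorder the arguments so that the normal basis vectors come first.
    have hcard : Fintype.card ((Set.range s)ᶜ : Set (Fin (m + q))) = q := by
      rw [Fintype.card_compl_set, Set.card_range_of_injective hsi]
      simp
    let e₁ : Fin m ≃ Set.range s := Equiv.ofInjective s hsi
    let e₂ : Fin q ≃ ((Set.range s)ᶜ : Set (Fin (m + q))) := (Fintype.equivFinOfCardEq hcard).symm
    let π : Equiv.Perm (Fin (m + q)) := finSumFinEquiv.symm.trans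
      ((Equiv.sumCongr e₁ e₂).trans (Equiv.Set.sumCompl (Set.range s)))
    have hπl : ∀ a, π (Fin.castAdd q a) = s a := fun a => by simp [π, e₁]
    have hπr : ∀ j, ∃ c, f (π (Fin.natAdd m j)) = Sum.inr c := by
      intro j
      have h1 : π (Fin.natAdd m j) = e₂ j := by simp [π]
      rcases hc : f (π (Fin.natAdd m j)) with a | c
      · exfalso
        have := hf (hc.trans (hs a).symm)
        rw [h1] at this
        exact (e₂ j).2 ⟨a, this.symm⟩
      · exact ⟨c, rfl⟩
    choose c hc using hπr
    have hv : (fun i => prodBasis m k (f (π i))) =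
        Fin.append (fun a => (stdVec m a, 0)) fun j => (0, stdVec k (c j)) := by
      ext1 i
      refine Fin.addCases (fun a => ?_) (fun j => ?_) i
      · rw [hπl, hs, prodBasis_inl, Fin.append_left]
      · rw [hc, prodBasis_inr, Fin.append_right]
    have h1 := ψ.map_perm (fun i => prodBasis m k (f i)) π
    have h2 := (wedge (normalVol m k) β).map_perm (fun i => prodBasis m k (f i)) π
    have h3 : ψ ((fun i => prodBasis m k (f i)) ∘ π) =
        wedge (normalVol m k) β ((fun i => prodBasis m k (f i)) ∘ π) := by
      change ψ (fun i => prodBasis m k (f (π i))) =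
        wedge (normalVol m k) β fun i => prodBasis m k (f (π i))
      rw [hv, wedge_normalVol_append, hβ]
    rw [h1, h2] at h3
    exact smul_left_cancel _ h3

end Normal

/-! ### Calculus in charts -/

/-- Evaluation of a family of alternating forms with smooth coefficients on smooth vectors. -/
theorem contDiffAt_alternating_apply {V F : Type*} [NormedAddCommGroup V] [NormedSpace ℝ V]
    [NormedAddCommGroup F] [NormedSpace ℝ F] [FiniteDimensional ℝ F] {p : ℕ}
    {a : V → F [⋀^Fin p]→ₗ[ℝ] ℂ} {v : Fin p → V → F} {z : V}
    (ha : ∀ w : Fin p → F, ContDiffAt ℝ ∞ (fun y => a y w) z)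
    (hv : ∀ i, ContDiffAt ℝ ∞ (v i) z) :
    ContDiffAt ℝ ∞ (fun y => a y fun i => v i y) z := by
  classical
  set B := Module.finBasis ℝ F
  have h : (fun y => a y fun i => v i y) = fun y =>
      ∑ f : Fin p → Fin (Module.finrank ℝ F),
        (∏ i, B.repr (v i y) (f i)) • a y fun i => B (f i) := by
    ext y
    have h1 : (fun i => v i y) = fun i => ∑ j, B.repr (v i y) j • B j := by
      ext1 i; exact (B.sum_repr _).symm
    rw [h1, ← AlternatingMap.coe_multilinearMap, MultilinearMap.map_sum]
    refine Finset.sum_congr rfl fun f _ => ?_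
    rw [MultilinearMap.map_smul_univ]
  rw [h]
  refine ContDiffAt.sum fun f _ => ?_
  have h1 : ContDiffAt ℝ ∞ (fun y => ∏ i, B.repr (v i y) (f i)) z := by
    refine contDiffAt_prod fun i _ => ?_
    have hl : ContDiff ℝ ∞ fun w : F => B.repr w (f i) :=
      (LinearMap.toContinuousLinearMap (B.coord (f i))).contDiff
    exact hl.contDiffAt.comp z (hv i)
  exact h1.smul (ha _)

section Charts

variable {d : ℕ} {M : Type*} [TopologicalSpace M] [ChartedSpace (E d) M]

/-- The differential of the inverse of the chart at `x₀`, with the tangent space replaced by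
`ℝ^d`. -/
def jac (x₀ : M) (z : E d) : E d →L[ℝ] E d := chartJac x₀ z

/-- The coordinate change from the chart at `x₀` to the chart at `x₁`. -/
def trans (d : ℕ) {M : Type*} [TopologicalSpace M] [ChartedSpace (E d) M] (x₀ x₁ : M) :
    E d → E d := fun z => chartAt (E d) x₁ ((chartAt (E d) x₀).symm z)

theorem inChart_apply {p : ℕ} (w : DForm d M p) (x₀ : M) (z : E d) (v : Fin p → E d) :
    inChart w x₀ z v = (show E d [⋀^Fin p]→ₗ[ℝ] ℂ from w ((chartAt (E d) x₀).symm z))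
      fun i => jac x₀ z (v i) := rfl

theorem isOpen_trans_domain (x₀ x₁ : M) : IsOpen {z : E d | z ∈ (chartAt (E d) x₀).target ∧
    (chartAt (E d) x₀).symm z ∈ (chartAt (E d) x₁).source} :=
  (chartAt (E d) x₀).symm.isOpen_inter_preimage (chartAt (E d) x₁).open_source

theorem trans_trans {x₀ x₁ x₂ : M} {z : E d}
    (h : (chartAt (E d) x₀).symm z ∈ (chartAt (E d) x₁).source) :
    trans d x₁ x₂ (trans d x₀ x₁ z) = trans d x₀ x₂ z := by
  simp only [trans, (chartAt (E d) x₁).left_inv h]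

theorem trans_mem_target {x₀ x₁ : M} {z : E d}
    (h : (chartAt (E d) x₀).symm z ∈ (chartAt (E d) x₁).source) :
    trans d x₀ x₁ z ∈ (chartAt (E d) x₁).target := (chartAt (E d) x₁).map_source h

theorem symm_trans {x₀ x₁ : M} {z : E d}
    (h : (chartAt (E d) x₀).symm z ∈ (chartAt (E d) x₁).source) :
    (chartAt (E d) x₁).symm (trans d x₀ x₁ z) = (chartAt (E d) x₀).symm z :=
  (chartAt (E d) x₁).left_inv h

theorem fderiv_trans_self {x₀ : M} {z : E d} (hz : z ∈ (chartAt (E d) x₀).target) :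
    fderiv ℝ (trans d x₀ x₀) z = ContinuousLinearMap.id ℝ (E d) := by
  have he : trans d x₀ x₀ =ᶠ[𝓝 z] id := by
    filter_upwards [(chartAt (E d) x₀).open_target.mem_nhds hz] with y hy
    exact (chartAt (E d) x₀).right_inv hy
  rw [he.fderiv_eq, fderiv_id]

theorem chartSign_eq (x₀ : M) (z : E d) :
    chartSign x₀ z = SignType.sign (LinearMap.det (jac x₀ z : E d →ₗ[ℝ] E d)) := rfl

theorem twistedInChart_apply {p : ℕ} (w : DForm d M p) (x₀ : M) (z : E d) (v : Fin p → E d) :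
    twistedInChart w x₀ z v = chartSign x₀ z • inChart w x₀ z v := rfl

theorem det_fderiv_trans_pos (hX : IsOrientedAtlas d M) {x₀ x₁ : M} {z : E d}
    (hz : z ∈ (chartAt (E d) x₀).target)
    (h : (chartAt (E d) x₀).symm z ∈ (chartAt (E d) x₁).source) :
    0 < LinearMap.det (fderiv ℝ (trans d x₀ x₁) z : E d →ₗ[ℝ] E d) := by
  have := hX _ (chart_mem_atlas (E d) x₀) _ (chart_mem_atlas (E d) x₁)
    ((chartAt (E d) x₀).symm z) ⟨(chartAt (E d) x₀).map_target hz, h⟩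
  rwa [(chartAt (E d) x₀).right_inv hz] at this

variable [IsManifold (𝓡 d) ∞ M]

theorem contDiffOn_trans (x₀ x₁ : M) : ContDiffOn ℝ ∞ (trans d x₀ x₁)
    {z : E d | z ∈ (chartAt (E d) x₀).target ∧
      (chartAt (E d) x₀).symm z ∈ (chartAt (E d) x₁).source} := by
  rw [← contMDiffOn_iff_contDiffOn]
  exact (contMDiffOn_chart (I := 𝓡 d) (x := x₁) (n := ∞)).comp
    ((contMDiffOn_chart_symm (I := 𝓡 d) (x := x₀) (n := ∞)).mono fun z hz => hz.1)
    fun z hz => hz.2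

theorem contDiffAt_trans {x₀ x₁ : M} {z : E d} (hz : z ∈ (chartAt (E d) x₀).target)
    (h : (chartAt (E d) x₀).symm z ∈ (chartAt (E d) x₁).source) :
    ContDiffAt ℝ ∞ (trans d x₀ x₁) z :=
  (contDiffOn_trans x₀ x₁).contDiffAt ((isOpen_trans_domain x₀ x₁).mem_nhds ⟨hz, h⟩)

theorem differentiableAt_trans {x₀ x₁ : M} {z : E d} (hz : z ∈ (chartAt (E d) x₀).target)
    (h : (chartAt (E d) x₀).symm z ∈ (chartAt (E d) x₁).source) :
    DifferentiableAt ℝ (trans d x₀ x₁) z :=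
  (contDiffAt_trans hz h).differentiableAt (by simp)

theorem fderiv_trans_comp {x₀ x₁ x₂ : M} {z : E d} (hz : z ∈ (chartAt (E d) x₀).target)
    (h₁ : (chartAt (E d) x₀).symm z ∈ (chartAt (E d) x₁).source)
    (h₂ : (chartAt (E d) x₀).symm z ∈ (chartAt (E d) x₂).source) :
    fderiv ℝ (trans d x₀ x₂) z =
      (fderiv ℝ (trans d x₁ x₂) (trans d x₀ x₁ z)).comp (fderiv ℝ (trans d x₀ x₁) z) := by
  have he : trans d x₀ x₂ =ᶠ[𝓝 z] trans d x₁ x₂ ∘ trans d x₀ x₁ := by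
    filter_upwards [(isOpen_trans_domain x₀ x₁).mem_nhds ⟨hz, h₁⟩] with y hy
    exact (trans_trans hy.2).symm
  rw [he.fderiv_eq, fderiv_comp]
  · exact differentiableAt_trans (trans_mem_target h₁) (by rwa [symm_trans h₁])
  · exact differentiableAt_trans hz h₁

/-- The tangent space at a point is identified with `ℝ^d` by its preferred chart, so that `jac` is
the differential of a coordinate change. -/
theorem jac_eq {x₀ : M} {z : E d} (hz : z ∈ (chartAt (E d) x₀).target) :
    jac x₀ z = fderiv ℝ (trans d x₀ ((chartAt (E d) x₀).symm z)) z := by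
  have h1 : MDifferentiableAt 𝓘(ℝ, E d) (𝓡 d) (chartAt (E d) x₀).symm z :=
    ((contMDiffOn_chart_symm (I := 𝓡 d) (x := x₀) (n := ∞)).contMDiffAt
      ((chartAt (E d) x₀).open_target.mem_nhds hz)).mdifferentiableAt (by simp)
  unfold jac chartJac
  rw [h1.mfderiv]
  simp only [writtenInExtChartAt, mfld_simps]
  rw [fderivWithin_univ]
  rfl

theorem jac_trans {x₀ x₁ : M} {z : E d} (hz : z ∈ (chartAt (E d) x₀).target)
    (h : (chartAt (E d) x₀).symm z ∈ (chartAt (E d) x₁).source) :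
    jac x₀ z = (jac x₁ (trans d x₀ x₁ z)).comp (fderiv ℝ (trans d x₀ x₁) z) := by
  rw [jac_eq hz, jac_eq (trans_mem_target h), symm_trans h]
  exact fderiv_trans_comp hz h (mem_chart_source _ _)

theorem fderiv_trans_inv {x₀ x₁ : M} {z : E d} (hz : z ∈ (chartAt (E d) x₀).target)
    (h : (chartAt (E d) x₀).symm z ∈ (chartAt (E d) x₁).source) :
    (fderiv ℝ (trans d x₁ x₀) (trans d x₀ x₁ z)).comp (fderiv ℝ (trans d x₀ x₁) z) =
      ContinuousLinearMap.id ℝ (E d) := by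
  rw [← fderiv_trans_comp hz h ((chartAt (E d) x₀).map_target hz), fderiv_trans_self hz]

theorem det_fderiv_trans_ne_zero {x₀ x₁ : M} {z : E d} (hz : z ∈ (chartAt (E d) x₀).target)
    (h : (chartAt (E d) x₀).symm z ∈ (chartAt (E d) x₁).source) :
    LinearMap.det (fderiv ℝ (trans d x₀ x₁) z : E d →ₗ[ℝ] E d) ≠ 0 := by
  have h1 := congrArg (fun f : E d →L[ℝ] E d => LinearMap.det (f : E d →ₗ[ℝ] E d))
    (fderiv_trans_inv hz h)
  simp only [ContinuousLinearMap.toLinearMap_comp, LinearMap.det_comp] at h1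
  intro h0
  rw [h0] at h1
  simp at h1

theorem det_jac_ne_zero {x₀ : M} {z : E d} (hz : z ∈ (chartAt (E d) x₀).target) :
    LinearMap.det (jac x₀ z : E d →ₗ[ℝ] E d) ≠ 0 := by
  rw [jac_eq hz]
  exact det_fderiv_trans_ne_zero hz (mem_chart_source _ _)

theorem chartSign_trans {x₀ x₁ : M} {z : E d} (hz : z ∈ (chartAt (E d) x₀).target)
    (h : (chartAt (E d) x₀).symm z ∈ (chartAt (E d) x₁).source) :
    chartSign x₀ z = chartSign x₁ (trans d x₀ x₁ z) *
      SignType.sign (LinearMap.det (fderiv ℝ (trans d x₀ x₁) z : E d →ₗ[ℝ] E d)) := by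
  rw [chartSign_eq, jac_trans hz h, chartSign_eq, ContinuousLinearMap.toLinearMap_comp,
    LinearMap.det_comp, sign_mul]
  simp

theorem inChart_trans {p : ℕ} (w : DForm d M p) {x₀ x₁ : M} {z : E d}
    (hz : z ∈ (chartAt (E d) x₀).target)
    (h : (chartAt (E d) x₀).symm z ∈ (chartAt (E d) x₁).source) (v : Fin p → E d) :
    inChart w x₀ z v =
      inChart w x₁ (trans d x₀ x₁ z) fun i => fderiv ℝ (trans d x₀ x₁) z (v i) := by
  rw [inChart_apply, inChart_apply, symm_trans h, jac_trans hz h]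
  rfl

theorem twistedInChart_trans {p : ℕ} (w : DForm d M p) {x₀ x₁ : M} {z : E d}
    (hz : z ∈ (chartAt (E d) x₀).target)
    (h : (chartAt (E d) x₀).symm z ∈ (chartAt (E d) x₁).source) (v : Fin p → E d) :
    twistedInChart w x₀ z v =
      (SignType.sign (LinearMap.det (fderiv ℝ (trans d x₀ x₁) z : E d →ₗ[ℝ] E d)) : ℝ) •
        twistedInChart w x₁ (trans d x₀ x₁ z) fun i => fderiv ℝ (trans d x₀ x₁) z (v i) := by
  rw [twistedInChart_apply, twistedInChart_apply, inChart_trans w hz h, chartSign_trans hz h,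
    mul_comm, mul_smul]

/-- The transformation law of densities. -/
theorem twistedInChart_stdVec_trans (w : DForm d M d) {x₀ x₁ : M} {z : E d}
    (hz : z ∈ (chartAt (E d) x₀).target)
    (h : (chartAt (E d) x₀).symm z ∈ (chartAt (E d) x₁).source) :
    twistedInChart w x₀ z (stdVec d) =
      |LinearMap.det (fderiv ℝ (trans d x₀ x₁) z : E d →ₗ[ℝ] E d)| •
        twistedInChart w x₁ (trans d x₀ x₁ z) (stdVec d) := by
  rw [twistedInChart_trans w hz h]
  have := map_comp_stdVec (twistedInChart w x₁ (trans d x₀ x₁ z))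
    (fderiv ℝ (trans d x₀ x₁) z : E d →ₗ[ℝ] E d)
  simp only [ContinuousLinearMap.coe_coe] at this
  rw [this, ← mul_smul, sign_mul_self]

theorem det_jac_pos (hX : IsOrientedAtlas d M) {x₀ : M} {z : E d}
    (hz : z ∈ (chartAt (E d) x₀).target) :
    0 < LinearMap.det (jac x₀ z : E d →ₗ[ℝ] E d) := by
  rw [jac_eq hz]
  exact det_fderiv_trans_pos hX hz (mem_chart_source _ _)

/-- On an oriented manifold the coefficients of a form of top degree transform like a density. -/
theorem inChart_stdVec_trans (hX : IsOrientedAtlas d M) (w : DForm d M d) {x₀ x₁ : M} {z : E d}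
    (hz : z ∈ (chartAt (E d) x₀).target)
    (h : (chartAt (E d) x₀).symm z ∈ (chartAt (E d) x₁).source) :
    inChart w x₀ z (stdVec d) =
      |LinearMap.det (fderiv ℝ (trans d x₀ x₁) z : E d →ₗ[ℝ] E d)| •
        inChart w x₁ (trans d x₀ x₁ z) (stdVec d) := by
  rw [inChart_trans w hz h, abs_of_pos (det_fderiv_trans_pos hX hz h)]
  exact map_comp_stdVec (inChart w x₁ (trans d x₀ x₁ z))
    (fderiv ℝ (trans d x₀ x₁) z : E d →ₗ[ℝ] E d)

/-- The differential of a map into `M` in preferred charts, computed in the chart at `x₀`. -/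
theorem fderiv_chart_symm_comp {G : Type*} [NormedAddCommGroup G] [NormedSpace ℝ G]
    {F : G → E d} {z : G} (hF : DifferentiableAt ℝ F z) {x₀ : M}
    (hz : F z ∈ (chartAt (E d) x₀).target) :
    fderiv ℝ (fun y => chartAt (E d) ((chartAt (E d) x₀).symm (F z))
      ((chartAt (E d) x₀).symm (F y))) z = (jac x₀ (F z)).comp (fderiv ℝ F z) := by
  rw [jac_eq hz]
  exact fderiv_comp (g := trans d x₀ ((chartAt (E d) x₀).symm (F z))) z
    (differentiableAt_trans hz (mem_chart_source _ _)) hF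

/-- Smoothness of a form may be checked at the centres of the preferred charts. -/
theorem isSmoothForm_of_center {p : ℕ} {w : DForm d M p}
    (h : ∀ (x : M) (v : Fin p → E d), ContDiffAt ℝ ∞ (fun z => inChart w x z v)
      (chartAt (E d) x x)) : IsSmoothForm w := by
  intro x₀ v z hz
  refine ContDiffAt.contDiffWithinAt ?_
  set x := (chartAt (E d) x₀).symm z with hx
  have hxs : (chartAt (E d) x₀).symm z ∈ (chartAt (E d) x).source := mem_chart_source _ _
  have htr := contDiffAt_trans hz hxs
  have he : (fun y => inChart w x₀ y v) =ᶠ[𝓝 z] fun y =>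
      inChart w x (trans d x₀ x y) fun i => fderiv ℝ (trans d x₀ x) y (v i) := by
    filter_upwards [(isOpen_trans_domain x₀ x).mem_nhds ⟨hz, hxs⟩] with y hy
    exact inChart_trans w hy.1 hy.2 v
  refine ContDiffAt.congr_of_eventuallyEq ?_ he
  refine contDiffAt_alternating_apply (fun v' => ?_) fun i => ?_
  · exact ContDiffAt.comp z (h x v') htr
  · exact (htr.fderiv_right (m := ∞) (by simp)).clm_apply contDiffAt_const

theorem sign_eventuallyEq {V : Type*} [TopologicalSpace V] {f : V → ℝ} {z : V}
    (hf : ContinuousAt f z) (h : f z ≠ 0) :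
    (fun y => SignType.sign (f y)) =ᶠ[𝓝 z] fun _ => SignType.sign (f z) := by
  rcases lt_or_gt_of_ne h with h | h
  · filter_upwards [hf.eventually (gt_mem_nhds h)] with y hy
    rw [sign_neg hy, sign_neg h]
  · filter_upwards [hf.eventually (lt_mem_nhds h)] with y hy
    rw [sign_pos hy, sign_pos h]

theorem continuous_det_clm (d : ℕ) :
    Continuous fun f : E d →L[ℝ] E d => LinearMap.det (f : E d →ₗ[ℝ] E d) :=
  ContinuousLinearMap.continuous_det

/-- Smoothness of a twisted form may be checked at the centres of the preferred charts. The signs of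
the Jacobians of the coordinate changes are locally constant. -/
theorem isSmoothTwistedForm_of_center {p : ℕ} {w : DForm d M p}
    (h : ∀ (x : M) (v : Fin p → E d), ContDiffAt ℝ ∞ (fun z => twistedInChart w x z v)
      (chartAt (E d) x x)) : IsSmoothTwistedForm w := by
  intro x₀ v z hz
  refine ContDiffAt.contDiffWithinAt ?_
  set x := (chartAt (E d) x₀).symm z with hx
  have hxs : (chartAt (E d) x₀).symm z ∈ (chartAt (E d) x).source := mem_chart_source _ _
  have htr := contDiffAt_trans hz hxs
  have hfd : ContDiffAt ℝ ∞ (fderiv ℝ (trans d x₀ x)) z := htr.fderiv_right (m := ∞) (by simp)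
  have hsg := sign_eventuallyEq
    (ContinuousAt.comp (continuous_det_clm d).continuousAt hfd.continuousAt)
    (det_fderiv_trans_ne_zero hz hxs)
  have he : (fun y => twistedInChart w x₀ y v) =ᶠ[𝓝 z] fun y =>
      (SignType.sign (LinearMap.det (fderiv ℝ (trans d x₀ x) z : E d →ₗ[ℝ] E d)) : ℝ) •
        twistedInChart w x (trans d x₀ x y) fun i => fderiv ℝ (trans d x₀ x) y (v i) := by
    filter_upwards [(isOpen_trans_domain x₀ x).mem_nhds ⟨hz, hxs⟩, hsg] with y hy hs
    rw [twistedInChart_trans w hy.1 hy.2 v]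
    simp only [Function.comp] at hs
    rw [hs]
  refine ContDiffAt.congr_of_eventuallyEq ?_ he
  have hs : ContDiffAt ℝ ∞ (fun y => twistedInChart w x (trans d x₀ x y)
      fun i => fderiv ℝ (trans d x₀ x) y (v i)) z := by
    refine contDiffAt_alternating_apply (fun v' => ?_) fun i => ?_
    · exact ContDiffAt.comp z (h x v') htr
    · exact hfd.clm_apply contDiffAt_const
  exact hs.const_smul _

end Charts

/-! ### Integrals of densities -/

section Density

variable {d : ℕ} {M : Type*} [TopologicalSpace M] [ChartedSpace (E d) M]

/-- The coefficient functions of a continuous density on `M` that vanishes outside of the compact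
set `K`. -/
structure IsDensity (f : M → E d → ℂ) (K : Set M) : Prop where
  continuousOn : ∀ x₀, ContinuousOn (f x₀) (chartAt (E d) x₀).target
  compat : ∀ (x₀ x₁ : M) (z : E d), z ∈ (chartAt (E d) x₀).target →
    (chartAt (E d) x₀).symm z ∈ (chartAt (E d) x₁).source →
    f x₀ z = |LinearMap.det (fderiv ℝ (trans d x₀ x₁) z : E d →ₗ[ℝ] E d)| • f x₁ (trans d x₀ x₁ z)
  isCompact : IsCompact K
  eq_zero : ∀ x₀, ∀ z ∈ (chartAt (E d) x₀).target, (chartAt (E d) x₀).symm z ∉ K → f x₀ z = 0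

/-- A continuous function on the range of a chart that vanishes outside of a compact subset is
integrable there. -/
theorem integrableOn_chart_target (x₀ : M) {h : E d → ℂ}
    (hc : ContinuousOn h (chartAt (E d) x₀).target) {L : Set M} (hL : IsCompact L)
    (hLs : L ⊆ (chartAt (E d) x₀).source)
    (h0 : ∀ z ∈ (chartAt (E d) x₀).target, (chartAt (E d) x₀).symm z ∉ L → h z = 0) :
    IntegrableOn h (chartAt (E d) x₀).target := by
  set c := chartAt (E d) x₀
  have hLt : c '' L ⊆ c.target := by
    rintro _ ⟨x, hx, rfl⟩
    exact c.map_source (hLs hx)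
  refine IntegrableOn.of_forall_sdiff_eq_zero ((hc.mono hLt).integrableOn_compact
    (hL.image_of_continuousOn (c.continuousOn.mono hLs))) c.open_target.measurableSet
    fun z hz => h0 z hz.1 fun h => hz.2 ⟨_, h, c.right_inv hz.1⟩

variable {f g : M → E d → ℂ} {K K' : Set M}

theorem IsDensity.add (hf : IsDensity f K) (hg : IsDensity g K') :
    IsDensity (fun x z => f x z + g x z) (K ∪ K') where
  continuousOn x₀ := (hf.continuousOn x₀).add (hg.continuousOn x₀)
  compat x₀ x₁ z hz h := by rw [hf.compat x₀ x₁ z hz h, hg.compat x₀ x₁ z hz h, smul_add]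
  isCompact := hf.isCompact.union hg.isCompact
  eq_zero x₀ z hz h := by
    rw [hf.eq_zero x₀ z hz fun h' => h (Or.inl h'), hg.eq_zero x₀ z hz fun h' => h (Or.inr h'),
      add_zero]

theorem IsDensity.zero : IsDensity (fun (_ : M) (_ : E d) => (0 : ℂ)) ∅ where
  continuousOn _ := continuousOn_const
  compat _ _ _ _ _ := by simp
  isCompact := isCompact_empty
  eq_zero _ _ _ _ := rfl

variable [IsManifold (𝓡 d) ∞ M] [T2Space M] [SigmaCompactSpace M]

theorem chartPartition_subordinate (x₀ : M) :
    tsupport (chartPartition d M x₀) ⊆ (chartAt (E d) x₀).source :=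
  (SmoothPartitionOfUnity.exists_isSubordinate_chartAt_source (𝓡 d) M).choose_spec x₀

theorem chartPartition_eq_zero {x₀ x : M} (h : x ∉ (chartAt (E d) x₀).source) :
    chartPartition d M x₀ x = 0 := by
  by_contra hne
  exact h (chartPartition_subordinate x₀ (subset_tsupport _ hne))

/-- The integrand of the `x₀`-th term of `chartIntegral`. -/
def chartTerm (f : M → E d → ℂ) (x₀ : M) (z : E d) : ℂ :=
  ((chartPartition d M x₀ ((chartAt (E d) x₀).symm z) : ℝ) : ℂ) * f x₀ z

theorem continuous_chartPartition (x₀ : M) : Continuous (chartPartition d M x₀) :=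
  (chartPartition d M x₀).contMDiff.continuous

theorem IsDensity.integrableOn (hf : IsDensity f K) (x₀ : M) :
    IntegrableOn (chartTerm f x₀) (chartAt (E d) x₀).target := by
  refine integrableOn_chart_target x₀ ?_
    (hf.isCompact.inter_right (isClosed_tsupport (chartPartition d M x₀)))
    (fun x hx => chartPartition_subordinate x₀ hx.2) fun z hz h => ?_
  · refine ContinuousOn.mul ?_ (hf.continuousOn x₀)
    exact Complex.continuous_ofReal.comp_continuousOn
      ((continuous_chartPartition x₀).comp_continuousOn (chartAt (E d) x₀).continuousOn_symm)
  · unfold chartTerm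
    by_cases hK : (chartAt (E d) x₀).symm z ∈ K
    · have : chartPartition d M x₀ ((chartAt (E d) x₀).symm z) = 0 := by
        by_contra hne
        exact h ⟨hK, subset_tsupport _ hne⟩
      simp [this]
    · rw [hf.eq_zero x₀ z hz hK, mul_zero]

/-- Only finitely many terms of `chartIntegral` are nonzero. -/
theorem IsDensity.finite (hf : IsDensity f K) :
    {x₀ : M | (Function.support (chartPartition d M x₀) ∩ K).Nonempty}.Finite :=
  (chartPartition d M).locallyFinite.finite_nonempty_inter_compact hf.isCompact

theorem IsDensity.chartTerm_eq_zero (hf : IsDensity f K) {x₀ : M}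
    (h : ¬ (Function.support (chartPartition d M x₀) ∩ K).Nonempty) :
    ∀ z ∈ (chartAt (E d) x₀).target, chartTerm f x₀ z = 0 := by
  intro z hz
  unfold chartTerm
  by_cases hK : (chartAt (E d) x₀).symm z ∈ K
  · have : chartPartition d M x₀ ((chartAt (E d) x₀).symm z) = 0 := by
      by_contra hne
      exact h ⟨_, hne, hK⟩
    simp [this]
  · rw [hf.eq_zero x₀ z hz hK, mul_zero]

theorem IsDensity.chartIntegral_eq_sum (hf : IsDensity f K) {S : Finset M}
    (hS : {x₀ : M | (Function.support (chartPartition d M x₀) ∩ K).Nonempty} ⊆ S) :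
    chartIntegral f = ∑ x₀ ∈ S, ∫ z in (chartAt (E d) x₀).target, chartTerm f x₀ z := by
  refine finsum_eq_sum_of_support_subset _ fun x₀ hx₀ => hS ?_
  by_contra hne
  exact hx₀ (setIntegral_eq_zero_of_forall_eq_zero (hf.chartTerm_eq_zero hne))

theorem IsDensity.chartIntegral_add (hf : IsDensity f K) (hg : IsDensity g K') :
    chartIntegral (fun x z => f x z + g x z) = chartIntegral f + chartIntegral g := by
  have hfg := hf.add hg
  have hsub : ∀ {L : Set M}, L ⊆ K ∪ K' →
      {x₀ : M | (Function.support (chartPartition d M x₀) ∩ L).Nonempty} ⊆ hfg.finite.toFinset := by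
    intro L hL x hx
    simp only [Finite.coe_toFinset]
    exact hx.mono (inter_subset_inter_right _ hL)
  rw [hfg.chartIntegral_eq_sum (hsub subset_rfl), hf.chartIntegral_eq_sum (hsub subset_union_left),
    hg.chartIntegral_eq_sum (hsub subset_union_right), ← Finset.sum_add_distrib]
  refine Finset.sum_congr rfl fun x₀ _ => ?_
  rw [← integral_add (hf.integrableOn x₀) (hg.integrableOn x₀)]
  simp only [chartTerm, mul_add]

theorem chartIntegral_zero : chartIntegral (fun (_ : M) (_ : E d) => (0 : ℂ)) = 0 := by
  simp [chartIntegral]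

/-- Integrals of densities are additive. -/
theorem IsDensity.sum {ι : Type*} (t : Finset ι) {f : ι → M → E d → ℂ} {K : ι → Set M}
    (h : ∀ a ∈ t, IsDensity (f a) (K a)) :
    IsDensity (fun x z => ∑ a ∈ t, f a x z) (⋃ a ∈ t, K a) ∧
      chartIntegral (fun x z => ∑ a ∈ t, f a x z) = ∑ a ∈ t, chartIntegral (f a) := by
  classical
  induction t using Finset.induction_on with
  | empty => simpa using ⟨IsDensity.zero, chartIntegral_zero⟩
  | insert a t ha ih =>
    obtain ⟨h1, h2⟩ := ih fun b hb => h b (by simp [hb])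
    have h3 := h a (by simp)
    simp only [Finset.sum_insert ha, Finset.set_biUnion_insert]
    exact ⟨h3.add h1, by rw [h3.chartIntegral_add h1, h2]⟩

/-- The integral of a density supported in the domain of a chart is computed in that chart: change
variables in each term, and sum up the partition of unity. -/
theorem IsDensity.chartIntegral_eq (hf : IsDensity f K) {x₁ : M}
    (hK : K ⊆ (chartAt (E d) x₁).source) :
    chartIntegral f = ∫ z in (chartAt (E d) x₁).target, f x₁ z := by
  set c₁ := chartAt (E d) x₁ with hc₁
  set S := (hf.finite (d := d)).toFinset with hS
  rw [hf.chartIntegral_eq_sum (S := S) (by simp [S])]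
  -- the function integrated in the chart at `x₁` to give the `x₀`-th term
  set F : M → E d → ℂ := fun x₀ y => ((chartPartition d M x₀ (c₁.symm y) : ℝ) : ℂ) * f x₁ y with hF
  have hterm : ∀ x₀, ∫ z in (chartAt (E d) x₀).target, chartTerm f x₀ z =
      ∫ y in c₁.target, F x₀ y := by
    intro x₀
    set c₀ := chartAt (E d) x₀ with hc₀
    set D : Set (E d) := {z | z ∈ c₀.target ∧ c₀.symm z ∈ c₁.source} with hD
    have hDo : IsOpen D := isOpen_trans_domain x₀ x₁
    have h1 : ∫ z in c₀.target, chartTerm f x₀ z = ∫ z in D, chartTerm f x₀ z := by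
      refine setIntegral_eq_of_subset_of_forall_sdiff_eq_zero c₀.open_target.measurableSet
        (fun z hz => hz.1) fun z hz => ?_
      unfold chartTerm
      rw [hf.eq_zero x₀ z hz.1 fun h => hz.2 ⟨hz.1, hK h⟩, mul_zero]
    have himg : trans d x₀ x₁ '' D = {y | y ∈ c₁.target ∧ c₁.symm y ∈ c₀.source} := by
      ext y
      constructor
      · rintro ⟨z, hz, rfl⟩
        exact ⟨trans_mem_target hz.2, by rw [symm_trans hz.2]; exact c₀.map_target hz.1⟩
      · rintro ⟨hy, hy'⟩
        refine ⟨trans d x₁ x₀ y, ⟨trans_mem_target hy', by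
          rw [symm_trans hy']; exact c₁.map_target hy⟩, ?_⟩
        rw [trans_trans hy']
        exact c₁.right_inv hy
    have hinj : InjOn (trans d x₀ x₁) D := by
      intro z hz z' hz' h
      have := c₁.injOn hz.2 hz'.2 h
      exact c₀.symm.injOn hz.1 hz'.1 this
    have h2 : ∫ y in trans d x₀ x₁ '' D, F x₀ y = ∫ z in D, chartTerm f x₀ z := by
      rw [integral_image_eq_integral_abs_det_fderiv_smul volume hDo.measurableSet
        (fun z hz => (differentiableAt_trans hz.1 hz.2).hasFDerivAt.hasFDerivWithinAt) hinj]
      refine setIntegral_congr_fun hDo.measurableSet fun z hz => ?_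
      simp only [F, chartTerm]
      rw [hf.compat x₀ x₁ z hz.1 hz.2, symm_trans hz.2, mul_smul_comm]
    rw [h1, ← h2, himg]
    refine (setIntegral_eq_of_subset_of_forall_sdiff_eq_zero c₁.open_target.measurableSet
        (fun z hz => hz.1) fun z hz => ?_).symm
    have : chartPartition d M x₀ (c₁.symm z) = 0 := chartPartition_eq_zero fun h => hz.2 ⟨hz.1, h⟩
    simp [F, this]
  simp only [hterm]
  have hFi : ∀ x₀, IntegrableOn (F x₀) c₁.target := by
    intro x₀
    have hc : ContinuousOn (F x₀) c₁.target := by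
      refine ContinuousOn.mul ?_ (hf.continuousOn x₁)
      exact Complex.continuous_ofReal.comp_continuousOn
        ((continuous_chartPartition x₀).comp_continuousOn c₁.continuousOn_symm)
    exact integrableOn_chart_target x₁ hc hf.isCompact hK fun z hz h => by
      simp only [F]
      rw [hf.eq_zero x₁ z hz h, mul_zero]
  rw [← integral_finsetSum _ fun x₀ _ => hFi x₀]
  refine setIntegral_congr_fun c₁.open_target.measurableSet fun y hy => ?_
  simp only [F, ← Finset.sum_mul]
  by_cases hyK : c₁.symm y ∈ K
  · have h1 := (chartPartition d M).sum_eq_one (mem_univ (c₁.symm y))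
    rw [finsum_eq_sum_of_support_subset (s := S) _ (by
      intro x₀ hx₀
      simp only [S, Finite.coe_toFinset]
      exact ⟨_, hx₀, hyK⟩)] at h1
    rw [← Complex.ofReal_sum, h1]; simp
  · rw [hf.eq_zero x₁ y hy hyK, mul_zero]

end Density

/-! ### The Morse-Bott lemma in Euclidean space -/

/-- The inverse function theorem, with smoothness of the map and of its inverse on open sets. -/
theorem exists_openPartialHomeomorph_of_contDiffOn {V W : Type*} [NormedAddCommGroup V]
    [NormedSpace ℝ V] [CompleteSpace V] [NormedAddCommGroup W] [NormedSpace ℝ W]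
    {F : V → W} {N : Set V} (hN : IsOpen N) (hF : ContDiffOn ℝ ∞ F N) {a : V} (ha : a ∈ N)
    {F' : V ≃L[ℝ] W} (hF' : HasFDerivAt F (F' : V →L[ℝ] W) a) :
    ∃ φ : OpenPartialHomeomorph V W, a ∈ φ.source ∧ φ.source ⊆ N ∧ (∀ z, φ z = F z) ∧
      ContDiffOn ℝ ∞ φ.symm φ.target ∧
      ∀ z ∈ φ.source, ∃ L : V ≃L[ℝ] W, HasFDerivAt F (L : V →L[ℝ] W) z := by
  have hFa : ContDiffAt ℝ ∞ F a := hF.contDiffAt (hN.mem_nhds ha)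
  set φ₀ := hFa.toOpenPartialHomeomorph F hF' (by simp) with hφ₀
  set S : Set V := N ∩ fderiv ℝ F ⁻¹' range ((↑) : (V ≃L[ℝ] W) → V →L[ℝ] W) with hS
  have hSo : IsOpen S :=
    (hF.continuousOn_fderiv_of_isOpen hN (by simp)).isOpen_inter_preimage hN
      (ContinuousLinearEquiv.isOpen)
  have haS : a ∈ S := ⟨ha, F', hF'.fderiv.symm⟩
  have hSL : ∀ z ∈ S, ∃ L : V ≃L[ℝ] W, HasFDerivAt F (L : V →L[ℝ] W) z := by
    rintro z ⟨hz, L, hL⟩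
    refine ⟨L, ?_⟩
    rw [hL]
    exact ((hF.contDiffAt (hN.mem_nhds hz)).differentiableAt (by simp)).hasFDerivAt
  refine ⟨φ₀.restrOpen S hSo, ⟨hFa.mem_toOpenPartialHomeomorph_source hF' (by simp), haS⟩,
    fun z hz => hz.2.1, fun z => rfl, ?_, fun z hz => hSL z hz.2⟩
  intro y hy
  refine ContDiffAt.contDiffWithinAt ?_
  set φ := φ₀.restrOpen S hSo
  have hz : φ.symm y ∈ φ.source := φ.map_target hy
  obtain ⟨L, hL⟩ := hSL _ hz.2
  exact φ.contDiffAt_symm hy hL (hF.contDiffAt (hN.mem_nhds hz.2.1))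

/-- Squaring is a smooth local diffeomorphism at the identity of a Banach algebra. -/
theorem exists_openPartialHomeomorph_sq (A : Type*) [NormedRing A] [NormedAlgebra ℝ A]
    [CompleteSpace A] : ∃ φ : OpenPartialHomeomorph A A, 1 ∈ φ.source ∧ (∀ z, φ z = z * z) ∧
      ContDiffOn ℝ ∞ φ.symm φ.target := by
  have hsqd : ContDiff ℝ ∞ fun b : A => b * b := contDiff_id.mul contDiff_id
  have hd : HasFDerivAt (fun b : A => b * b)
      ((ContinuousLinearEquiv.smulLeft (Units.mk0 (2 : ℝ) two_ne_zero) : A ≃L[ℝ] A) :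
        A →L[ℝ] A) 1 := by
    refine ((hasFDerivAt_id (𝕜 := ℝ) (1 : A)).mul' (hasFDerivAt_id (𝕜 := ℝ) (1 : A))).congr_fderiv
      (ContinuousLinearMap.ext fun b => ?_)
    have : ((ContinuousLinearEquiv.smulLeft (Units.mk0 (2 : ℝ) two_ne_zero) : A ≃L[ℝ] A) :
        A →L[ℝ] A) b = (2 : ℝ) • b := rfl
    rw [this]
    simp [two_smul]
  obtain ⟨φ, h1, -, hφ, hsm, -⟩ := exists_openPartialHomeomorph_of_contDiffOn isOpen_univ
    hsqd.contDiffOn (mem_univ 1) hd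
  exact ⟨φ, h1, hφ, hsm⟩

/-- A smooth square root of operators near the identity; it takes self-adjoint operators to
self-adjoint operators. -/
theorem exists_smooth_sqrt (m : ℕ) : ∃ (U : Set (E m →L[ℝ] E m))
    (g : (E m →L[ℝ] E m) → (E m →L[ℝ] E m)), IsOpen U ∧ 1 ∈ U ∧ ContDiffOn ℝ ∞ g U ∧ g 1 = 1 ∧
      (∀ T ∈ U, g T * g T = T) ∧
      ∀ T ∈ U, (∀ x y : E m, ⟪T x, y⟫ = ⟪x, T y⟫) → ∀ x y : E m, ⟪g T x, y⟫ = ⟪x, g T y⟫ := by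
  obtain ⟨φ, h1, hφ, hsm⟩ := exists_openPartialHomeomorph_sq (E m →L[ℝ] E m)
  have hφ1 : φ 1 = 1 := by rw [hφ, one_mul]
  have h1t : (1 : E m →L[ℝ] E m) ∈ φ.target := by rw [← hφ1]; exact φ.map_source h1
  have hg1 : φ.symm 1 = 1 := by
    conv_lhs => rw [← hφ1]
    exact φ.left_inv h1
  have hsq : ∀ T ∈ φ.target, φ.symm T * φ.symm T = T := fun T hT => by
    have := φ.right_inv hT
    rwa [hφ] at this
  -- On `U` both the square root and its adjoint lie in the domain where squaring is injective.
  have hc : ContinuousOn (fun T => star (φ.symm T)) φ.target :=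
    continuous_star.comp_continuousOn φ.continuousOn_symm
  refine ⟨φ.target ∩ (fun T => star (φ.symm T)) ⁻¹' φ.source, φ.symm,
    hc.isOpen_inter_preimage φ.open_target φ.open_source, ⟨h1t, ?_⟩, hsm.mono inter_subset_left,
    hg1, fun T hT => hsq T hT.1, ?_⟩
  · rw [mem_preimage, hg1, star_one]
    exact h1
  · intro T hT hsym x y
    have hTa : star T = T := by
      refine ContinuousLinearMap.ext fun x => ext_inner_right ℝ fun y => ?_
      rw [ContinuousLinearMap.star_eq_adjoint, ContinuousLinearMap.adjoint_inner_left, hsym]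
    have h4 : star (φ.symm T) = φ.symm T := by
      refine φ.injOn hT.2 (φ.map_target hT.1) ?_
      rw [hφ, hφ, ← star_mul, hsq T hT.1, hTa]
    conv_lhs => rw [← h4]
    exact ContinuousLinearMap.adjoint_inner_left _ _ _

section Hadamard

variable {m k : ℕ}

/-- Taylor's formula of second order along a segment in the first variable. -/
theorem eq_integral_second_deriv {f : E m × E k → ℝ} (hf : ContDiff ℝ ∞ f) {x : E m} {u : E k}
    (h0 : f (0, u) = 0) (h1 : fderiv ℝ f (0, u) = 0) :
    f (x, u) = ∫ t in (0 : ℝ)..1,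
      (1 - t) * fderiv ℝ (fderiv ℝ f) (t • x, u) (x, 0) (x, 0) := by
  have hf' : ContDiff ℝ ∞ (fderiv ℝ f) := hf.fderiv_right (by simp)
  have hline : ∀ t : ℝ, HasDerivAt (fun t : ℝ => (t • x, u)) (x, (0 : E k)) t := fun t => by
    simpa using ((hasDerivAt_id t).smul_const x).prodMk (hasDerivAt_const t u)
  have hd1 : ∀ t : ℝ, HasDerivAt (fun t : ℝ => f (t • x, u)) (fderiv ℝ f (t • x, u) (x, 0)) t :=
    fun t => ((hf.differentiable (by simp)) (t • x, u)).hasFDerivAt.comp_hasDerivAt t (hline t)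
  have hd2 : ∀ t : ℝ, HasDerivAt (fun t : ℝ => fderiv ℝ f (t • x, u) (x, 0))
      (fderiv ℝ (fderiv ℝ f) (t • x, u) (x, 0) (x, 0)) t := fun t => by
    have h2 := ((hf'.differentiable (by simp)) (t • x, u)).hasFDerivAt.comp_hasDerivAt t (hline t)
    simpa using h2.clm_apply (hasDerivAt_const t (x, (0 : E k)))
  have hd : ∀ t : ℝ, HasDerivAt
      (fun t : ℝ => (1 - t) * fderiv ℝ f (t • x, u) (x, 0) + f (t • x, u))
      ((1 - t) * fderiv ℝ (fderiv ℝ f) (t • x, u) (x, 0) (x, 0)) t := fun t => by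
    refine ((((hasDerivAt_id t).const_sub 1).mul (hd2 t)).add (hd1 t)).congr_deriv ?_
    simp
  have hlc : Continuous fun t : ℝ => (t • x, u) := by fun_prop
  have hcont : Continuous fun t : ℝ =>
      (1 - t) * fderiv ℝ (fderiv ℝ f) (t • x, u) (x, 0) (x, 0) := by
    have h3 : Continuous fun t : ℝ => fderiv ℝ (fderiv ℝ f) (t • x, u) :=
      (hf'.continuous_fderiv (by simp)).comp hlc
    exact (continuous_const.sub continuous_id).mul
      ((h3.clm_apply continuous_const).clm_apply continuous_const)
  rw [intervalIntegral.integral_eq_sub_of_hasDerivAt (fun t _ => hd t)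
    (hcont.intervalIntegrable _ _)]
  simp [h0, h1]

/-- The averaged second derivative in the first variable, as a bilinear form. -/
def averagedHessian (f : E m × E k → ℝ) (z : E m × E k) :
    (E m × E k) →L[ℝ] (E m × E k) →L[ℝ] ℝ :=
  ∫ t : unitInterval, (1 - (t : ℝ)) • fderiv ℝ (fderiv ℝ f) ((t : ℝ) • z.1, z.2)

theorem contDiff_averagedHessian {f : E m × E k → ℝ} (hf : ContDiff ℝ ∞ f) :
    ContDiff ℝ ∞ (averagedHessian f) := by
  have hf'' : ContDiff ℝ ∞ (fderiv ℝ (fderiv ℝ f)) :=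
    (hf.fderiv_right (m := ∞) (by simp)).fderiv_right (by simp)
  refine contDiff_integral_of_contDiff (P := E m × E k) (Q := ℝ) volume
    (q := fun t : unitInterval => (t : ℝ)) continuous_subtype_val.aestronglyMeasurable
    (isCompact_Icc (a := (0 : ℝ)) (b := 1)) (fun a => a.2)
    (Φ := fun z : (E m × E k) × ℝ =>
      (1 - z.2) • fderiv ℝ (fderiv ℝ f) (z.2 • z.1.1, z.1.2)) ?_
  refine (contDiff_const.sub contDiff_snd).smul (hf''.comp ?_)
  exact (contDiff_snd.smul contDiff_fst.fst).prodMk contDiff_fst.snd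

theorem averagedHessian_apply {f : E m × E k → ℝ} (hf : ContDiff ℝ ∞ f) (z v w : E m × E k) :
    averagedHessian f z v w = ∫ t in (0 : ℝ)..1,
      (1 - t) * fderiv ℝ (fderiv ℝ f) (t • z.1, z.2) v w := by
  have hf'' : Continuous (fderiv ℝ (fderiv ℝ f)) :=
    (hf.fderiv_right (m := ∞) (by simp)).continuous_fderiv (by simp)
  have hc : Continuous fun t : unitInterval =>
      (1 - (t : ℝ)) • fderiv ℝ (fderiv ℝ f) ((t : ℝ) • z.1, z.2) := by
    have h1 : Continuous fun t : unitInterval => 1 - (t : ℝ) := by fun_prop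
    have h2 : Continuous fun t : unitInterval => ((t : ℝ) • z.1, z.2) := by fun_prop
    exact h1.smul (hf''.comp h2)
  have hi : Integrable fun t : unitInterval =>
      (1 - (t : ℝ)) • fderiv ℝ (fderiv ℝ f) ((t : ℝ) • z.1, z.2) :=
    hc.integrable_of_hasCompactSupport (HasCompactSupport.of_compactSpace _)
  unfold averagedHessian
  rw [ContinuousLinearMap.integral_apply hi, ContinuousLinearMap.integral_apply
    (hi.apply_continuousLinearMap v), intervalIntegral.integral_of_le zero_le_one,
    ← integral_Icc_eq_integral_Ioc]
  simp only [smul_apply, smul_eq_mul]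
  exact integral_subtype_comap measurableSet_Icc
    fun t : ℝ => (1 - t) * fderiv ℝ (fderiv ℝ f) (t • z.1, z.2) v w

theorem second_deriv_symm {V : Type*} [NormedAddCommGroup V] [NormedSpace ℝ V] {f : V → ℝ} {z : V}
    (hf : ContDiffAt ℝ ∞ f z) (v w : V) :
    fderiv ℝ (fderiv ℝ f) z v w = fderiv ℝ (fderiv ℝ f) z w v :=
  (hf.isSymmSndFDerivAt (by
    rw [minSmoothness_of_isRCLikeNormedField]; exact WithTop.coe_le_coe.2 le_top)) v w

theorem averagedHessian_symm {f : E m × E k → ℝ} (hf : ContDiff ℝ ∞ f) (z v w : E m × E k) :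
    averagedHessian f z v w = averagedHessian f z w v := by
  rw [averagedHessian_apply hf, averagedHessian_apply hf]
  simp only [second_deriv_symm hf.contDiffAt v w]

/-- The operator on the first factor given by the averaged second derivative. -/
def hessOp (f : E m × E k → ℝ) (z : E m × E k) : E m →L[ℝ] E m :=
  ∑ a : Fin m, (((averagedHessian f z).flip (stdVec m a, 0)).comp
    (ContinuousLinearMap.inl ℝ (E m) (E k))).smulRight (stdVec m a)

theorem contDiff_hessOp {f : E m × E k → ℝ} (hf : ContDiff ℝ ∞ f) :
    ContDiff ℝ ∞ (hessOp f) := by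
  have h := contDiff_averagedHessian hf
  refine ContDiff.sum fun a _ => ?_
  refine ContDiff.smulRight ?_ contDiff_const
  refine ContDiff.clm_comp ?_ contDiff_const
  have h2 : ContDiff ℝ ∞ fun z => (averagedHessian f z).flip :=
    (ContinuousLinearMap.flipₗᵢ ℝ (E m × E k) (E m × E k) ℝ).contDiff.comp h
  exact h2.clm_apply contDiff_const

theorem inner_hessOp (f : E m × E k → ℝ) (z : E m × E k) (x y : E m) :
    ⟪hessOp f z x, y⟫ = averagedHessian f z (x, 0) (y, 0) := by
  have hy : (y, (0 : E k)) = ∑ a : Fin m, y a • (stdVec m a, (0 : E k)) := by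
    have h1 : y = ∑ a : Fin m, y a • stdVec m a := by
      conv_lhs => rw [← (EuclideanSpace.basisFun (Fin m) ℝ).sum_repr y]
      simp [stdVec]
    refine Prod.ext ?_ ?_
    · simp [Prod.fst_sum, ← h1]
    · simp [Prod.snd_sum]
  rw [hy, map_sum]
  simp only [hessOp, sum_apply, sum_inner, map_smul]
  refine Finset.sum_congr rfl fun a _ => ?_
  simp [inner_smul_left, stdVec, mul_comm, EuclideanSpace.inner_single_left]

/-- The Morse-Bott lemma: a nonnegative function vanishing for `x = 0`, whose second derivative in
the direction of `x` is the standard one at one point, is there equal to `‖x'‖²` for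
smooth coordinates `(x', u)`. -/
theorem exists_morseBott_coordinates {f : E m × E k → ℝ} (hf : ContDiff ℝ ∞ f)
    (h0 : ∀ u, f (0, u) = 0) (hnn : ∀ z, 0 ≤ f z) {u₀ : E k}
    (hH : ∀ x y : E m, fderiv ℝ (fderiv ℝ f) (0, u₀) (x, 0) (y, 0) = 2 * ⟪x, y⟫)
    {N : Set (E m × E k)} (hN : IsOpen N) (hN0 : (0, u₀) ∈ N) :
    ∃ Φ : OpenPartialHomeomorph (E m × E k) (E m × E k), (0, u₀) ∈ Φ.source ∧ Φ.source ⊆ N ∧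
      ContDiffOn ℝ ∞ Φ.symm Φ.target ∧
      (∀ z ∈ Φ.source, ∃ L : (E m × E k) ≃L[ℝ] (E m × E k), HasFDerivAt Φ
        (L : (E m × E k) →L[ℝ] (E m × E k)) z) ∧
      (∀ u, Φ (0, u) = (0, u)) ∧ ∀ z ∈ Φ.source, ‖(Φ z).1‖ ^ 2 = f z := by
  have h1 : ∀ u, fderiv ℝ f (0, u) = 0 := fun u =>
    IsLocalMin.fderiv_eq_zero (Eventually.of_forall fun z => by rw [h0]; exact hnn z)
  obtain ⟨U, g, hU, h1U, hg, hg1, hgsq, hgsym⟩ := exists_smooth_sqrt m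
  have hop := contDiff_hessOp hf
  have hsymm : ∀ z (x y : E m), ⟪hessOp f z x, y⟫ = ⟪x, hessOp f z y⟫ := fun z x y => by
    rw [inner_hessOp, averagedHessian_symm hf, ← inner_hessOp, real_inner_comm]
  have hop0 : hessOp f (0, u₀) = 1 := by
    refine ContinuousLinearMap.ext fun x => ext_inner_right ℝ fun y => ?_
    rw [inner_hessOp, averagedHessian_apply hf]
    simp only [smul_zero, hH]
    have : ∫ t in (0 : ℝ)..1, (1 - t) * (2 * ⟪x, y⟫) = ⟪x, y⟫ := by
      rw [intervalIntegral.integral_mul_const]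
      have : ∫ t in (0 : ℝ)..1, (1 - t) = 1 / 2 := by
        rw [intervalIntegral.integral_sub (by simp) (by simp)]
        simp; norm_num
      rw [this]; ring
    rw [this]; rfl
  have hquad : ∀ z : E m × E k, f z = ⟪hessOp f z z.1, z.1⟫ := fun z => by
    rw [inner_hessOp, averagedHessian_apply hf]
    exact eq_integral_second_deriv hf (h0 z.2) (h1 z.2)
  set B : E m × E k → (E m →L[ℝ] E m) := fun z => g (hessOp f z) with hB
  set N' : Set (E m × E k) := N ∩ hessOp f ⁻¹' U with hN'
  have hN'o : IsOpen N' := hN.inter (hU.preimage hop.continuous)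
  have hN'0 : (0, u₀) ∈ N' := ⟨hN0, by rw [mem_preimage, hop0]; exact h1U⟩
  have hBs : ContDiffOn ℝ ∞ B N' := hg.comp hop.contDiffOn fun z hz => hz.2
  set F : E m × E k → E m × E k := fun z => (B z z.1, z.2) with hF
  have hFs : ContDiffOn ℝ ∞ F N' := (hBs.clm_apply contDiff_fst.contDiffOn).prodMk
    contDiff_snd.contDiffOn
  have hF' : HasFDerivAt F ((ContinuousLinearEquiv.refl ℝ (E m × E k) :
      (E m × E k) ≃L[ℝ] (E m × E k)) : (E m × E k) →L[ℝ] (E m × E k)) (0, u₀) := by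
    have hBd := ((hBs.contDiffAt (hN'o.mem_nhds hN'0)).differentiableAt (by simp)).hasFDerivAt
    refine ((hBd.clm_apply hasFDerivAt_fst).prodMk hasFDerivAt_snd).congr_fderiv
      (ContinuousLinearMap.ext fun v => ?_)
    have hB0 : B (0, u₀) = 1 := by simp only [B, hop0, hg1]
    refine Prod.ext ?_ ?_
    · simp [hB0]
    · simp
  obtain ⟨Φ, hΦ0, hΦN, hΦ, hΦs, hΦd⟩ := exists_openPartialHomeomorph_of_contDiffOn hN'o hFs hN'0 hF'
  have hΦF : ⇑Φ = F := funext hΦ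
  refine ⟨Φ, hΦ0, fun z hz => (hΦN hz).1, hΦs, by rwa [hΦF], fun u => ?_, fun z hz => ?_⟩
  · rw [hΦ]; simp [F]
  · have hzU := (hΦN hz).2
    rw [hΦ, hquad z, ← real_inner_self_eq_norm_sq]
    change ⟪B z z.1, B z z.1⟫ = _
    rw [← hgsym _ hzU (hsymm z)]
    have := hgsq _ hzU
    conv_rhs => rw [← this]
    rfl

end Hadamard

/-! ### Second derivatives at critical points -/

section SecondDerivative

variable {V W : Type*} [NormedAddCommGroup V] [NormedSpace ℝ V] [NormedAddCommGroup W]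
  [NormedSpace ℝ W]

/-- At a critical point, the second derivative transforms like a bilinear form. -/
theorem second_deriv_comp {F : W → ℝ} {τ : V → W} {a : V} (hF : ContDiffAt ℝ ∞ F (τ a))
    (hτ : ContDiffAt ℝ ∞ τ a) (h0 : fderiv ℝ F (τ a) = 0) (v w : V) :
    fderiv ℝ (fderiv ℝ (F ∘ τ)) a v w =
      fderiv ℝ (fderiv ℝ F) (τ a) (fderiv ℝ τ a v) (fderiv ℝ τ a w) := by
  have hF2 : ContDiffAt ℝ 2 F (τ a) := hF.of_le (WithTop.coe_le_coe.2 le_top)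
  have hτ2 : ContDiffAt ℝ 2 τ a := hτ.of_le (WithTop.coe_le_coe.2 le_top)
  have he : fderiv ℝ (F ∘ τ) =ᶠ[𝓝 a] fun y => (fderiv ℝ F (τ y)).comp (fderiv ℝ τ y) := by
    have h1 := hτ2.continuousAt.eventually (hF2.eventually (by simp))
    have h2 := hτ2.eventually (by simp)
    filter_upwards [h1, h2] with y hy hy'
    exact fderiv_comp y (hy.differentiableAt (by simp)) (hy'.differentiableAt (by simp))
  have hdF : HasFDerivAt (fun y => fderiv ℝ F (τ y))
      ((fderiv ℝ (fderiv ℝ F) (τ a)).comp (fderiv ℝ τ a)) a :=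
    ((hF.fderiv_right (m := ∞) (by simp)).differentiableAt (by simp)).hasFDerivAt.comp a
      (hτ.differentiableAt (by simp)).hasFDerivAt
  have hdτ : HasFDerivAt (fderiv ℝ τ) (fderiv ℝ (fderiv ℝ τ) a) a :=
    ((hτ.fderiv_right (m := ∞) (by simp)).differentiableAt (by simp)).hasFDerivAt
  rw [he.fderiv_eq, (hdF.clm_comp hdτ).fderiv]
  simp [h0]

/-- The second derivative at a minimum is positive semidefinite. -/
theorem second_deriv_nonneg {F : V → ℝ} {a : V} (hF : ContDiffAt ℝ ∞ F a)
    (h0 : F a = 0) (hnn : ∀ᶠ y in 𝓝 a, 0 ≤ F y) (v : V) :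
    0 ≤ fderiv ℝ (fderiv ℝ F) a v v := by
  have hF2 : ContDiffAt ℝ 2 F a := hF.of_le (WithTop.coe_le_coe.2 le_top)
  have hcrit : fderiv ℝ F a = 0 :=
    IsLocalMin.fderiv_eq_zero (hnn.mono fun y hy => by rw [h0]; exact hy)
  set ℓ : ℝ → V := fun t => a + t • v with hℓ
  have hℓ0 : ℓ 0 = a := by simp [ℓ]
  have hℓd : ∀ t, HasDerivAt ℓ v t := fun t => by
    simpa only [one_smul, id] using! ((hasDerivAt_id t).smul_const v).const_add a
  have hℓc : Tendsto ℓ (𝓝 0) (𝓝 a) := by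
    have := (hℓd 0).continuousAt.tendsto
    rwa [hℓ0] at this
  set φ : ℝ → ℝ := fun t => F (ℓ t) with hφ
  have hd1 : deriv φ =ᶠ[𝓝 0] fun t => fderiv ℝ F (ℓ t) v := by
    filter_upwards [hℓc.eventually (hF2.eventually (by simp))] with t ht
    exact ((ht.differentiableAt (by simp)).hasFDerivAt.comp_hasDerivAt t (hℓd t)).deriv
  have hd2 : deriv (deriv φ) 0 = fderiv ℝ (fderiv ℝ F) a v v := by
    rw [hd1.deriv_eq]
    have h2 : HasFDerivAt (fderiv ℝ F) (fderiv ℝ (fderiv ℝ F) a) (ℓ 0) := by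
      rw [hℓ0]
      exact ((hF.fderiv_right (m := ∞) (by simp)).differentiableAt (by simp)).hasFDerivAt
    have h3 := (h2.comp_hasDerivAt 0 (hℓd 0)).clm_apply (hasDerivAt_const (0 : ℝ) v)
    simpa using h3.deriv
  by_contra hneg
  push Not at hneg
  have hmax : IsLocalMax φ 0 := by
    refine isLocalMax_of_deriv_deriv_neg (by rw [hd2]; exact hneg) ?_ ?_
    · rw [hd1.self_of_nhds]; show fderiv ℝ F (ℓ 0) v = 0; rw [hℓ0, hcrit]; rfl
    · exact ContinuousAt.comp (f := ℓ) (by rw [hℓ0]; exact hF.continuousAt)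
        (hℓd 0).continuousAt
  have hφ0 : φ =ᶠ[𝓝 0] fun _ => 0 := by
    filter_upwards [hmax, hℓc.eventually hnn] with t ht ht'
    have : φ 0 = 0 := by simp only [φ, hℓ0, h0]
    rw [this] at ht
    exact le_antisymm ht ht'
  have h1 : deriv φ =ᶠ[𝓝 0] fun _ => 0 := hφ0.deriv.trans (by simp)
  rw [← hd2, h1.deriv_eq] at hneg
  simp at hneg

/-- A positive definite symmetric bilinear form has an orthonormal family of full size. -/
theorem exists_orthonormal_family {T : Type*} [AddCommGroup T] [Module ℝ T]
    [FiniteDimensional ℝ T] (B : LinearMap.BilinForm ℝ T) (hs : LinearMap.IsSymm B)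
    (hp : ∀ v, v ≠ 0 → 0 < B v v) :
    ∃ b : Fin (Module.finrank ℝ T) → T, ∀ i j, B (b i) (b j) = if i = j then 1 else 0 := by
  obtain ⟨v, hv⟩ := LinearMap.BilinForm.exists_orthogonal_basis hs
  refine ⟨fun i => (Real.sqrt (B (v i) (v i)))⁻¹ • v i, fun i j => ?_⟩
  have hpos := hp (v i) (v.ne_zero i)
  simp only [map_smul, LinearMap.smul_apply, smul_eq_mul]
  split_ifs with h
  · subst h
    have := Real.mul_self_sqrt hpos.le
    field_simp
    rw [sq, this]
  · have : B (v i) (v j) = 0 := hv h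
    rw [this]; simp

/-- A positive semidefinite symmetric form of rank `m` is the standard form on the image of a
linear map from `ℝ^m`. -/
theorem exists_orthonormal_map {T : Type*} [NormedAddCommGroup T] [NormedSpace ℝ T]
    [FiniteDimensional ℝ T] {m : ℕ} (H : LinearMap.BilinForm ℝ T) (hs : ∀ v w, H v w = H w v)
    (hnn : ∀ v, 0 ≤ H v v) (hr : Module.finrank ℝ (LinearMap.range H) = m) :
    ∃ N : E m →L[ℝ] T, ∀ a b, H (N a) (N b) = 2 * ⟪a, b⟫ := by
  have hsymm : LinearMap.IsSymm H := ⟨fun v w => by simpa using hs v w⟩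
  obtain ⟨C, hC⟩ := Submodule.exists_isCompl (LinearMap.ker H)
  have hCm : Module.finrank ℝ C = m := by
    have h1 := Submodule.finrank_add_eq_of_isCompl hC
    have h2 := LinearMap.finrank_range_add_finrank_ker H
    omega
  have hpos : ∀ v : C, v ≠ 0 → 0 < H v v := by
    intro v hv
    refine lt_of_le_of_ne (hnn _) fun h0 => hv ?_
    have hker : (v : T) ∈ LinearMap.ker H := by
      rw [LinearMap.mem_ker]
      ext w
      have := LinearMap.BilinForm.apply_sq_le_of_symm H hnn hsymm (v : T) w
      rw [← h0, zero_mul] at this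
      simpa using this
    have := hC.disjoint.le_bot ⟨hker, v.2⟩
    simpa using this
  obtain ⟨b, hb⟩ := exists_orthonormal_family (T := C)
    ((1 / 2 : ℝ) • LinearMap.BilinForm.restrict H C)
    ⟨fun v w => by simpa using hs v w⟩ (fun v hv => by simpa using hpos v hv)
  subst hCm
  refine ⟨∑ i, (EuclideanSpace.proj i : E (Module.finrank ℝ C) →L[ℝ] ℝ).smulRight (b i : T),
    fun x y => ?_⟩
  have hb' : ∀ i j, H (b i) (b j) = if i = j then 2 else 0 := fun i j => by
    have := hb i j
    simp only [LinearMap.smul_apply, smul_eq_mul, LinearMap.BilinForm.restrict_apply] at this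
    have h2 : H (b i) (b j) = 2 * (if i = j then 1 else 0) := by
      rw [← this]; simp [LinearMap.domRestrict_apply]
    rw [h2]; split_ifs <;> simp
  simp only [_root_.sum_apply, ContinuousLinearMap.smulRight_apply, LinearMap.sum_apply,
    map_sum, map_smul, LinearMap.smul_apply, smul_eq_mul, hb', PiLp.inner_apply,
    Finset.mul_sum]
  refine Finset.sum_congr rfl fun i _ => ?_
  rw [Finset.sum_eq_single i (fun j _ hj => by simp [hj]) (by simp)]
  simp
  ring

end SecondDerivative

/-! ### The submanifold in coordinates -/

section Submanifold

variable {n k : ℕ} {X Y : Type*} [TopologicalSpace X] [ChartedSpace (E n) X]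
  [TopologicalSpace Y] [ChartedSpace (E k) Y]

/-- The differential of `i` at `y`, as a map between model spaces. -/
def dmap (n k : ℕ) {X Y : Type*} [TopologicalSpace X] [ChartedSpace (E n) X]
    [TopologicalSpace Y] [ChartedSpace (E k) Y] (i : Y → X) (y : Y) : E k →L[ℝ] E n :=
  mfderiv (𝓡 k) (𝓡 n) i y

/-- The map `i` in the chart of `Y` at `y₁` and the chart of `X` at `i y₁`. -/
def localMap (n k : ℕ) {X Y : Type*} [TopologicalSpace X] [ChartedSpace (E n) X]
    [TopologicalSpace Y] [ChartedSpace (E k) Y] (i : Y → X) (y₁ : Y) : E k → E n := fun u =>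
  chartAt (E n) (i y₁) (i ((chartAt (E k) y₁).symm u))

theorem restrict_apply (i : Y → X) {p : ℕ} (φ : DForm n X p) (y : Y) (v : Fin p → E k) :
    (show E k [⋀^Fin p]→ₗ[ℝ] ℂ from restrict i φ y) v =
      (show E n [⋀^Fin p]→ₗ[ℝ] ℂ from φ (i y)) fun a => dmap n k i y (v a) := rfl

/-- The domain of `localMap`. -/
def localDomain (n k : ℕ) {X Y : Type*} [TopologicalSpace X] [ChartedSpace (E n) X]
    [TopologicalSpace Y] [ChartedSpace (E k) Y] (i : Y → X) (y₁ : Y) : Set (E k) :=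
  {u | u ∈ (chartAt (E k) y₁).target ∧
    i ((chartAt (E k) y₁).symm u) ∈ (chartAt (E n) (i y₁)).source}

theorem isOpen_localDomain {i : Y → X} (hi : Continuous i) (y₁ : Y) :
    IsOpen (localDomain n k i y₁) :=
  ((chartAt (E k) y₁).continuousOn_symm.isOpen_inter_preimage (chartAt (E k) y₁).open_target
    ((chartAt (E n) (i y₁)).open_source.preimage hi))

theorem center_mem_localDomain (i : Y → X) (y₁ : Y) :
    chartAt (E k) y₁ y₁ ∈ localDomain n k i y₁ := by
  refine ⟨mem_chart_target _ _, ?_⟩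
  rw [(chartAt (E k) y₁).left_inv (mem_chart_source _ _)]
  exact mem_chart_source _ _

theorem localMap_center (i : Y → X) (y₁ : Y) :
    localMap n k i y₁ (chartAt (E k) y₁ y₁) = chartAt (E n) (i y₁) (i y₁) := by
  rw [localMap, (chartAt (E k) y₁).left_inv (mem_chart_source _ _)]

theorem localMap_mem_target {i : Y → X} {y₁ : Y} {u : E k} (hu : u ∈ localDomain n k i y₁) :
    localMap n k i y₁ u ∈ (chartAt (E n) (i y₁)).target :=
  (chartAt (E n) (i y₁)).map_source hu.2

theorem symm_localMap {i : Y → X} {y₁ : Y} {u : E k} (hu : u ∈ localDomain n k i y₁) :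
    (chartAt (E n) (i y₁)).symm (localMap n k i y₁ u) = i ((chartAt (E k) y₁).symm u) :=
  (chartAt (E n) (i y₁)).left_inv hu.2

theorem contDiffOn_comp_chart_symm [IsManifold (𝓡 n) ∞ X] {f : X → ℝ}
    (hf : ContMDiff (𝓡 n) 𝓘(ℝ, ℝ) ∞ f) (x : X) :
    ContDiffOn ℝ ∞ (f ∘ (chartAt (E n) x).symm) (chartAt (E n) x).target := by
  rw [← contMDiffOn_iff_contDiffOn]
  exact hf.comp_contMDiffOn (contMDiffOn_chart_symm (I := 𝓡 n) (x := x))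

/-- An immersion has injective differentials. -/
theorem dmap_injective {i : Y → X} (hi : Manifold.IsImmersion (𝓡 k) (𝓡 n) ∞ i) (y : Y) :
    Function.Injective (dmap n k i y) := by
  have h := hi.isImmersionAt y
  have hcont : ContMDiff (𝓡 k) (𝓡 n) ∞ i := hi.contMDiff
  set ρ : X → Y := fun x => h.domChart.symm (h.equiv.symm (h.codChart x)).1 with hρ
  have hval : ∀ y' ∈ h.domChart.source, h.codChart (i y') = h.equiv (h.domChart y', 0) := by
    intro y' hy'
    have := h.writtenInCharts (show h.domChart y' ∈ (h.domChart.extend (𝓡 k)).target by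
      simpa using h.domChart.map_source hy')
    simpa [h.domChart.left_inv hy'] using this
  have hleft : ∀ y' ∈ h.domChart.source, ρ (i y') = y' := fun y' hy' => by
    simp only [ρ, hval y' hy', ContinuousLinearEquiv.symm_apply_apply, h.domChart.left_inv hy']
  have hρd : MDifferentiableAt (𝓡 n) (𝓡 k) ρ (i y) := by
    have h1 : ContMDiffAt (𝓡 n) (𝓡 n) ∞ h.codChart (i y) :=
      contMDiffAt_of_mem_maximalAtlas h.codChart_mem_maximalAtlas h.mem_codChart_source
    have h2 : ContMDiffAt (𝓡 k) (𝓡 k) ∞ h.domChart.symm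
        ((h.equiv.symm (h.codChart (i y))).1) := by
      refine contMDiffAt_symm_of_mem_maximalAtlas h.domChart_mem_maximalAtlas ?_
      rw [hval y h.mem_domChart_source, ContinuousLinearEquiv.symm_apply_apply]
      exact h.domChart.map_source h.mem_domChart_source
    have h3 : ContMDiffAt (𝓡 n) (𝓡 k) ∞ (fun z : E n => (h.equiv.symm z).1)
        (h.codChart (i y)) := by
      refine ContDiffAt.contMDiffAt ?_
      exact (contDiff_fst.comp h.equiv.symm.contDiff).contDiffAt
    exact (ContMDiffAt.comp (i y) h2 (ContMDiffAt.comp (i y) h3 h1)).mdifferentiableAt (by simp)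
  have hcomp := mfderiv_comp y hρd ((hcont y).mdifferentiableAt (by simp))
  have hid : ρ ∘ i =ᶠ[𝓝 y] id := by
    filter_upwards [h.domChart.open_source.mem_nhds h.mem_domChart_source] with y' hy'
    exact hleft y' hy'
  have hid2 : (mfderiv (𝓡 k) (𝓡 k) (ρ ∘ i) y : E k →L[ℝ] E k) = ContinuousLinearMap.id ℝ (E k) :=
    hid.mfderiv_eq.trans mfderiv_id
  refine Function.LeftInverse.injective
    (g := (mfderiv (𝓡 n) (𝓡 k) ρ (i y) : E n →L[ℝ] E k)) fun v => ?_
  have := congrArg (fun L : E k →L[ℝ] E k => L v) (hcomp.symm.trans hid2)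
  exact this

variable [IsManifold (𝓡 n) ∞ X] [IsManifold (𝓡 k) ∞ Y]

theorem contDiffOn_localMap {i : Y → X} (hi : ContMDiff (𝓡 k) (𝓡 n) ∞ i) (y₁ : Y) :
    ContDiffOn ℝ ∞ (localMap n k i y₁) (localDomain n k i y₁) := by
  have := (contMDiff_iff.1 hi).2 y₁ (i y₁)
  refine this.mono fun u hu => ?_
  simpa [localDomain] using hu

/-- The differential of `i` in terms of the charts at `y₁` and at `i y₁`. -/
theorem dmap_comp_jac {i : Y → X} (hi : ContMDiff (𝓡 k) (𝓡 n) ∞ i) {y₁ : Y} {u : E k}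
    (hu : u ∈ localDomain n k i y₁) :
    (dmap n k i ((chartAt (E k) y₁).symm u)).comp (jac (d := k) y₁ u) =
      (jac (d := n) (i y₁) (localMap n k i y₁ u)).comp (fderiv ℝ (localMap n k i y₁) u) := by
  set y := (chartAt (E k) y₁).symm u with hy
  have hopen := isOpen_localDomain (n := n) (k := k) hi.continuous y₁
  have hys : y ∈ (chartAt (E k) y).source := mem_chart_source _ _
  have hy1 : y ∈ (chartAt (E k) y₁).source := (chartAt (E k) y₁).map_target hu.1
  have hιd : DifferentiableAt ℝ (localMap n k i y₁) u :=
    ((contDiffOn_localMap hi y₁).contDiffAt (hopen.mem_nhds hu)).differentiableAt (by simp)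
  have hJ := fderiv_chart_symm_comp hιd (localMap_mem_target hu)
  rw [symm_localMap hu, ← hy] at hJ
  set G : E k → E n := fun v => chartAt (E n) (i y)
    ((chartAt (E n) (i y₁)).symm (localMap n k i y₁ v)) with hG
  rw [← hJ]
  have hGd : DifferentiableAt ℝ G u := by
    have h1 : DifferentiableAt ℝ (trans n (i y₁) (i y)) (localMap n k i y₁ u) :=
      differentiableAt_trans (localMap_mem_target hu) (by
        rw [symm_localMap hu]; exact mem_chart_source _ _)
    exact h1.comp u hιd
  have hmd : MDifferentiableAt (𝓡 k) (𝓡 n) i y := (hi y).mdifferentiableAt (by simp)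
  have hyt : chartAt (E k) y y ∈ (chartAt (E k) y).target := mem_chart_target _ _
  have hyl : (chartAt (E k) y).symm (chartAt (E k) y y) = y := (chartAt (E k) y).left_inv hys
  have htu : trans k y y₁ (chartAt (E k) y y) = u := by
    rw [trans, hyl, hy, (chartAt (E k) y₁).right_inv hu.1]
  have hmf : dmap n k i y = (fderiv ℝ G u).comp (fderiv ℝ (trans k y y₁) (chartAt (E k) y y)) := by
    have h0 : dmap n k i y = fderiv ℝ
        (fun v => chartAt (E n) (i y) (i ((chartAt (E k) y).symm v))) (chartAt (E k) y y) := by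
      have := hmd.mfderiv
      simp only [fderivWithin_univ, mfld_simps] at this
      exact this
    rw [h0]
    have hd2 : DifferentiableAt ℝ (trans k y y₁) (chartAt (E k) y y) :=
      differentiableAt_trans hyt (by rw [hyl]; exact hy1)
    have hcomp : fderiv ℝ (G ∘ trans k y y₁) (chartAt (E k) y y) =
        (fderiv ℝ G u).comp (fderiv ℝ (trans k y y₁) (chartAt (E k) y y)) := by
      rw [fderiv_comp _ (by rw [htu]; exact hGd) hd2, htu]
    rw [← hcomp]
    refine Filter.EventuallyEq.fderiv_eq ?_
    have h1 : ∀ᶠ v in 𝓝 (chartAt (E k) y y), trans k y y₁ v ∈ localDomain n k i y₁ :=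
      hd2.continuousAt.eventually (by rw [htu]; exact hopen.mem_nhds hu)
    have h2 := (isOpen_trans_domain y y₁).mem_nhds ⟨hyt, by rw [hyl]; exact hy1⟩
    filter_upwards [h1, h2] with v hv hv2
    simp only [G, Function.comp_apply]
    rw [symm_localMap hv, symm_trans hv2.2]
  rw [hmf, jac_eq hu.1, ContinuousLinearMap.comp_assoc]
  have hinv := fderiv_trans_inv (x₀ := y₁) (x₁ := y) hu.1 (by rw [← hy]; exact hys)
  have : trans k y₁ y u = chartAt (E k) y y := by rw [trans]
  rw [this] at hinv
  rw [← hy, hinv]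
  rfl

/-- The map `i` in coordinates is an immersion. -/
theorem fderiv_localMap_injective {i : Y → X} (hi : Manifold.IsImmersion (𝓡 k) (𝓡 n) ∞ i)
    {y₁ : Y} {u : E k} (hu : u ∈ localDomain n k i y₁) :
    Function.Injective (fderiv ℝ (localMap n k i y₁) u) := by
  have h := dmap_comp_jac hi.contMDiff hu
  have hj : Function.Injective (jac (d := k) y₁ u) :=
    (LinearMap.equivOfDetNeZero _ (det_jac_ne_zero hu.1)).injective
  have : Function.Injective
      ((jac (d := n) (i y₁) (localMap n k i y₁ u)).comp (fderiv ℝ (localMap n k i y₁) u)) := by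
    rw [← h]
    exact (dmap_injective hi _).comp hj
  exact Function.Injective.of_comp this

end Submanifold

/-! ### Morse-Bott coordinates adapted to the charts -/

section Adapted

variable {n m k : ℕ} {X Y : Type*} [TopologicalSpace X] [ChartedSpace (E n) X]
  [TopologicalSpace Y] [ChartedSpace (E k) Y]

/-- Morse-Bott coordinates `(x, u)` near `i y₁`: a diffeomorphism `κ` from an open subset of
`ℝ^m × ℝ^k` onto an open subset of the chart of `X` at `i y₁`, such that `μ = |x|²` and such that
`(0, u)` is the point of `Y` with coordinate `u` in the chart at `y₁`. -/
structure IsAdaptedChart (i : Y → X) (μ : X → ℝ) (y₁ : Y)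
    (κ : OpenPartialHomeomorph (E m × E k) (E n)) : Prop where
  mem_source : ((0 : E m), chartAt (E k) y₁ y₁) ∈ κ.source
  target_subset : κ.target ⊆ (chartAt (E n) (i y₁)).target
  contDiffOn : ContDiffOn ℝ ∞ κ κ.source
  contDiffOn_symm : ContDiffOn ℝ ∞ κ.symm κ.target
  exists_hasFDerivAt : ∀ z ∈ κ.source, ∃ L : (E m × E k) ≃L[ℝ] E n,
    HasFDerivAt κ (L : (E m × E k) →L[ℝ] E n) z
  norm_sq : ∀ z ∈ κ.source, μ ((chartAt (E n) (i y₁)).symm (κ z)) = ‖z.1‖ ^ 2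
  zero_mem : ∀ u, ((0 : E m), u) ∈ κ.source → u ∈ (chartAt (E k) y₁).target
  apply_zero : ∀ u, ((0 : E m), u) ∈ κ.source →
    (chartAt (E n) (i y₁)).symm (κ (0, u)) = i ((chartAt (E k) y₁).symm u)

/-- A smooth function on an open set, cut off by a smooth function supported in it. -/
theorem contDiff_mul_of_tsupport_subset {V : Type*} [NormedAddCommGroup V] [NormedSpace ℝ V]
    {b F : V → ℝ} {U : Set V} (hU : IsOpen U) (hb : ContDiff ℝ ∞ b) (hF : ContDiffOn ℝ ∞ F U)
    (hs : tsupport b ⊆ U) : ContDiff ℝ ∞ fun z => b z * F z := by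
  refine contDiff_iff_contDiffAt.2 fun z => ?_
  by_cases hz : z ∈ U
  · exact hb.contDiffAt.mul (hF.contDiffAt (hU.mem_nhds hz))
  · have : (fun z => b z * F z) =ᶠ[𝓝 z] fun _ => 0 := by
      have h := (isClosed_tsupport b).isOpen_compl.mem_nhds fun h => hz (hs h)
      filter_upwards [h] with y hy
      rw [image_eq_zero_of_notMem_tsupport hy, zero_mul]
    exact contDiffAt_const.congr_of_eventuallyEq this

variable [IsManifold (𝓡 n) ∞ X] [IsManifold (𝓡 k) ∞ Y]

/-- At a point of the zero set there is a normal frame, orthonormal for half of the Hessian; it is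
given as a linear map `N` from `ℝ^m`. -/
theorem IsMorseBott.exists_normal_map {i : Y → X} {μ : X → ℝ}
    (hμ : IsMorseBott (n := n) i μ m) (y : Y) :
    ∃ N : E m →L[ℝ] E n, ∀ a b,
      fderiv ℝ (fderiv ℝ (μ ∘ (chartAt (E n) (i y)).symm)) (chartAt (E n) (i y) (i y)) (N a) (N b) =
        2 * ⟪a, b⟫ := by
  set F := μ ∘ (chartAt (E n) (i y)).symm with hF
  set a := chartAt (E n) (i y) (i y) with ha
  have hat : a ∈ (chartAt (E n) (i y)).target := mem_chart_target _ _
  have hFs : ContDiffAt ℝ ∞ F a := (contDiffOn_comp_chart_symm hμ.smooth (i y)).contDiffAt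
    ((chartAt (E n) (i y)).open_target.mem_nhds hat)
  have hF0 : F a = 0 := by
    simp only [F, a, Function.comp_apply, (chartAt (E n) (i y)).left_inv (mem_chart_source _ _)]
    exact (hμ.zero_iff _).2 (mem_range_self _)
  exact exists_orthonormal_map (H := (fderiv ℝ (fderiv ℝ F) a).toLinearMap₁₂)
    (fun v w => second_deriv_symm hFs v w)
    (fun v => second_deriv_nonneg hFs hF0 (Eventually.of_forall fun z => hμ.nonneg _) v)
    (hμ.rank_hessian y)

/-- Existence of Morse-Bott coordinates. The map `τ (x, u) = i(u) + N x` parametrizes a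
neighbourhood of the point of `Y`, since the Hessian vanishes on tangent vectors and is nondegenerate on the image
of `N`; in these coordinates the Morse-Bott lemma for `ℝ^m × ℝ^k` applies. -/
theorem IsMorseBott.exists_adaptedChart {i : Y → X} {μ : X → ℝ} (hmk : m + k = n)
    (hi : Manifold.IsImmersion (𝓡 k) (𝓡 n) ∞ i)
    (hμ : IsMorseBott (n := n) i μ m) (y₁ : Y) :
    ∃ κ : OpenPartialHomeomorph (E m × E k) (E n), IsAdaptedChart i μ y₁ κ := by
  obtain ⟨N, hN⟩ := hμ.exists_normal_map y₁
  have his := hi.contMDiff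
  set c := chartAt (E n) (i y₁) with hc
  set u₁ := chartAt (E k) y₁ y₁ with hu₁
  set F := μ ∘ c.symm with hF
  set ι := localMap n k i y₁ with hι
  set O := localDomain n k i y₁ with hO
  have hFs : ContDiffOn ℝ ∞ F c.target := contDiffOn_comp_chart_symm hμ.smooth (i y₁)
  have hFn : ∀ z, 0 ≤ F z := fun z => hμ.nonneg _
  have hOo : IsOpen O := isOpen_localDomain his.continuous y₁
  have hu₁O : u₁ ∈ O := center_mem_localDomain i y₁
  have hιs : ContDiffOn ℝ ∞ ι O := contDiffOn_localMap his y₁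
  have hιt : ∀ u ∈ O, ι u ∈ c.target := fun u hu => localMap_mem_target hu
  have hι1 : ι u₁ = c (i y₁) := localMap_center i y₁
  have hFι : ∀ u ∈ O, F (ι u) = 0 := fun u hu => by
    simp only [F, Function.comp_apply]
    rw [symm_localMap hu]
    exact (hμ.zero_iff _).2 (mem_range_self _)
  have hdF : ∀ u ∈ O, fderiv ℝ F (ι u) = 0 := fun u hu =>
    IsLocalMin.fderiv_eq_zero (Eventually.of_forall fun z => by rw [hFι u hu]; exact hFn z)
  have hFa : ContDiffAt ℝ ∞ F (ι u₁) := hFs.contDiffAt (c.open_target.mem_nhds (hιt _ hu₁O))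
  have hιa : ContDiffAt ℝ ∞ ι u₁ := hιs.contDiffAt (hOo.mem_nhds hu₁O)
  rw [← hι1] at hN
  -- tangent vectors are in the kernel of the Hessian
  have hker : ∀ v, fderiv ℝ (fderiv ℝ F) (ι u₁) (fderiv ℝ ι u₁ v) = 0 := by
    intro v
    have h1 : HasFDerivAt (fun u => fderiv ℝ F (ι u))
        ((fderiv ℝ (fderiv ℝ F) (ι u₁)).comp (fderiv ℝ ι u₁)) u₁ :=
      ((hFa.fderiv_right (m := ∞) (by simp)).differentiableAt (by simp)).hasFDerivAt.comp u₁
        (hιa.differentiableAt (by simp)).hasFDerivAt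
    have h2 : (fun u => fderiv ℝ F (ι u)) =ᶠ[𝓝 u₁] fun _ => 0 := by
      filter_upwards [hOo.mem_nhds hu₁O] with u hu using hdF u hu
    have h3 := h1.unique ((hasFDerivAt_const (0 : E n →L[ℝ] ℝ) u₁).congr_of_eventuallyEq h2)
    exact congrArg (fun L : E k →L[ℝ] (E n →L[ℝ] ℝ) => L v) h3
  set τ : E m × E k → E n := fun z => ι z.2 + N z.1 with hτ
  set D : Set (E m × E k) := {z | z.2 ∈ O ∧ τ z ∈ c.target} with hD
  have hτc : ContDiffOn ℝ ∞ τ (Prod.snd ⁻¹' O) := by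
    refine ContDiffOn.add (hιs.comp contDiff_snd.contDiffOn fun z hz => hz) ?_
    exact (N.contDiff.comp contDiff_fst).contDiffOn
  have hDo : IsOpen D :=
    hτc.continuousOn.isOpen_inter_preimage (hOo.preimage continuous_snd) c.open_target
  have hτD : ContDiffOn ℝ ∞ τ D := hτc.mono fun z hz => hz.1
  have hτ0 : ∀ u, τ (0, u) = ι u := fun u => by simp [τ]
  have haD : ((0 : E m), u₁) ∈ D := ⟨hu₁O, by rw [hτ0]; exact hιt _ hu₁O⟩
  set τ' : E m × E k →L[ℝ] E n :=
    (fderiv ℝ ι u₁).comp (ContinuousLinearMap.snd ℝ (E m) (E k)) +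
      N.comp (ContinuousLinearMap.fst ℝ (E m) (E k)) with hτ'
  have hτd : HasFDerivAt τ τ' (0, u₁) := by
    refine HasFDerivAt.add ?_ ?_
    · exact HasFDerivAt.comp (f := Prod.snd) ((0 : E m), u₁)
        (hιa.differentiableAt (by simp)).hasFDerivAt hasFDerivAt_snd
    · exact N.hasFDerivAt.comp _ hasFDerivAt_fst
  have hinj : Function.Injective τ' := by
    refine (injective_iff_map_eq_zero τ').2 fun z hz => ?_
    have hz' : fderiv ℝ ι u₁ z.2 + N z.1 = 0 := hz
    have h1 : z.1 = 0 := by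
      have := congrArg (fun v => fderiv ℝ (fderiv ℝ F) (ι u₁) v (N z.1)) hz'
      simp only [map_add, hker, zero_add, hN, map_zero, _root_.zero_apply] at this
      have h2 : ⟪z.1, z.1⟫ = 0 := by linarith
      exact inner_self_eq_zero.1 h2
    rw [h1, map_zero, add_zero] at hz'
    have h2 : z.2 = 0 := fderiv_localMap_injective hi hu₁O (by rw [map_zero]; exact hz')
    exact Prod.ext h1 h2
  have hfin : Module.finrank ℝ (E m × E k) = Module.finrank ℝ (E n) := by
    simp [hmk]
  -- an injective linear map between spaces of the same dimension `m + k = n`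
  set τL : (E m × E k) ≃L[ℝ] E n :=
    (LinearEquiv.ofInjectiveOfFinrankEq τ'.toLinearMap hinj hfin).toContinuousLinearEquiv
  have hτL : (τL : (E m × E k) →L[ℝ] E n) = τ' := ContinuousLinearMap.ext fun z => rfl
  obtain ⟨T, haT, hTD, hTτ, hTsymm, hTd⟩ :=
    exists_openPartialHomeomorph_of_contDiffOn hDo hτD haD (F' := τL) (by rw [hτL]; exact hτd)
  -- the function `μ` in the coordinates `T`, cut off away from the centre
  obtain ⟨R, hR0, hRT⟩ := Metric.isOpen_iff.1 T.open_source _ haT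
  let b : ContDiffBump ((0 : E m), u₁) := ⟨R / 4, R / 2, by positivity, by linarith⟩
  have hbT : tsupport b ⊆ T.source := by
    rw [b.tsupport_eq]
    exact (Metric.closedBall_subset_ball (by simp only [b]; linarith)).trans hRT
  have hFτ : ContDiffOn ℝ ∞ (fun z => F (τ z)) T.source :=
    hFs.comp (hτD.mono hTD) fun z hz => (hTD hz).2
  set f : E m × E k → ℝ := fun z => b z * F (τ z) with hf
  have hfs : ContDiff ℝ ∞ f :=
    contDiff_mul_of_tsupport_subset T.open_source b.contDiff hFτ hbT
  have hf0 : ∀ u, f (0, u) = 0 := fun u => by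
    by_cases hu : ((0 : E m), u) ∈ T.source
    · simp only [f, hτ0, hFι u (hTD hu).1, mul_zero]
    · simp only [f, image_eq_zero_of_notMem_tsupport fun h => hu (hbT h), zero_mul]
  have hfn : ∀ z, 0 ≤ f z := fun z => mul_nonneg b.nonneg (hFn _)
  have hball : ∀ z ∈ Metric.ball ((0 : E m), u₁) (R / 4), f z = F (τ z) := fun z hz => by
    simp only [f, b.one_of_mem_closedBall (Metric.ball_subset_closedBall hz), one_mul]
  have hfev : f =ᶠ[𝓝 (0, u₁)] F ∘ τ := by
    filter_upwards [Metric.ball_mem_nhds ((0 : E m), u₁) (by positivity : 0 < R / 4)] with z hz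
    exact hball z hz
  have hfH : ∀ x y : E m, fderiv ℝ (fderiv ℝ f) (0, u₁) (x, 0) (y, 0) = 2 * ⟪x, y⟫ := by
    intro x y
    have h1 : fderiv ℝ f =ᶠ[𝓝 (0, u₁)] fderiv ℝ (F ∘ τ) := hfev.fderiv
    rw [h1.fderiv_eq, second_deriv_comp (by rw [hτ0]; exact hFa)
      (hτD.contDiffAt (hDo.mem_nhds haD)) (by rw [hτ0]; exact hdF _ hu₁O), hτd.fderiv, hτ0, ← hN]
    simp [τ']
  obtain ⟨Φ, haΦ, hΦN, hΦs, hΦd, hΦ0, hΦn⟩ := exists_morseBott_coordinates hfs hf0 hfn hfH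
    (N := T.source ∩ Metric.ball ((0 : E m), u₁) (R / 4))
    (T.open_source.inter Metric.isOpen_ball) ⟨haT, Metric.mem_ball_self (by positivity)⟩
  set S : Set (E m × E k) := {z | ((0 : E m), z.2) ∈ Φ.source} with hS
  have hSo : IsOpen S := Φ.open_source.preimage (by fun_prop)
  have hΦ0s : ∀ u, ((0 : E m), u) ∈ Φ.source → Φ.symm (0, u) = (0, u) := fun u hu => by
    conv_lhs => rw [← hΦ0 u]
    exact Φ.left_inv hu
  set κ := (Φ.symm.trans T).restrOpen S hSo with hκ
  have hκs : ∀ z ∈ κ.source, z ∈ Φ.target ∧ Φ.symm z ∈ T.source ∧ ((0 : E m), z.2) ∈ Φ.source := by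
    intro z hz
    simp only [κ, OpenPartialHomeomorph.restrOpen_source, OpenPartialHomeomorph.trans_source,
      OpenPartialHomeomorph.symm_source] at hz
    exact ⟨hz.1.1, hz.1.2, hz.2⟩
  have hκe : ∀ z, κ z = τ (Φ.symm z) := fun z => hTτ _
  have hκt : κ.target ⊆ T.target := fun w hw => by
    rw [← κ.right_inv hw, hκe, ← hTτ]
    exact T.map_source (hκs _ (κ.map_target hw)).2.1
  have hκD : ∀ z ∈ κ.source, ∃ L : (E m × E k) ≃L[ℝ] E n,
      HasFDerivAt κ (L : (E m × E k) →L[ℝ] E n) z := by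
    intro z hz
    obtain ⟨h1, h2, -⟩ := hκs z hz
    obtain ⟨L₁, hL₁⟩ := hΦd _ (Φ.map_target h1)
    obtain ⟨L₂, hL₂⟩ := hTd _ h2
    have h3 := Φ.hasFDerivAt_symm h1 hL₁
    refine ⟨L₁.symm.trans L₂, ?_⟩
    exact HasFDerivAt.congr_of_eventuallyEq (hL₂.comp z h3) (Eventually.of_forall hκe)
  have hκc : ContDiffOn ℝ ∞ κ κ.source := by
    refine ContDiffOn.congr (hτD.comp (hΦs.mono fun z hz => (hκs z hz).1)
      fun z hz => hTD (hκs z hz).2.1) fun z _ => hκe z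
  refine ⟨κ, ?_, ?_, hκc, ?_, hκD, ?_, ?_, ?_⟩
  · simp only [κ, OpenPartialHomeomorph.restrOpen_source, OpenPartialHomeomorph.trans_source,
      OpenPartialHomeomorph.symm_source]
    refine ⟨⟨?_, ?_⟩, haΦ⟩
    · rw [← hΦ0 u₁]; exact Φ.map_source haΦ
    · rw [mem_preimage, hΦ0s _ haΦ]; exact haT
  · intro w hw
    rw [← κ.right_inv hw, hκe]
    exact (hTD (hκs _ (κ.map_target hw)).2.1).2
  · intro w hw
    obtain ⟨L, hL⟩ := hκD _ (κ.map_target hw)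
    exact (κ.contDiffAt_symm hw hL (hκc.contDiffAt
      (κ.open_source.mem_nhds (κ.map_target hw)))).contDiffWithinAt
  · intro z hz
    obtain ⟨h1, h2, -⟩ := hκs z hz
    have h3 := Φ.map_target h1
    have h4 := hΦn _ h3
    rw [Φ.right_inv h1, hball _ (hΦN h3).2] at h4
    rw [h4, hκe]
    rfl
  · intro u hu
    obtain ⟨-, -, h3⟩ := hκs _ hu
    exact (hTD (hΦN h3).1).1.1
  · intro u hu
    obtain ⟨-, -, h3⟩ := hκs _ hu
    rw [hκe, hΦ0s _ h3, hτ0]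
    exact symm_localMap (hTD (hΦN h3).1).1

end Adapted

/-! ### The normal volume form in adapted coordinates -/

section Determinant

variable {m k : ℕ}

theorem joinEquiv_castAdd (z : E m × E k) (a : Fin m) :
    joinEquiv m k z (Fin.castAdd k a) = z.1 a := by
  simp [joinEquiv, EuclideanSpace.finAddEquivProd]

theorem joinEquiv_natAdd (z : E m × E k) (b : Fin k) :
    joinEquiv m k z (Fin.natAdd m b) = z.2 b := by
  simp [joinEquiv, EuclideanSpace.finAddEquivProd]

/-- The determinant of a block triangular family of vectors. -/
theorem det_append_joinEquiv (x : Fin m → E m × E k) (t : Fin k → E k) :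
    (EuclideanSpace.basisFun (Fin (m + k)) ℝ).toBasis.det
      (Fin.append (fun b => joinEquiv m k (x b)) fun a => joinEquiv m k (0, t a)) =
    (Matrix.of fun a b => (x a).1 b).det * (EuclideanSpace.basisFun (Fin k) ℝ).toBasis.det t := by
  rw [Module.Basis.det_apply, Module.Basis.det_apply,
    ← Matrix.det_submatrix_equiv_self (finSumFinEquiv (m := m) (n := k))]
  have : ((EuclideanSpace.basisFun (Fin (m + k)) ℝ).toBasis.toMatrix
      (Fin.append (fun b => joinEquiv m k (x b)) fun a => joinEquiv m k (0, t a))).submatrix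
        finSumFinEquiv finSumFinEquiv =
      Matrix.fromBlocks (Matrix.of fun a b => (x a).1 b).transpose 0
        (Matrix.of fun a b => (x b).2 a)
        ((EuclideanSpace.basisFun (Fin k) ℝ).toBasis.toMatrix t) := by
    ext a b
    rcases a with a | a <;> rcases b with b | b <;>
      simp [Module.Basis.toMatrix_apply, joinEquiv_castAdd, joinEquiv_natAdd]
  rw [this, Matrix.det_fromBlocks_zero₁₂, Matrix.det_transpose]

end Determinant

section Pointwise

variable {n m k : ℕ} {X Y : Type*} [TopologicalSpace X] [ChartedSpace (E n) X]
  [TopologicalSpace Y] [ChartedSpace (E k) Y]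

/-- The value of a form at a point, as an alternating form on the model space. -/
def formAt {d : ℕ} {M : Type*} [TopologicalSpace M] [ChartedSpace (E d) M] {p : ℕ}
    (ψ : DForm d M p) (x : M) : E d [⋀^Fin p]→ₗ[ℝ] ℂ := ψ x

/-- The differential of the parametrization `κ` followed by the inverse of the chart at `i y₁`. -/
def frameMap (i : Y → X) (y₁ : Y) (κ : E m × E k → E n) (z : E m × E k) : E m × E k →L[ℝ] E n :=
  (jac (d := n) (i y₁) (κ z)).comp (fderiv ℝ κ z)

/-- The pullback of a form on `X` by the parametrization `κ` followed by the inverse of the chart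
at `i y₁`. -/
def inCoords {p : ℕ} (i : Y → X) (y₁ : Y) (κ : E m × E k → E n) (ψ : DForm n X p)
    (z : E m × E k) : (E m × E k) [⋀^Fin p]→ₗ[ℝ] ℂ :=
  (formAt ψ ((chartAt (E n) (i y₁)).symm (κ z))).compLinearMap (frameMap i y₁ κ z).toLinearMap

theorem inCoords_apply {p : ℕ} (i : Y → X) (y₁ : Y) (κ : E m × E k → E n) (ψ : DForm n X p)
    (z : E m × E k) (v : Fin p → E m × E k) :
    inCoords i y₁ κ ψ z v = inChart ψ (i y₁) (κ z) fun a => fderiv ℝ κ z (v a) := rfl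

variable [IsManifold (𝓡 n) ∞ X] [IsManifold (𝓡 k) ∞ Y]
variable {i : Y → X} {μ : X → ℝ} {y₁ : Y} {κ : OpenPartialHomeomorph (E m × E k) (E n)}

theorem IsAdaptedChart.contDiffAt (hκ : IsAdaptedChart i μ y₁ κ) {z : E m × E k}
    (hz : z ∈ κ.source) : ContDiffAt ℝ ∞ κ z :=
  hκ.contDiffOn.contDiffAt (κ.open_source.mem_nhds hz)

theorem IsAdaptedChart.mem_target (hκ : IsAdaptedChart i μ y₁ κ) {z : E m × E k}
    (hz : z ∈ κ.source) : κ z ∈ (chartAt (E n) (i y₁)).target :=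
  hκ.target_subset (κ.map_source hz)

theorem IsAdaptedChart.frameMap_bijective (hκ : IsAdaptedChart i μ y₁ κ) {z : E m × E k}
    (hz : z ∈ κ.source) : Function.Bijective (frameMap i y₁ κ z) := by
  obtain ⟨L, hL⟩ := hκ.exists_hasFDerivAt z hz
  rw [frameMap, hL.fderiv]
  exact (LinearMap.equivOfDetNeZero _ (det_jac_ne_zero (hκ.mem_target hz))).bijective.comp
    L.bijective

/-- Smoothness of the coefficients in adapted coordinates. -/
theorem IsAdaptedChart.contDiffOn_inCoords (hκ : IsAdaptedChart i μ y₁ κ) {p : ℕ}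
    {ψ : DForm n X p} (hψ : IsSmoothForm ψ) (v : Fin p → E m × E k) :
    ContDiffOn ℝ ∞ (fun z => inCoords i y₁ κ ψ z v) κ.source := by
  intro z hz
  refine ContDiffAt.contDiffWithinAt ?_
  simp only [inCoords_apply]
  refine contDiffAt_alternating_apply (a := fun z => inChart ψ (i y₁) (κ z)) (fun w => ?_)
    fun a => ?_
  · exact ContDiffAt.comp z ((hψ (i y₁) w).contDiffAt
      ((chartAt (E n) (i y₁)).open_target.mem_nhds (hκ.mem_target hz))) (hκ.contDiffAt hz)
  · exact ((hκ.contDiffAt hz).fderiv_right (m := ∞) (by simp)).clm_apply contDiffAt_const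

theorem IsAdaptedChart.mem_localDomain (hκ : IsAdaptedChart i μ y₁ κ) {u : E k}
    (hu : ((0 : E m), u) ∈ κ.source) : u ∈ localDomain n k i y₁ := by
  refine ⟨hκ.zero_mem u hu, ?_⟩
  rw [← hκ.apply_zero u hu]
  exact (chartAt (E n) (i y₁)).map_target (hκ.mem_target hu)

theorem IsAdaptedChart.apply_eq_localMap (hκ : IsAdaptedChart i μ y₁ κ) {u : E k}
    (hu : ((0 : E m), u) ∈ κ.source) : κ (0, u) = localMap n k i y₁ u := by
  rw [localMap, ← hκ.apply_zero u hu, (chartAt (E n) (i y₁)).right_inv (hκ.mem_target hu)]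

/-- The frame of an adapted chart extends the coordinate frame of the submanifold. -/
theorem IsAdaptedChart.frameMap_tangent (hκ : IsAdaptedChart i μ y₁ κ)
    (hi : ContMDiff (𝓡 k) (𝓡 n) ∞ i) {u : E k} (hu : ((0 : E m), u) ∈ κ.source) (v : E k) :
    frameMap i y₁ κ (0, u) (0, v) =
      dmap n k i ((chartAt (E k) y₁).symm u) (jac (d := k) y₁ u v) := by
  have h1 := dmap_comp_jac hi (hκ.mem_localDomain hu)
  have h2 : fderiv ℝ (localMap n k i y₁) u =
      (fderiv ℝ κ (0, u)).comp (ContinuousLinearMap.inr ℝ (E m) (E k)) := by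
    have h3 : localMap n k i y₁ =ᶠ[𝓝 u] fun u' => κ (0, u') := by
      have : ∀ᶠ u' in 𝓝 u, ((0 : E m), u') ∈ κ.source :=
        (Continuous.prodMk_right (0 : E m)).continuousAt.eventually
          (κ.open_source.mem_nhds hu)
      filter_upwards [this] with u' hu' using (hκ.apply_eq_localMap hu').symm
    rw [h3.fderiv_eq]
    exact (((hκ.contDiffAt hu).differentiableAt (by simp)).hasFDerivAt.comp u
      (hasFDerivAt_prodMk_right (0 : E m) u)).fderiv
  rw [h2, ← hκ.apply_eq_localMap hu] at h1
  exact (congrArg (fun L : E k →L[ℝ] E n => L v) h1).symm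

/-- In adapted coordinates the Hessian is twice the standard form in the normal directions. -/
theorem IsAdaptedChart.hessian_frameMap (hκ : IsAdaptedChart i μ y₁ κ)
    (hμ : IsMorseBott (n := n) i μ m) {u : E k} (hu : ((0 : E m), u) ∈ κ.source)
    (v w : E m × E k) :
    hessian (d := n) μ (i ((chartAt (E k) y₁).symm u)) (frameMap i y₁ κ (0, u) v)
      (frameMap i y₁ κ (0, u) w) = 2 * ⟪v.1, w.1⟫ := by
  set x := i ((chartAt (E k) y₁).symm u) with hx
  have hκd := (hκ.contDiffAt hu).differentiableAt (by simp)
  have hxe : (chartAt (E n) (i y₁)).symm (κ (0, u)) = x := hκ.apply_zero u hu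
  have hJ := fderiv_chart_symm_comp hκd (hκ.mem_target hu)
  rw [hxe] at hJ
  set σ : E m × E k → E n := fun z => chartAt (E n) x ((chartAt (E n) (i y₁)).symm (κ z)) with hσ
  have hσ0 : σ (0, u) = chartAt (E n) x x := by simp only [σ, hxe]
  have hxs : (chartAt (E n) (i y₁)).symm (κ (0, u)) ∈ (chartAt (E n) x).source := by
    rw [hxe]; exact mem_chart_source _ _
  have hσs : ContDiffAt ℝ ∞ σ (0, u) :=
    (contDiffAt_trans (hκ.mem_target hu) hxs).comp (0, u) (hκ.contDiffAt hu)
  set F := μ ∘ (chartAt (E n) x).symm with hF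
  have hFs : ContDiffAt ℝ ∞ F (σ (0, u)) := by
    rw [hσ0]
    exact (contDiffOn_comp_chart_symm hμ.smooth x).contDiffAt
      ((chartAt (E n) x).open_target.mem_nhds (mem_chart_target _ _))
  have hF0 : F (σ (0, u)) = 0 := by
    rw [hσ0]
    simp only [F, Function.comp_apply, (chartAt (E n) x).left_inv (mem_chart_source _ _)]
    exact (hμ.zero_iff _).2 (mem_range_self _)
  have hd0 : fderiv ℝ F (σ (0, u)) = 0 :=
    IsLocalMin.fderiv_eq_zero (Eventually.of_forall fun z => by rw [hF0]; exact hμ.nonneg _)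
  have h1 := second_deriv_comp hFs hσs hd0 v w
  have h2 : F ∘ σ =ᶠ[𝓝 (0, u)] fun z => ⟪z.1, z.1⟫ := by
    have h3 : ∀ᶠ z in 𝓝 ((0 : E m), u),
        (chartAt (E n) (i y₁)).symm (κ z) ∈ (chartAt (E n) x).source := by
      have : ContinuousAt (fun z => (chartAt (E n) (i y₁)).symm (κ z)) ((0 : E m), u) :=
        ContinuousAt.comp (f := κ)
          ((chartAt (E n) (i y₁)).continuousAt_symm (hκ.mem_target hu)) (κ.continuousAt hu)
      exact this.eventually ((chartAt (E n) x).open_source.mem_nhds hxs)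
    filter_upwards [h3, κ.open_source.mem_nhds hu] with z hz hz'
    simp only [F, σ, Function.comp_apply]
    rw [(chartAt (E n) x).left_inv hz, hκ.norm_sq z hz', real_inner_self_eq_norm_sq]
  have h4 : fderiv ℝ (fun z : E m × E k => ⟪z.1, z.1⟫) =
      fun z => (2 : ℝ) • ((innerSL ℝ z.1).comp (ContinuousLinearMap.fst ℝ (E m) (E k))) := by
    ext1 z
    have : HasFDerivAt (fun z : E m × E k => ⟪z.1, z.1⟫) _ z :=
      (hasFDerivAt_fst (𝕜 := ℝ) (E := E m) (F := E k) (p := z)).inner ℝ hasFDerivAt_fst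
    rw [this.fderiv]
    ext w <;> simp [real_inner_comm, two_mul]
  have h5 : fderiv ℝ (fderiv ℝ (F ∘ σ)) (0, u) v w = 2 * ⟪v.1, w.1⟫ := by
    rw [h2.fderiv.fderiv_eq, h4]
    set L : (E m × E k) →L[ℝ] (E m × E k) →L[ℝ] ℝ :=
      (2 : ℝ) • (((ContinuousLinearMap.compL ℝ (E m × E k) (E m) ℝ).flip
        (ContinuousLinearMap.fst ℝ (E m) (E k))).comp
          ((innerSL ℝ).comp (ContinuousLinearMap.fst ℝ (E m) (E k)))) with hL
    have : HasFDerivAt (fun z : E m × E k =>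
        (2 : ℝ) • ((innerSL ℝ z.1).comp (ContinuousLinearMap.fst ℝ (E m) (E k)))) L (0, u) :=
      L.hasFDerivAt
    rw [this.fderiv]
    rfl
  rw [h5, hJ, hσ0] at h1
  exact h1.symm

end Pointwise

section NormalVolume

variable {m k : ℕ} {X Y : Type*} [TopologicalSpace X] [ChartedSpace (E (m + k)) X]
  [TopologicalSpace Y] [ChartedSpace (E k) Y]

/-- The Jacobian determinant of a map from `ℝ^m × ℝ^k` to `ℝ^(m+k)`. -/
def coordDet (κ : E m × E k → E (m + k)) (z : E m × E k) : ℝ :=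
  LinearMap.det ((fderiv ℝ κ z).comp ((joinEquiv m k).symm : E (m + k) →L[ℝ] E m × E k) :
    E (m + k) →ₗ[ℝ] E (m + k))

/-- The sign of the Jacobian determinant of a parametrization. -/
def coordSign (κ : E m × E k → E (m + k)) (z : E m × E k) : ℝ := SignType.sign (coordDet κ z)

/-- The normal volume form, as an alternating form on the model space. -/
def normalVolumeAt (m k : ℕ) {X Y : Type*} [TopologicalSpace X] [ChartedSpace (E (m + k)) X]
    [TopologicalSpace Y] [ChartedSpace (E k) Y] (i : Y → X) (μ : X → ℝ) (y : Y) :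
    E (m + k) [⋀^Fin m]→ₗ[ℝ] ℂ :=
  normalVolume (n := m + k) rfl i μ y

variable [IsManifold (𝓡 (m + k)) ∞ X] [IsManifold (𝓡 k) ∞ Y]
variable {i : Y → X} {μ : X → ℝ} {y₁ : Y} {κ : OpenPartialHomeomorph (E m × E k) (E (m + k))}

theorem IsAdaptedChart.coordDet_ne_zero (hκ : IsAdaptedChart i μ y₁ κ) {z : E m × E k}
    (hz : z ∈ κ.source) : coordDet κ z ≠ 0 := by
  obtain ⟨L, hL⟩ := hκ.exists_hasFDerivAt z hz
  rw [coordDet, hL.fderiv]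
  exact (LinearEquiv.isUnit_det' ((joinEquiv m k).symm.trans L).toLinearEquiv).ne_zero

theorem coordSign_mul_self {κ : E m × E k → E (m + k)} {z : E m × E k} (h : coordDet κ z ≠ 0) :
    coordSign κ z * coordSign κ z = 1 := by
  rcases lt_or_gt_of_ne h with h | h <;> simp [coordSign, h]

theorem coordSign_mul_coordDet (κ : E m × E k → E (m + k)) (z : E m × E k) :
    coordSign κ z * coordDet κ z = |coordDet κ z| := sign_mul_self _

theorem chartSign_mul_self {u : E k} (hu : u ∈ (chartAt (E k) y₁).target) :
    chartSign y₁ u * chartSign y₁ u = 1 := by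
  rcases lt_or_gt_of_ne (det_jac_ne_zero hu) with h | h <;> simp [chartSign_eq, h]

/-- Frames of a complement of the tangent space in terms of adapted coordinates. -/
theorem IsAdaptedChart.isNormalFrame_iff (hX : IsOrientedAtlas (m + k) X)
    (hκ : IsAdaptedChart i μ y₁ κ) (hi : ContMDiff (𝓡 k) (𝓡 (m + k)) ∞ i)
    (hμ : IsMorseBott (n := m + k) i μ m) {u : E k} (hu : ((0 : E m), u) ∈ κ.source)
    (ξ : Fin m → E m × E k) :
    IsNormalFrame (n := m + k) rfl i μ ((chartAt (E k) y₁).symm u)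
        (fun b => frameMap i y₁ κ (0, u) (ξ b)) ↔
      (∀ a b, ⟪(ξ a).1, (ξ b).1⟫ = if a = b then (1 : ℝ) else 0) ∧
        0 < coordSign κ (0, u) * chartSign y₁ u * (Matrix.of fun a b => (ξ a).1 b).det := by
  set y := (chartAt (E k) y₁).symm u with hy
  set A := frameMap i y₁ κ (0, u) with hA
  set J : E k →ₗ[ℝ] E k := (jac (d := k) y₁ u : E k →ₗ[ℝ] E k) with hJ
  have hJ0 : LinearMap.det J ≠ 0 := det_jac_ne_zero (hκ.zero_mem u hu)
  set JE := LinearMap.equivOfDetNeZero J hJ0 with hJE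
  have hJJ : ∀ v, J (JE.symm v) = v := fun v => JE.apply_symm_apply v
  have hdetK : LinearMap.det J * LinearMap.det (JE.symm : E k →ₗ[ℝ] E k) = 1 := by
    rw [← LinearMap.det_comp]
    have : J ∘ₗ (JE.symm : E k →ₗ[ℝ] E k) = LinearMap.id := LinearMap.ext hJJ
    rw [this, LinearMap.det_id]
  set A' : E (m + k) →ₗ[ℝ] E (m + k) :=
    (A.comp ((joinEquiv m k).symm : E (m + k) →L[ℝ] E m × E k) : E (m + k) →ₗ[ℝ] E (m + k)) with hA'
  have hA'j : ∀ z, A' (joinEquiv m k z) = A z := fun z => by simp [A']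
  have hdetA : LinearMap.det A' =
      LinearMap.det (jac (d := m + k) (i y₁) (κ (0, u)) : E (m + k) →ₗ[ℝ] E (m + k)) *
        coordDet κ (0, u) := by
    rw [coordDet, ← LinearMap.det_comp]
    rfl
  have hjp := det_jac_pos hX (hκ.mem_target hu)
  have hframe : (Fin.append (fun b => A (ξ b))
      fun a => dmap (m + k) k i y (stdVec k a)) =
      A' ∘ Fin.append (fun b => joinEquiv m k (ξ b))
        fun a => joinEquiv m k (0, JE.symm (stdVec k a)) := by
    funext j
    refine Fin.addCases (fun b => ?_) (fun a => ?_) j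
    · simp [hA'j]
    · simp only [Fin.append_right, Function.comp_apply, hA'j]
      rw [hA, hκ.frameMap_tangent hi hu]
      exact congrArg _ (hJJ _).symm
  have hstd : (EuclideanSpace.basisFun (Fin k) ℝ).toBasis.det
      (fun a => JE.symm (stdVec k a)) = LinearMap.det (JE.symm : E k →ₗ[ℝ] E k) := by
    have h1 := Module.Basis.det_comp (EuclideanSpace.basisFun (Fin k) ℝ).toBasis
      (JE.symm : E k →ₗ[ℝ] E k) (EuclideanSpace.basisFun (Fin k) ℝ).toBasis
    rw [Module.Basis.det_self, mul_one] at h1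
    rw [← h1]
    congr 1
    funext a
    simp [stdVec]
  have hdet : (EuclideanSpace.basisFun (Fin (m + k)) ℝ).toBasis.det
      ((show Fin (m + k) → E (m + k) from Fin.append (fun b => A (ξ b))
        fun a => dmap (m + k) k i y (stdVec k a)) ∘ finCongr rfl) =
      LinearMap.det A' * ((Matrix.of fun a b => (ξ a).1 b).det *
        LinearMap.det (JE.symm : E k →ₗ[ℝ] E k)) := by
    rw [hframe, ← hstd, ← det_append_joinEquiv, ← Module.Basis.det_comp]
    rfl
  have hpos : 0 < (EuclideanSpace.basisFun (Fin (m + k)) ℝ).toBasis.det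
      ((show Fin (m + k) → E (m + k) from Fin.append (fun b => A (ξ b))
        fun a => dmap (m + k) k i y (stdVec k a)) ∘ finCongr rfl) ↔
      0 < coordSign κ (0, u) * chartSign y₁ u * (Matrix.of fun a b => (ξ a).1 b).det := by
    rw [hdet, hdetA]
    set Dx := (Matrix.of fun a b => (ξ a).1 b).det
    have hc := hκ.coordDet_ne_zero hu
    have h1 := coordSign_mul_self hc
    have h2 := coordSign_mul_coordDet κ (0, u)
    have h3 := chartSign_mul_self (y₁ := y₁) (hκ.zero_mem u hu)
    have h4 : chartSign y₁ u * LinearMap.det J = |LinearMap.det J| := sign_mul_self _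
    have h5 := abs_pos.2 hc
    have h6 := abs_pos.2 hJ0
    -- both sides differ by a positive factor
    have h7 : LinearMap.det (jac (d := m + k) (i y₁) (κ (0, u)) : E (m + k) →ₗ[ℝ] E (m + k)) *
        coordDet κ (0, u) * (Dx * LinearMap.det (JE.symm : E k →ₗ[ℝ] E k)) =
        (LinearMap.det (jac (d := m + k) (i y₁) (κ (0, u)) : E (m + k) →ₗ[ℝ] E (m + k)) *
          |coordDet κ (0, u)| * |LinearMap.det J|⁻¹) *
          (coordSign κ (0, u) * chartSign y₁ u * Dx) := by
      have e1 : coordDet κ (0, u) = coordSign κ (0, u) * |coordDet κ (0, u)| := by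
        rw [← h2, ← mul_assoc, h1, one_mul]
      have e2 : LinearMap.det J = chartSign y₁ u * |LinearMap.det J| := by
        rw [← h4, ← mul_assoc, h3, one_mul]
      have e3 : LinearMap.det (JE.symm : E k →ₗ[ℝ] E k) =
          |LinearMap.det J|⁻¹ * chartSign y₁ u := by
        field_simp
        calc LinearMap.det (JE.symm : E k →ₗ[ℝ] E k) * |LinearMap.det J|
            = chartSign y₁ u * (LinearMap.det J *
                LinearMap.det (JE.symm : E k →ₗ[ℝ] E k)) := by rw [← h4]; ring
          _ = chartSign y₁ u := by rw [hdetK, mul_one]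
      rw [e3]
      conv_lhs => rw [e1]
      ring
    rw [h7]
    exact mul_pos_iff_of_pos_left (by positivity)
  constructor
  · intro h
    refine ⟨fun a b => ?_, hpos.1 h.oriented⟩
    have h1 := h.orthonormal a b
    rw [hκ.hessian_frameMap hμ hu] at h1
    linarith
  · rintro ⟨h1, h2⟩
    refine ⟨fun a b => ?_, hpos.2 h2⟩
    rw [hκ.hessian_frameMap hμ hu, ← h1 a b]
    ring

/-- Positively oriented orthonormal normal frames exist. For `m = 0` this could fail, since there is
no vector to be reversed. -/
theorem exists_isNormalFrame (hX : IsOrientedAtlas (m + k) X) (hm : 1 ≤ m)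
    (hκ : IsAdaptedChart i μ y₁ κ) (hi : ContMDiff (𝓡 k) (𝓡 (m + k)) ∞ i)
    (hμ : IsMorseBott (n := m + k) i μ m) {u : E k} (hu : ((0 : E m), u) ∈ κ.source) :
    ∃ e, IsNormalFrame (n := m + k) rfl i μ ((chartAt (E k) y₁).symm u) e := by
  set s := coordSign κ (0, u) * chartSign y₁ u with hs
  have hss : s * s = 1 := by
    rw [hs, mul_mul_mul_comm, coordSign_mul_self (hκ.coordDet_ne_zero hu),
      chartSign_mul_self (hκ.zero_mem u hu), one_mul]
  -- one vector of the standard frame is reversed if the orientations disagree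
  set c : Fin m → ℝ := fun b => if b = ⟨0, hm⟩ then s else 1 with hc
  have hcc : ∀ b, c b * c b = 1 := fun b => by
    simp only [c]; split_ifs <;> simp [hss]
  refine ⟨_, (hκ.isNormalFrame_iff hX hi hμ hu fun b => (c b • stdVec m b, 0)).2 ⟨?_, ?_⟩⟩
  · intro a b
    simp only [inner_smul_left, inner_smul_right, stdVec, EuclideanSpace.inner_single_left]
    by_cases h : a = b
    · subst h; simp [hcc]
    · simp [h]
  · have : (Matrix.of fun a b : Fin m => (c a • stdVec m a) b) = Matrix.diagonal c := by
      ext a b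
      by_cases h : a = b
      · subst h; simp [stdVec]
      · simp [stdVec, Matrix.diagonal_apply_ne _ h, Ne.symm h]
    rw [this, Matrix.det_diagonal]
    have hprod : ∏ b, c b = s := by
      rw [Finset.prod_eq_single (⟨0, hm⟩ : Fin m) (fun b _ hb => by simp [c, hb]) (by simp)]
      simp [c]
    rw [hprod, ← hs, hss]
    exact one_pos

/-- The normal volume form in adapted coordinates is `dx₁ ∧ ⋯ ∧ dx_m`, up to the sign that compares
the orientations: an orthonormal frame has an orthogonal matrix of normal components, and the
orientation determines its determinant. -/
theorem IsAdaptedChart.normalVolume_frameMap (hX : IsOrientedAtlas (m + k) X) (hm : 1 ≤ m)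
    (hκ : IsAdaptedChart i μ y₁ κ) (hi : ContMDiff (𝓡 k) (𝓡 (m + k)) ∞ i)
    (hμ : IsMorseBott (n := m + k) i μ m) {u : E k} (hu : ((0 : E m), u) ∈ κ.source) :
    (normalVolumeAt m k i μ ((chartAt (E k) y₁).symm u)).compLinearMap
      (frameMap i y₁ κ (0, u)).toLinearMap =
      (coordSign κ (0, u) * chartSign y₁ u) • normalVol m k := by
  have hex := exists_isNormalFrame hX hm hκ hi hμ hu
  set e := hex.choose with he
  have hee := hex.choose_spec
  rw [← he] at hee
  obtain ⟨ξ, hξ⟩ : ∃ ξ : Fin m → E m × E k, e = fun b => frameMap i y₁ κ (0, u) (ξ b) := by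
    choose ξ hξ using fun b => (hκ.frameMap_bijective hu).2 (e b)
    exact ⟨ξ, funext fun b => (hξ b).symm⟩
  rw [hξ] at hee
  obtain ⟨h1, h2⟩ := (hκ.isNormalFrame_iff hX hi hμ hu ξ).1 hee
  set s := coordSign κ (0, u) * chartSign y₁ u with hs
  have hss : s * s = 1 := by
    rw [hs, mul_mul_mul_comm, coordSign_mul_self (hκ.coordDet_ne_zero hu),
      chartSign_mul_self (hκ.zero_mem u hu), one_mul]
  set G : Matrix (Fin m) (Fin m) ℝ := Matrix.of fun a b => (ξ a).1 b with hG
  have hGG : G * G.transpose = 1 := by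
    ext a b
    rw [Matrix.mul_apply, Matrix.one_apply, ← h1 a b, PiLp.inner_apply]
    exact Finset.sum_congr rfl fun c _ => by simp [G, mul_comm]
  -- an orthogonal matrix has determinant `±1`, and `0 < s * det G`
  have hdet : G.det = s := by
    have h3 : G.det * G.det = 1 := by
      have := congrArg Matrix.det hGG
      rwa [Matrix.det_mul, Matrix.det_transpose, Matrix.det_one] at this
    rcases mul_self_eq_one_iff.1 h3 with h | h <;> rcases mul_self_eq_one_iff.1 hss with h' | h' <;>
      rw [h, h'] at h2 ⊢ <;> norm_num at h2
  ext v
  have hval : normalVolumeAt m k i μ ((chartAt (E k) y₁).symm u) =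
      coframeVolume i μ ((chartAt (E k) y₁).symm u) e := dif_pos hex
  rw [hval, hξ]
  have hco : ((coframeVolume i μ ((chartAt (E k) y₁).symm u)
      (fun b => frameMap i y₁ κ (0, u) (ξ b))).compLinearMap
      (frameMap i y₁ κ (0, u)).toLinearMap) v =
      ((Matrix.of fun a b => (1 / 2 : ℝ) * hessian (d := m + k) μ
        (i ((chartAt (E k) y₁).symm u)) (frameMap i y₁ κ (0, u) (v a))
          (frameMap i y₁ κ (0, u) (ξ b))).det : ℂ) := rfl
  refine hco.trans ?_
  have hmat : (Matrix.of fun a b => (1 / 2 : ℝ) * hessian (d := m + k) μ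
        (i ((chartAt (E k) y₁).symm u)) (frameMap i y₁ κ (0, u) (v a))
          (frameMap i y₁ κ (0, u) (ξ b))) =
      (Matrix.of fun a b => (v a).1 b) * G.transpose := by
    ext a b
    rw [Matrix.of_apply, hκ.hessian_frameMap hμ hu, Matrix.mul_apply, PiLp.inner_apply,
      ← mul_assoc]
    norm_num
    exact Finset.sum_congr rfl fun c _ => by simp [G, mul_comm]
  rw [hmat, Matrix.det_mul, Matrix.det_transpose, hdet, AlternatingMap.smul_apply,
    normalVol_apply, Complex.real_smul]
  push_cast
  ring

end NormalVolume

/-! ### Tame forms along the submanifold -/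

theorem append_update {T : Type*} {m q : ℕ} [DecidableEq (Fin q)] (e : Fin m → T) (t : Fin q → T)
    (j : Fin q) (x : T) :
    Fin.append e (Function.update t j x) = Function.update (Fin.append e t) (Fin.natAdd m j) x := by
  funext a
  refine Fin.addCases (fun b => ?_) (fun b => ?_) a
  · rw [Fin.append_left, Function.update_of_ne, Fin.append_left]
    simp [Fin.ext_iff]
    omega
  · by_cases h : b = j
    · subst h; simp
    · rw [Fin.append_right, Function.update_of_ne h, Function.update_of_ne, Fin.append_right]
      simpa using h

/-- The form obtained by inserting the vectors `e` in the first arguments. -/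
def insertFirst {T : Type*} [AddCommGroup T] [Module ℝ T] {m q : ℕ}
    (ψ : T [⋀^Fin (m + q)]→ₗ[ℝ] ℂ) (e : Fin m → T) : T [⋀^Fin q]→ₗ[ℝ] ℂ where
  toFun t := ψ (Fin.append e t)
  map_update_add' t j x y := by
    rw [append_update, append_update, append_update, AlternatingMap.map_update_add]
  map_update_smul' t j c x := by
    rw [append_update, append_update, AlternatingMap.map_update_smul]
  map_eq_zero_of_eq' t a b h hab := by
    refine ψ.map_eq_zero_of_eq (Fin.append e t) (i := Fin.natAdd m a) (j := Fin.natAdd m b)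
      (by simpa using h) fun h' => hab ?_
    simpa using h'

/-- Limits of wedge products with a fixed form. -/
theorem tendsto_wedge_apply {T ι : Type*} [AddCommGroup T] [Module ℝ T] {p q : ℕ} {l : Filter ι}
    (a : T [⋀^Fin p]→ₗ[ℝ] ℂ) {b : ι → T [⋀^Fin q]→ₗ[ℝ] ℂ} {b₀ : T [⋀^Fin q]→ₗ[ℝ] ℂ}
    (hb : ∀ v, Tendsto (fun t => b t v) l (𝓝 (b₀ v))) (v : Fin (p + q) → T) :
    Tendsto (fun t => wedge a (b t) v) l (𝓝 (wedge a b₀ v)) := by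
  simp only [wedge_apply, sumWedge_apply]
  refine Tendsto.const_mul _ (tendsto_finsetSum _ fun σ _ => ?_)
  exact Tendsto.const_mul _ (Tendsto.const_mul _ (hb _))

section Tame

variable {n m k p : ℕ} {X Y : Type*} [TopologicalSpace X] [ChartedSpace (E n) X]
  [TopologicalSpace Y] [ChartedSpace (E k) Y]
variable [IsManifold (𝓡 n) ∞ X] [IsManifold (𝓡 k) ∞ Y]
variable {i : Y → X} {μ : X → ℝ} {y₁ : Y} {κ : OpenPartialHomeomorph (E m × E k) (E n)}

/-- In adapted coordinates `dμ` is the differential of `‖x‖²`. -/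
theorem IsAdaptedChart.dFun_frameMap (hκ : IsAdaptedChart i μ y₁ κ)
    (hμ : IsMorseBott (n := n) i μ m) {z : E m × E k} (hz : z ∈ κ.source)
    (v : Fin 1 → E m × E k) :
    inCoords i y₁ κ (dFun μ) z v = ((2 * ⟪z.1, (v 0).1⟫ : ℝ) : ℂ) := by
  set c := chartAt (E n) (i y₁) with hc
  have hct := hκ.mem_target hz
  have h1 : inCoords i y₁ κ (dFun μ) z v =
      ((show ℝ from (show E n →L[ℝ] ℝ from mfderiv (𝓡 n) 𝓘(ℝ, ℝ) μ (c.symm (κ z)))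
        (jac (d := n) (i y₁) (κ z) (fderiv ℝ κ z (v 0))) : ℝ) : ℂ) := rfl
  rw [h1]
  congr 1
  have hF := ((contDiffOn_comp_chart_symm hμ.smooth (i y₁)).contDiffAt
    (c.open_target.mem_nhds hct)).differentiableAt (by simp)
  have hκd := (hκ.contDiffAt hz).differentiableAt (by simp)
  have hm := mfderiv_comp (I := 𝓘(ℝ, E n)) (I' := 𝓡 n) (I'' := 𝓘(ℝ, ℝ)) (κ z) (g := μ)
    (f := c.symm) ((hμ.smooth _).mdifferentiableAt (by simp))
    ((contMDiffOn_chart_symm (I := 𝓡 n) (n := ∞) (x := i y₁)).contMDiffAt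
      (c.open_target.mem_nhds hct) |>.mdifferentiableAt (by simp))
  rw [mfderiv_eq_fderiv] at hm
  have h2 : (show E n →L[ℝ] ℝ from mfderiv (𝓡 n) 𝓘(ℝ, ℝ) μ (c.symm (κ z)))
        (jac (d := n) (i y₁) (κ z) (fderiv ℝ κ z (v 0))) =
      fderiv ℝ (μ ∘ c.symm) (κ z) (fderiv ℝ κ z (v 0)) :=
    (congrArg (fun L : E n →L[ℝ] ℝ => L (fderiv ℝ κ z (v 0))) hm).symm
  rw [h2]
  have h3 : (μ ∘ c.symm) ∘ κ =ᶠ[𝓝 z] fun z => ⟪z.1, z.1⟫ := by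
    filter_upwards [κ.open_source.mem_nhds hz] with z' hz'
    rw [real_inner_self_eq_norm_sq]
    exact hκ.norm_sq z' hz'
  have h4 := (fderiv_comp z hF hκd).symm.trans h3.fderiv_eq
  have h5 := congrArg (fun L : E m × E k →L[ℝ] ℝ => L (v 0)) h4
  have : HasFDerivAt (fun z : E m × E k => ⟪z.1, z.1⟫) _ z :=
    (hasFDerivAt_fst (𝕜 := ℝ) (E := E m) (F := E k) (p := z)).inner ℝ hasFDerivAt_fst
  refine h5.trans ((congrArg (fun L : E m × E k →L[ℝ] ℝ => L (v 0)) this.fderiv).trans ?_)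
  simp [real_inner_comm, two_mul]

/-- Away from the submanifold, `μ χ = dμ ∧ ψ` for the smooth extensions `ψ` of `μ^r w` and `χ` of
`μ^(r-1) dμ ∧ w`. -/
theorem smul_extension_eq {r : ℕ} (hr : 1 ≤ r) {w ψ : DForm n X p} {χ : DForm n X (1 + p)}
    (hψ : IsSmoothExtension i ψ fun x => μ x ^ r • w x)
    (hχ : IsSmoothExtension i χ fun x => μ x ^ (r - 1) • wedge (dFun μ x) (w x))
    {x : X} (hx : x ∉ range i) : μ x • χ x = wedge (dFun μ x) (ψ x) := by
  have h1 : ψ x = μ x ^ r • w x := hψ.2 x hx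
  have h2 : χ x = μ x ^ (r - 1) • wedge (dFun μ x) (w x) := hχ.2 x hx
  have h3 : wedge (dFun μ x) (μ x ^ r • w x) = μ x ^ r • wedge (dFun μ x) (w x) :=
    wedgeCast_smul_right rfl _ _ _
  rw [h1, h2, h3, smul_smul, ← pow_succ', Nat.sub_add_cancel hr]

/-- On the submanifold, a tame form (multiplied by `μ^r`) is annihilated by the normal
covectors: divide `μ χ = dμ ∧ ψ` by `t` along `x = t e_b` and let `t → 0`. -/
theorem IsAdaptedChart.wedge_normalCovector_eq_zero (hκ : IsAdaptedChart i μ y₁ κ)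
    (hμ : IsMorseBott (n := n) i μ m) {r : ℕ} (hr : 1 ≤ r) {w ψ : DForm n X p}
    {χ : DForm n X (1 + p)}
    (hψ : IsSmoothExtension i ψ fun x => μ x ^ r • w x)
    (hχ : IsSmoothExtension i χ fun x => μ x ^ (r - 1) • wedge (dFun μ x) (w x))
    {u : E k} (hu : ((0 : E m), u) ∈ κ.source) (b : Fin m) :
    wedge (normalCovector m k b) (inCoords i y₁ κ ψ (0, u)) = 0 := by
  set γ : ℝ → E m × E k := fun t => (t • stdVec m b, u) with hγ
  have hγc : Continuous γ := by fun_prop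
  have hγ0 : γ 0 = (0, u) := by simp [γ]
  have hγt : Tendsto γ (𝓝[≠] 0) (𝓝 (0, u)) := by
    rw [← hγ0]; exact hγc.continuousAt.tendsto.mono_left nhdsWithin_le_nhds
  have hlim : ∀ {q : ℕ} {φ : DForm n X q}, IsSmoothForm φ → ∀ v,
      Tendsto (fun t => inCoords i y₁ κ φ (γ t) v) (𝓝[≠] 0) (𝓝 (inCoords i y₁ κ φ (0, u) v)) :=
    fun hφ v => (((hκ.contDiffOn_inCoords hφ v).continuousOn.continuousAt
      (κ.open_source.mem_nhds hu)).tendsto).comp hγt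
  have hev : ∀ᶠ t in 𝓝[≠] (0 : ℝ), t • inCoords i y₁ κ χ (γ t) =
      (2 : ℝ) • wedge (normalCovector m k b) (inCoords i y₁ κ ψ (γ t)) := by
    filter_upwards [hγt.eventually (κ.open_source.mem_nhds hu), self_mem_nhdsWithin] with t ht ht0
    set x := (chartAt (E n) (i y₁)).symm (κ (γ t)) with hx
    have hμx : μ x = t ^ 2 := by
      rw [hx, hκ.norm_sq _ ht]
      simp [γ, norm_smul, stdVec]
    have hxY : x ∉ range i := fun h => by
      rw [← hμ.zero_iff, hμx] at h
      exact ht0 (pow_eq_zero_iff two_ne_zero |>.1 h)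
    have h1 := smul_extension_eq hr hψ hχ hxY
    have h1' : μ x • formAt χ x = wedge (formAt (dFun μ) x) (formAt ψ x) := h1
    have h2 : μ x • inCoords i y₁ κ χ (γ t) =
        wedge (inCoords i y₁ κ (dFun μ) (γ t)) (inCoords i y₁ κ ψ (γ t)) := by
      rw [inCoords, inCoords, inCoords, ← compLinearMap_wedge, ← hx, ← h1']
      rfl
    have h3 : inCoords i y₁ κ (dFun μ) (γ t) = (2 * t) • normalCovector m k b := by
      ext v
      rw [hκ.dFun_frameMap hμ ht]
      simp [γ, normalCovector_apply, stdVec, inner_smul_left, EuclideanSpace.inner_single_left]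
      ring
    rw [h3, ← wedgeCast_rfl, wedgeCast_smul_left, wedgeCast_rfl, hμx] at h2
    have h4 : t • (t • inCoords i y₁ κ χ (γ t)) =
        t • ((2 : ℝ) • wedge (normalCovector m k b) (inCoords i y₁ κ ψ (γ t))) := by
      rw [smul_smul, smul_smul, ← sq, h2, mul_comm]
    exact smul_right_injective _ ht0 h4
  ext v
  have h1 : Tendsto (fun t : ℝ => (t • inCoords i y₁ κ χ (γ t)) v) (𝓝[≠] 0) (𝓝 0) := by
    have := (tendsto_id.mono_left nhdsWithin_le_nhds : Tendsto (fun t : ℝ => t) (𝓝[≠] 0) (𝓝 0)).smul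
      (hlim hχ.1 v)
    simpa using this
  have h2 := (tendsto_wedge_apply (normalCovector m k b) (hlim hψ.1) v).const_smul (2 : ℝ)
  have h3 := tendsto_nhds_unique (h1.congr' (hev.mono fun t ht => by
    rw [ht, AlternatingMap.smul_apply])) h2
  have h4 := (smul_eq_zero.1 h3.symm).resolve_left two_ne_zero
  rw [h4]; rfl

end Tame

section Restriction

variable {m k p q : ℕ} {X Y : Type*} [TopologicalSpace X] [ChartedSpace (E (m + k)) X]
  [TopologicalSpace Y] [ChartedSpace (E k) Y]
variable [IsManifold (𝓡 (m + k)) ∞ X] [IsManifold (𝓡 k) ∞ Y]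
variable {i : Y → X} {μ : X → ℝ} {y₁ : Y} {κ : OpenPartialHomeomorph (E m × E k) (E (m + k))}

/-- The standard normal frame in `ℝ^m × ℝ^k`, followed by vectors of the second factor. -/
def normalAppend (m : ℕ) {k q : ℕ} (v : Fin q → E k) : Fin (m + q) → E m × E k :=
  Fin.append (fun a => (stdVec m a, 0)) fun j => (0, v j)

/-- If `ψ|_Y = V(μ) ∧ α`, then `ψ = ± dx₁ ∧ ⋯ ∧ dx_m ∧ β` in adapted coordinates, where `β`
restricts to `α`. -/
theorem IsAdaptedChart.exists_inCoords_eq_wedge (hX : IsOrientedAtlas (m + k) X) (hm : 1 ≤ m)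
    (hκ : IsAdaptedChart i μ y₁ κ) (hi : ContMDiff (𝓡 k) (𝓡 (m + k)) ∞ i)
    (hμ : IsMorseBott (n := m + k) i μ m) {ψ : DForm (m + k) X (m + q)} {α : DForm k Y q}
    (hα : RestrictsTo rfl rfl i μ ψ α) {u : E k} (hu : ((0 : E m), u) ∈ κ.source) :
    ∃ β : (E m × E k) [⋀^Fin q]→ₗ[ℝ] ℂ,
      inCoords i y₁ κ ψ (0, u) = wedge (normalVol m k) β ∧
      ∀ v : Fin q → E k, β (fun j => (0, v j)) =
        coordSign κ (0, u) • twistedInChart α y₁ u v := by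
  obtain ⟨β, hβα, hβψ⟩ := hα ((chartAt (E k) y₁).symm u)
  set s := coordSign κ (0, u) * chartSign y₁ u with hs
  set A := frameMap i y₁ κ (0, u) with hA
  have hx := hκ.apply_zero u hu
  have h1 : inCoords i y₁ κ ψ (0, u) =
      (formAt ψ (i ((chartAt (E k) y₁).symm u))).compLinearMap A.toLinearMap := by
    rw [inCoords, hx]
  set β' : (E m × E k) [⋀^Fin q]→ₗ[ℝ] ℂ :=
    (show E (m + k) [⋀^Fin q]→ₗ[ℝ] ℂ from β).compLinearMap A.toLinearMap with hβ'
  refine ⟨s • β', ?_, fun v => ?_⟩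
  · have h2 : formAt ψ (i ((chartAt (E k) y₁).symm u)) =
        wedge (normalVolumeAt m k i μ ((chartAt (E k) y₁).symm u))
          (show E (m + k) [⋀^Fin q]→ₗ[ℝ] ℂ from β) := hβψ
    rw [h1, h2, compLinearMap_wedge, hκ.normalVolume_frameMap hX hm hi hμ hu, ← hβ',
      ← wedgeCast_rfl, ← wedgeCast_rfl, wedgeCast_smul_left, wedgeCast_smul_right]
  · have h3 : β' (fun j => (0, v j)) = inChart α y₁ u v := by
      rw [inChart_apply, ← hβα]
      have : ∀ j, A (0, v j) = dmap (m + k) k i ((chartAt (E k) y₁).symm u)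
          (jac (d := k) y₁ u (v j)) := fun j => hκ.frameMap_tangent hi hu (v j)
      change (show E (m + k) [⋀^Fin q]→ₗ[ℝ] ℂ from β) (fun j => A (0, v j)) = _
      simp only [this]
      rfl
    rw [AlternatingMap.smul_apply, h3, twistedInChart_apply, smul_smul]

/-- The form `α` is the contraction of `ψ` with the normal frame of an adapted chart, up to sign. -/
theorem IsAdaptedChart.twistedInChart_eq (hX : IsOrientedAtlas (m + k) X) (hm : 1 ≤ m)
    (hκ : IsAdaptedChart i μ y₁ κ) (hi : ContMDiff (𝓡 k) (𝓡 (m + k)) ∞ i)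
    (hμ : IsMorseBott (n := m + k) i μ m) {ψ : DForm (m + k) X (m + q)} {α : DForm k Y q}
    (hα : RestrictsTo rfl rfl i μ ψ α) {u : E k} (hu : ((0 : E m), u) ∈ κ.source)
    (v : Fin q → E k) :
    twistedInChart α y₁ u v =
      coordSign κ (0, u) • inCoords i y₁ κ ψ (0, u) (normalAppend m v) := by
  obtain ⟨β, h1, h2⟩ := hκ.exists_inCoords_eq_wedge hX hm hi hμ hα hu
  rw [h1, normalAppend, wedge_normalVol_append, h2, smul_smul,
    coordSign_mul_self (hκ.coordDet_ne_zero hu), one_smul]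

/-- A twisted form is determined at a point by its expression at the centre of the chart there. -/
theorem eq_of_twistedInChart_eq {τ τ' : DForm k Y q} {y : Y}
    (h : ∀ v, twistedInChart τ y (chartAt (E k) y y) v =
      twistedInChart τ' y (chartAt (E k) y y) v) : τ y = τ' y := by
  set u := chartAt (E k) y y with hu
  have hut : u ∈ (chartAt (E k) y).target := mem_chart_target _ _
  have hy : (chartAt (E k) y).symm u = y := (chartAt (E k) y).left_inv (mem_chart_source _ _)
  have hJ : Function.Surjective (jac (d := k) y u).toLinearMap :=
    (LinearMap.equivOfDetNeZero _ (det_jac_ne_zero hut)).surjective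
  have h1 : (formAt τ y).compLinearMap (jac (d := k) y u).toLinearMap =
      (formAt τ' y).compLinearMap (jac (d := k) y u).toLinearMap := by
    ext v
    have h2 := h v
    rw [twistedInChart_apply, twistedInChart_apply] at h2
    have h3 := smul_right_injective ℂ (fun h0 => by
      have := chartSign_mul_self hut
      rw [h0] at this
      simp at this : chartSign y u ≠ 0) h2
    rw [inChart_apply, inChart_apply, hy] at h3
    exact h3
  exact AlternatingMap.compLinearMap_injective _ hJ h1

/-- If `ψ|_Y = V(μ) ∧ α` with `ψ` smooth, then `α` is smooth: near the centre of an adapted chart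
it is a contraction of `ψ`, up to a locally constant sign. -/
theorem RestrictsTo.isSmoothTwistedForm (hX : IsOrientedAtlas (m + k) X) (hm : 1 ≤ m)
    (hi : Manifold.IsImmersion (𝓡 k) (𝓡 (m + k)) ∞ i)
    (hμ : IsMorseBott (n := m + k) i μ m) {ψ : DForm (m + k) X (m + q)} (hψ : IsSmoothForm ψ)
    {α : DForm k Y q} (hα : RestrictsTo rfl rfl i μ ψ α) : IsSmoothTwistedForm α := by
  refine isSmoothTwistedForm_of_center fun y v => ?_
  obtain ⟨κ, hκ⟩ := hμ.exists_adaptedChart rfl hi y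
  set u₁ := chartAt (E k) y y with hu₁
  have hu₁s : ((0 : E m), u₁) ∈ κ.source := hκ.mem_source
  have hc : ContinuousAt (fun u : E k => ((0 : E m), u)) u₁ :=
    (Continuous.prodMk_right (0 : E m)).continuousAt
  have hdet : ContinuousAt (fun u => coordDet κ ((0 : E m), u)) u₁ := by
    have h1 : ContinuousAt (fderiv ℝ κ) ((0 : E m), u₁) :=
      ((hκ.contDiffAt hu₁s).fderiv_right (m := ∞) (by simp)).continuousAt
    have h2 : ContinuousAt (fun z => (fderiv ℝ κ z).comp
        ((joinEquiv m k).symm : E (m + k) →L[ℝ] E m × E k)) ((0 : E m), u₁) :=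
      h1.clm_comp continuousAt_const
    exact ((continuous_det_clm (m + k)).continuousAt.comp h2).comp hc
  have hsign := sign_eventuallyEq hdet (hκ.coordDet_ne_zero hu₁s)
  have he : (fun u => twistedInChart α y u v) =ᶠ[𝓝 u₁] fun u =>
      coordSign κ (0, u₁) • inCoords i y κ ψ (0, u) (normalAppend m v) := by
    filter_upwards [hsign, hc.eventually (κ.open_source.mem_nhds hu₁s)] with u hu hus
    rw [hκ.twistedInChart_eq hX hm hi.contMDiff hμ hα hus, coordSign, hu]
    rfl
  refine ContDiffAt.congr_of_eventuallyEq ?_ he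
  refine ContDiffAt.const_smul _ ?_
  exact ContDiffAt.comp u₁ ((hκ.contDiffOn_inCoords hψ _).contDiffAt
    (κ.open_source.mem_nhds hu₁s)) (contDiff_prodMk_right (0 : E m)).contDiffAt

/-- A form whose pullback vanishes at the centre of an adapted chart vanishes there. -/
theorem IsAdaptedChart.formAt_eq_zero (hκ : IsAdaptedChart i μ y₁ κ) {ψ : DForm (m + k) X p}
    {u : E k} (hu : ((0 : E m), u) ∈ κ.source) (h : inCoords i y₁ κ ψ (0, u) = 0) :
    ψ (i ((chartAt (E k) y₁).symm u)) = 0 := by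
  rw [inCoords, hκ.apply_zero u hu] at h
  have : Function.Surjective (frameMap i y₁ κ (0, u)).toLinearMap := (hκ.frameMap_bijective hu).2
  exact AlternatingMap.compLinearMap_injective _ this h

/-- For tame `w` of degree less than the codimension, `μ^r w` vanishes on the submanifold. -/
theorem eq_zero_of_isTame (hi : Manifold.IsImmersion (𝓡 k) (𝓡 (m + k)) ∞ i)
    (hμ : IsMorseBott (n := m + k) i μ m) {r : ℕ} (hr : 1 ≤ r) (hp : p < m)
    {w ψ : DForm (m + k) X p}
    (hψ : IsSmoothExtension i ψ fun x => μ x ^ r • w x) (hw : IsTame i μ r w) (y : Y) :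
    ψ (i y) = 0 := by
  obtain ⟨χ, hχ⟩ := hw.2
  obtain ⟨κ, hκ⟩ := hμ.exists_adaptedChart rfl hi y
  have := hκ.formAt_eq_zero hκ.mem_source (eq_zero_of_wedge_normalCovector_of_lt hp _ fun b =>
    hκ.wedge_normalCovector_eq_zero hμ hr hψ hχ hκ.mem_source b)
  rwa [(chartAt (E k) y).left_inv (mem_chart_source _ _)] at this

/-- For tame `w`, the restriction of `μ^r w` to the submanifold is of the form `V(μ) ∧ α`. -/
theorem exists_restrictsTo (hX : IsOrientedAtlas (m + k) X) (hm : 1 ≤ m)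
    (hi : Manifold.IsImmersion (𝓡 k) (𝓡 (m + k)) ∞ i)
    (hμ : IsMorseBott (n := m + k) i μ m) {r : ℕ} (hr : 1 ≤ r)
    {w ψ : DForm (m + k) X (m + q)}
    (hψ : IsSmoothExtension i ψ fun x => μ x ^ r • w x) (hw : IsTame i μ r w) :
    ∃ α : DForm k Y q, RestrictsTo rfl rfl i μ ψ α := by
  obtain ⟨χ, hχ⟩ := hw.2
  have key : ∀ y : Y, ∃ β : E (m + k) [⋀^Fin q]→ₗ[ℝ] ℂ, formAt ψ (i y) =
      wedge (normalVolumeAt m k i μ y) β := by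
    intro y
    obtain ⟨κ, hκ⟩ := hμ.exists_adaptedChart rfl hi y
    set u := chartAt (E k) y y with hu₁
    have hu := hκ.mem_source
    have hy : (chartAt (E k) y).symm u = y := (chartAt (E k) y).left_inv (mem_chart_source _ _)
    set A := frameMap i y κ (0, u) with hA
    set Ae := LinearEquiv.ofBijective A.toLinearMap (hκ.frameMap_bijective hu)
    set s := coordSign κ (0, u) * chartSign y u with hs
    have hss : s * s = 1 := by
      rw [hs, mul_mul_mul_comm, coordSign_mul_self (hκ.coordDet_ne_zero hu),
        chartSign_mul_self (hκ.zero_mem u hu), one_mul]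
    set β := insertFirst (inCoords i y κ ψ (0, u)) fun a => (stdVec m a, 0) with hβ
    have h1 := eq_wedge_normalVol (inCoords i y κ ψ (0, u))
      (fun b => hκ.wedge_normalCovector_eq_zero hμ hr hψ hχ hu b) β fun t => rfl
    have h2 := hκ.normalVolume_frameMap hX hm hi.contMDiff hμ hu
    rw [hy] at h2
    refine ⟨(s • β).compLinearMap Ae.symm.toLinearMap, ?_⟩
    refine AlternatingMap.compLinearMap_injective A.toLinearMap (hκ.frameMap_bijective hu).2 ?_
    have h3 : (formAt ψ (i y)).compLinearMap A.toLinearMap = inCoords i y κ ψ (0, u) := by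
      rw [inCoords, hκ.apply_zero u hu, hy]
    have h4 : ((s • β).compLinearMap Ae.symm.toLinearMap).compLinearMap A.toLinearMap = s • β := by
      ext v
      change (s • β) (fun j => Ae.symm (Ae (v j))) = _
      simp
    change (formAt ψ (i y)).compLinearMap A.toLinearMap = (wedge (normalVolumeAt m k i μ y)
      ((s • β).compLinearMap Ae.symm.toLinearMap)).compLinearMap A.toLinearMap
    rw [h3, compLinearMap_wedge, h4, h2, h1, ← wedgeCast_rfl, ← wedgeCast_rfl,
      wedgeCast_smul_left, wedgeCast_smul_right, smul_smul, hss, one_smul]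
  choose β hβ using key
  exact ⟨fun y => (β y).compLinearMap (dmap (m + k) k i y).toLinearMap,
    fun y => ⟨β y, rfl, hβ y⟩⟩

end Restriction

/-! ### Smooth forms: products, pullbacks, and the densities they define -/

/-- Wedge products of forms with smooth coefficients have smooth coefficients. -/
theorem contDiffOn_wedgeCast_apply {V T : Type*} [NormedAddCommGroup V] [NormedSpace ℝ V]
    [AddCommGroup T] [Module ℝ T] {p q d : ℕ} (h : p + q = d) {S : Set V}
    {a : V → T [⋀^Fin p]→ₗ[ℝ] ℂ} {b : V → T [⋀^Fin q]→ₗ[ℝ] ℂ}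
    (ha : ∀ v, ContDiffOn ℝ ∞ (fun z => a z v) S) (hb : ∀ v, ContDiffOn ℝ ∞ (fun z => b z v) S)
    (v : Fin d → T) : ContDiffOn ℝ ∞ (fun z => wedgeCast h (a z) (b z) v) S := by
  simp only [wedgeCast_apply, sumWedge_apply]
  refine contDiffOn_const.mul (ContDiffOn.sum fun σ _ => ?_)
  exact contDiffOn_const.mul ((ha _).mul (hb _))

section Forms

variable {d : ℕ} {M : Type*} [TopologicalSpace M] [ChartedSpace (E d) M] {p q : ℕ}

theorem inChart_wedgeCast (h : p + q = d) (a : DForm d M p) (b : DForm d M q) (x₀ : M) (z : E d) :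
    inChart (fun x => wedgeCast h (a x) (b x)) x₀ z =
      wedgeCast h (inChart a x₀ z) (inChart b x₀ z) :=
  compLinearMap_wedgeCast h (formAt a _) (formAt b _) (jac (d := d) x₀ z).toLinearMap

theorem IsSmoothForm.wedgeCast (h : p + q = d) {a : DForm d M p} {b : DForm d M q}
    (ha : IsSmoothForm a) (hb : IsSmoothForm b) :
    IsSmoothForm fun x => MorseBottResidue.wedgeCast h (a x) (b x) := by
  intro x₀ v
  simp only [inChart_wedgeCast]
  exact contDiffOn_wedgeCast_apply h (ha x₀) (hb x₀) v

theorem IsSmoothTwistedForm.wedgeCast (h : p + q = d) {a : DForm d M p} {b : DForm d M q}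
    (ha : IsSmoothTwistedForm a) (hb : IsSmoothForm b) :
    IsSmoothTwistedForm fun x => MorseBottResidue.wedgeCast h (a x) (b x) := by
  intro x₀ v
  have : ∀ z, twistedInChart (fun x => MorseBottResidue.wedgeCast h (a x) (b x)) x₀ z =
      MorseBottResidue.wedgeCast h (twistedInChart a x₀ z) (inChart b x₀ z) := fun z => by
    rw [twistedInChart, inChart_wedgeCast, twistedInChart, wedgeCast_smul_left]
  simp only [this]
  exact contDiffOn_wedgeCast_apply h (ha x₀) (hb x₀) v

theorem inChart_smul (f : M → ℝ) (a : DForm d M p) (x₀ : M) (z : E d) (v : Fin p → E d) :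
    inChart (fun x => f x • a x) x₀ z v =
      (f ((chartAt (E d) x₀).symm z) : ℂ) * inChart a x₀ z v := rfl

theorem twistedInChart_smul (f : M → ℝ) (a : DForm d M p) (x₀ : M) (z : E d) (v : Fin p → E d) :
    twistedInChart (fun x => f x • a x) x₀ z v =
      (f ((chartAt (E d) x₀).symm z) : ℂ) * twistedInChart a x₀ z v := by
  rw [twistedInChart_apply, inChart_smul, twistedInChart_apply, Complex.real_smul,
    Complex.real_smul, mul_left_comm]

variable [IsManifold (𝓡 d) ∞ M]

theorem contDiffOn_ofReal_comp_chart_symm {f : M → ℝ} (hf : ContMDiff (𝓡 d) 𝓘(ℝ, ℝ) ∞ f)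
    (x₀ : M) : ContDiffOn ℝ ∞ (fun z => (f ((chartAt (E d) x₀).symm z) : ℂ))
      (chartAt (E d) x₀).target :=
  Complex.ofRealCLM.contDiff.comp_contDiffOn (contDiffOn_comp_chart_symm hf x₀)

theorem IsSmoothForm.smul {f : M → ℝ} (hf : ContMDiff (𝓡 d) 𝓘(ℝ, ℝ) ∞ f) {a : DForm d M p}
    (ha : IsSmoothForm a) : IsSmoothForm fun x => f x • a x := fun x₀ v => by
  simp only [inChart_smul]
  exact (contDiffOn_ofReal_comp_chart_symm hf x₀).mul (ha x₀ v)

theorem IsSmoothTwistedForm.smul {f : M → ℝ} (hf : ContMDiff (𝓡 d) 𝓘(ℝ, ℝ) ∞ f) {a : DForm d M p}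
    (ha : IsSmoothTwistedForm a) : IsSmoothTwistedForm fun x => f x • a x := fun x₀ v => by
  simp only [twistedInChart_smul]
  exact (contDiffOn_ofReal_comp_chart_symm hf x₀).mul (ha x₀ v)

/-- A continuous multiple of a compactly supported smooth form of top degree is a density. -/
theorem IsSmoothForm.isDensity (hX : IsOrientedAtlas d M) {η : DForm d M d} (hη : IsSmoothForm η)
    {K : Set M} (hK : IsCompact K) (h0 : ∀ x ∉ K, η x = 0) {f : M → ℂ} (hf : Continuous f) :
    IsDensity (fun x₀ z => f ((chartAt (E d) x₀).symm z) * inChart η x₀ z (stdVec d)) K where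
  continuousOn x₀ := (hf.comp_continuousOn (chartAt (E d) x₀).continuousOn_symm).mul
    (hη x₀ _).continuousOn
  compat x₀ x₁ z hz h := by
    rw [inChart_stdVec_trans hX η hz h, symm_trans h, mul_smul_comm]
  isCompact := hK
  eq_zero x₀ z _ hz := by
    rw [inChart_apply, h0 _ hz]
    exact mul_zero _

theorem IsSmoothTwistedForm.isDensity {τ : DForm d M d} (hτ : IsSmoothTwistedForm τ)
    {K : Set M} (hK : IsCompact K) (h0 : ∀ x ∉ K, τ x = 0) :
    IsDensity (fun x₀ z => twistedInChart τ x₀ z (stdVec d)) K where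
  continuousOn x₀ := (hτ x₀ _).continuousOn
  compat x₀ x₁ z hz h := twistedInChart_stdVec_trans τ hz h
  isCompact := hK
  eq_zero x₀ z _ hz := by
    rw [twistedInChart_apply, inChart_apply, h0 _ hz]
    exact smul_zero _

end Forms

section Restrict

variable {n k j : ℕ} {X Y : Type*} [TopologicalSpace X] [ChartedSpace (E n) X]
  [TopologicalSpace Y] [ChartedSpace (E k) Y]
variable [IsManifold (𝓡 n) ∞ X] [IsManifold (𝓡 k) ∞ Y]

/-- The pullback in coordinates. -/
theorem inChart_restrict {i : Y → X} (hi : ContMDiff (𝓡 k) (𝓡 n) ∞ i) {y₁ : Y} {u : E k}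
    (hu : u ∈ localDomain n k i y₁) (φ : DForm n X j) (v : Fin j → E k) :
    inChart (restrict i φ) y₁ u v = inChart φ (i y₁) (localMap n k i y₁ u)
      fun a => fderiv ℝ (localMap n k i y₁) u (v a) := by
  rw [inChart_apply, restrict_apply, inChart_apply, symm_localMap hu]
  have : ∀ a, dmap n k i ((chartAt (E k) y₁).symm u) (jac (d := k) y₁ u (v a)) =
      jac (d := n) (i y₁) (localMap n k i y₁ u) (fderiv ℝ (localMap n k i y₁) u (v a)) :=
    fun a => congrArg (fun L : E k →L[ℝ] E n => L (v a)) (dmap_comp_jac hi hu)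
  simp only [this]

theorem IsSmoothForm.restrict {i : Y → X} (hi : ContMDiff (𝓡 k) (𝓡 n) ∞ i) {φ : DForm n X j}
    (hφ : IsSmoothForm φ) : IsSmoothForm (MorseBottResidue.restrict i φ : DForm k Y j) := by
  refine isSmoothForm_of_center fun y v => ?_
  set u := chartAt (E k) y y with hu
  have hD : localDomain n k i y ∈ 𝓝 u :=
    (isOpen_localDomain hi.continuous y).mem_nhds (center_mem_localDomain i y)
  have hι : ContDiffAt ℝ ∞ (localMap n k i y) u := (contDiffOn_localMap hi y).contDiffAt hD
  have he : (fun u => inChart (MorseBottResidue.restrict i φ) y u v) =ᶠ[𝓝 u] fun u =>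
      inChart φ (i y) (localMap n k i y u) fun a => fderiv ℝ (localMap n k i y) u (v a) := by
    filter_upwards [hD] with u' hu' using inChart_restrict hi hu' φ v
  refine ContDiffAt.congr_of_eventuallyEq ?_ he
  refine contDiffAt_alternating_apply (a := fun z => inChart φ (i y) (localMap n k i y z))
    (fun w => ?_) fun a => ?_
  · exact ContDiffAt.comp u ((hφ (i y) w).contDiffAt ((chartAt (E n) (i y)).open_target.mem_nhds
      (localMap_mem_target (center_mem_localDomain i y)))) hι
  · exact (hι.fderiv_right (m := ∞) (by simp)).clm_apply contDiffAt_const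

/-- In adapted coordinates the pullback to the submanifold is the restriction to vectors of the
second factor. -/
theorem IsAdaptedChart.inCoords_tangent {m : ℕ} {i : Y → X} {μ : X → ℝ} {y₁ : Y}
    {κ : OpenPartialHomeomorph (E m × E k) (E n)} (hκ : IsAdaptedChart i μ y₁ κ)
    (hi : ContMDiff (𝓡 k) (𝓡 n) ∞ i) {u : E k} (hu : ((0 : E m), u) ∈ κ.source)
    (φ : DForm n X j) (v : Fin j → E k) :
    inCoords i y₁ κ φ (0, u) (fun a => (0, v a)) = inChart (restrict i φ) y₁ u v := by
  rw [inChart_apply, restrict_apply, ← hκ.apply_zero u hu]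
  have : ∀ a, frameMap i y₁ κ (0, u) (0, v a) = dmap n k i ((chartAt (E k) y₁).symm u)
      (jac (d := k) y₁ u (v a)) := fun a => hκ.frameMap_tangent hi hu (v a)
  simp only [← this]
  rfl

end Restrict

/-! ### The residue of a smooth form of top degree -/

section TopForm

variable {m k : ℕ} {X Y : Type*} [TopologicalSpace X] [ChartedSpace (E (m + k)) X]
  [TopologicalSpace Y] [ChartedSpace (E k) Y]

/-- `τ` is the contraction of the top degree form `η` with the normal frames of the submanifold,
in all adapted charts. The sign turns a form that depends on the orientation of the coordinates into
a twisted form. -/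
def IsNormalContraction (i : Y → X) (μ : X → ℝ) (η : DForm (m + k) X (m + k)) (τ : DForm k Y k) :
    Prop :=
  ∀ (y₁ : Y) (κ : OpenPartialHomeomorph (E m × E k) (E (m + k))), IsAdaptedChart i μ y₁ κ →
    ∀ u, ((0 : E m), u) ∈ κ.source → twistedInChart τ y₁ u (stdVec k) =
      coordSign κ (0, u) • inCoords i y₁ κ η (0, u) (normalAppend m (stdVec k))

theorem joinEquiv_symm_stdVec :
    (fun a => (joinEquiv m k).symm (stdVec (m + k) a)) = normalAppend m (stdVec k) := by
  funext a
  refine Fin.addCases (fun b => ?_) (fun b => ?_) a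
  · rw [← joinEquiv_stdVec_left, ContinuousLinearEquiv.symm_apply_apply, normalAppend,
      Fin.append_left]
  · rw [← joinEquiv_stdVec_right, ContinuousLinearEquiv.symm_apply_apply, normalAppend,
      Fin.append_right]

/-- The coefficient of a form of top degree in the coordinates `κ`. -/
theorem inCoords_normalAppend (i : Y → X) (y₁ : Y) (κ : E m × E k → E (m + k))
    (η : DForm (m + k) X (m + k)) (z : E m × E k) :
    inCoords i y₁ κ η z (normalAppend m (stdVec k)) =
      coordDet κ z • inChart η (i y₁) (κ z) (stdVec (m + k)) := by
  rw [inCoords_apply, ← joinEquiv_symm_stdVec, coordDet, ← map_comp_stdVec]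
  rfl

theorem inCoords_eq_zero {p : ℕ} (i : Y → X) (y₁ : Y) (κ : E m × E k → E (m + k))
    {ψ : DForm (m + k) X p} {z : E m × E k}
    (h : ψ ((chartAt (E (m + k)) (i y₁)).symm (κ z)) = 0) : inCoords i y₁ κ ψ z = 0 := by
  rw [inCoords, formAt, h]
  rfl

variable [IsManifold (𝓡 (m + k)) ∞ X] [IsManifold (𝓡 k) ∞ Y]
variable {i : Y → X} {μ : X → ℝ} {y₁ : Y} {κ : OpenPartialHomeomorph (E m × E k) (E (m + k))}
  {η : DForm (m + k) X (m + k)} {τ : DForm k Y k}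

theorem IsAdaptedChart.continuousOn_coordDet (hκ : IsAdaptedChart i μ y₁ κ) :
    ContinuousOn (coordDet κ) κ.source := by
  intro z hz
  have h1 : ContinuousAt (fderiv ℝ κ) z :=
    ((hκ.contDiffAt hz).fderiv_right (m := ∞) (by simp)).continuousAt
  have h2 : ContinuousAt (fun z => (fderiv ℝ κ z).comp
      ((joinEquiv m k).symm : E (m + k) →L[ℝ] E m × E k)) z := h1.clm_comp continuousAt_const
  exact (ContinuousAt.comp (continuous_det_clm (m + k)).continuousAt h2).continuousWithinAt

/-- Change of variables in an adapted chart. -/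
theorem IsAdaptedChart.integral_target (hκ : IsAdaptedChart i μ y₁ κ) (f : E (m + k) → ℂ) :
    ∫ z in κ.target, f z = ∫ z in κ.source, |coordDet κ z| • f (κ z) := by
  set J := joinEquiv m k with hJ
  set S : Set (E (m + k)) := J.symm ⁻¹' κ.source with hS
  have hSo : IsOpen S := κ.open_source.preimage J.symm.continuous
  have hd : ∀ w ∈ S, HasFDerivWithinAt (κ ∘ J.symm)
      ((fderiv ℝ κ (J.symm w)).comp (J.symm : E (m + k) →L[ℝ] E m × E k)) S w := fun w hw =>
    ((((hκ.contDiffAt hw).differentiableAt (by simp)).hasFDerivAt).comp w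
      J.symm.hasFDerivAt).hasFDerivWithinAt
  have hinj : InjOn (κ ∘ J.symm) S := fun a ha b hb hab =>
    J.symm.injective (κ.injOn ha hb hab)
  have himg : (κ ∘ J.symm) '' S = κ.target := by
    rw [image_comp, image_preimage_eq _ J.symm.surjective, κ.image_source_eq_target]
  rw [← himg, integral_image_eq_integral_abs_det_fderiv_smul volume hSo.measurableSet hd hinj]
  have hmp := measurePreserving_joinEquiv m k
  have := hmp.setIntegral_preimage_emb J.toHomeomorph.measurableEmbedding
    (fun w => |coordDet κ (J.symm w)| • f (κ (J.symm w))) S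
  have hpre : J ⁻¹' S = κ.source := by
    ext z; simp [S]
  rw [hpre] at this
  refine this.symm.trans (setIntegral_congr_fun κ.open_source.measurableSet fun z _ => ?_)
  change |coordDet κ (J.symm (J z))| • f (κ (J.symm (J z))) = _
  rw [J.symm_apply_apply]

/-- A normal contraction vanishes wherever `η` does; in particular it has compact support if `η`
does. -/
theorem eq_zero_of_isNormalContraction (hi : Manifold.IsImmersion (𝓡 k) (𝓡 (m + k)) ∞ i)
    (hμ : IsMorseBott (n := m + k) i μ m) (h : IsNormalContraction i μ η τ) {y : Y}
    (hy : η (i y) = 0) : τ y = 0 := by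
  obtain ⟨κ, hκ⟩ := hμ.exists_adaptedChart rfl hi y
  have h1 := h y κ hκ _ hκ.mem_source
  have h2 : inCoords i y κ η (0, chartAt (E k) y y) = 0 := by
    rw [inCoords, hκ.apply_zero _ hκ.mem_source,
      (chartAt (E k) y).left_inv (mem_chart_source _ _), formAt, hy]
    rfl
  rw [h2, AlternatingMap.zero_apply, smul_zero] at h1
  refine eq_of_twistedInChart_eq (τ' := fun _ => 0) fun v => ?_
  have h3 : twistedInChart τ y (chartAt (E k) y y) = 0 := by
    refine (EuclideanSpace.basisFun (Fin k) ℝ).toBasis.ext_alternating fun f hf => ?_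
    let σ : Equiv.Perm (Fin k) := Equiv.ofBijective f (Finite.injective_iff_bijective.1 hf)
    have h4 := (twistedInChart τ y (chartAt (E k) y y)).map_perm (stdVec k) σ
    rw [h1, smul_zero] at h4
    have h5 : (fun a => (EuclideanSpace.basisFun (Fin k) ℝ).toBasis (f a)) = stdVec k ∘ σ := by
      funext a
      simp [σ, stdVec]
    rw [h5, h4]
    rfl
  rw [h3, twistedInChart_apply, inChart_apply]
  exact (smul_zero _).symm

/-- Points of the submanifold in an adapted chart. -/
theorem IsAdaptedChart.eq_of_apply_eq (hκ : IsAdaptedChart i μ y₁ κ)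
    (hμ : IsMorseBott (n := m + k) i μ m) (hinj : Function.Injective i) {z : E m × E k}
    (hz : z ∈ κ.source) {y : Y} (h : (chartAt (E (m + k)) (i y₁)).symm (κ z) = i y) :
    z = (0, z.2) ∧ y = (chartAt (E k) y₁).symm z.2 := by
  have h1 := hκ.norm_sq z hz
  rw [h, (hμ.zero_iff _).2 (mem_range_self _)] at h1
  have h2 : z.1 = 0 := by simpa using h1.symm
  have h3 : z = (0, z.2) := Prod.ext h2 rfl
  refine ⟨h3, hinj ?_⟩
  rw [← h, ← hκ.apply_zero z.2 (h3 ▸ hz), ← h3]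

variable [T2Space X] [SigmaCompactSpace X] [T2Space Y] [SigmaCompactSpace Y]

/-- The function `s ↦ ∫ μ^(s/2-r) η`. For `η = μ^r w ∧ φ` this is `∫ μ^(s/2) w ∧ φ`. -/
def powerIntegral (μ : X → ℝ) (η : DForm (m + k) X (m + k)) (r : ℕ) (s : ℂ) : ℂ :=
  chartIntegral fun (x₀ : X) z => ((μ ((chartAt (E (m + k)) x₀).symm z) : ℂ) ^ (s / 2 - r)) *
    inChart η x₀ z (stdVec (m + k))

theorem continuous_cpow_comp {f : X → ℝ} (hf : Continuous f) {a : ℂ} (ha : 0 < a.re) :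
    Continuous fun x => (f x : ℂ) ^ a := by
  exact (Complex.continuous_ofReal_cpow_const ha).comp hf

theorem re_half_sub_pos {r : ℕ} {s : ℂ} (hs : 2 * r < s.re) : 0 < (s / 2 - r).re := by
  have : (s / 2 - r).re = s.re / 2 - r := by simp
  rw [this]; linarith

/-- For `Re s > 2 r` the exponent has positive real part, so that the integrand is continuous across
the zero set of `μ`. -/
theorem isDensity_powerIntegral (hX : IsOrientedAtlas (m + k) X)
    (hμ : IsMorseBott (n := m + k) i μ m) (hη : IsSmoothForm η) {K : Set X} (hK : IsCompact K)
    (h0 : ∀ x ∉ K, η x = 0) {r : ℕ} {s : ℂ} (hs : 2 * r < s.re) :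
    IsDensity (fun (x₀ : X) z => ((μ ((chartAt (E (m + k)) x₀).symm z) : ℂ) ^ (s / 2 - r)) *
      inChart η x₀ z (stdVec (m + k))) K :=
  hη.isDensity hX hK h0 (continuous_cpow_comp hμ.smooth.continuous (re_half_sub_pos hs))

/-- The residue vanishes for forms supported away from the submanifold: there the integral is an
entire function of `s`. -/
theorem hasResidueZero_powerIntegral_of_disjoint (hX : IsOrientedAtlas (m + k) X)
    (hμ : IsMorseBott (n := m + k) i μ m) (hη : IsSmoothForm η) {K : Set X} (hK : IsCompact K)
    (h0 : ∀ x ∉ K, η x = 0) {x₁ : X} (hKs : K ⊆ (chartAt (E (m + k)) x₁).source)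
    (hKY : Disjoint K (range i)) (r : ℕ) : HasResidueZero (powerIntegral μ η r) 0 := by
  set c := chartAt (E (m + k)) x₁ with hc
  have hKc : c '' K ⊆ c.target := by
    rintro _ ⟨x, hx, rfl⟩
    exact c.map_source (hKs hx)
  have hcK : IsCompact (c '' K) := hK.image_of_continuousOn (c.continuousOn.mono hKs)
  have hd := differentiable_integral_cpow (ν := volume) hcK (m := fun z => μ (c.symm z))
    (hμ.smooth.continuous.comp_continuousOn (c.continuousOn_symm.mono hKc))
    (by
      rintro _ ⟨x, hx, rfl⟩
      rw [c.left_inv (hKs hx)]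
      refine lt_of_le_of_ne (hμ.nonneg x) fun h => ?_
      exact hKY.le_bot ⟨hx, (hμ.zero_iff x).1 h.symm⟩)
    (g := fun z => inChart η x₁ z (stdVec (m + k))) ((hη x₁ _).continuousOn.mono hKc) (r : ℂ)
  refine (HasResidueZero.of_differentiable hd).congr (C := 2 * r) fun s hs => ?_
  rw [powerIntegral, (isDensity_powerIntegral hX hμ hη hK h0 hs).chartIntegral_eq hKs]
  refine (setIntegral_eq_of_subset_of_forall_sdiff_eq_zero c.open_target.measurableSet hKc
    fun z hz => ?_).symm
  exact (isDensity_powerIntegral hX hμ hη hK h0 hs).eq_zero x₁ z hz.1 fun h =>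
    hz.2 ⟨_, h, c.right_inv hz.1⟩

end TopForm

section Residue

variable {r k : ℕ} {X Y : Type*} [TopologicalSpace X] [ChartedSpace (E (2 * r + k)) X]
  [TopologicalSpace Y] [ChartedSpace (E k) Y]
variable [IsManifold (𝓡 (2 * r + k)) ∞ X] [IsManifold (𝓡 k) ∞ Y]
variable {i : Y → X} {μ : X → ℝ} {y₁ : Y}
  {κ : OpenPartialHomeomorph (E (2 * r) × E k) (E (2 * r + k))}
  {η : DForm (2 * r + k) X (2 * r + k)} {τ : DForm k Y k}
variable [T2Space X] [SigmaCompactSpace X] [T2Space Y] [SigmaCompactSpace Y]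

/-- The residue of forms supported in an adapted chart: there `μ = ‖x‖²`, and the integral is the
one over `ℝ^(2r) × ℝ^k` whose continuation is known. -/
theorem IsAdaptedChart.hasResidueZero_powerIntegral (hr : 1 ≤ r)
    (hX : IsOrientedAtlas (2 * r + k) X) (hκ : IsAdaptedChart i μ y₁ κ)
    (hi : Manifold.IsSmoothEmbedding (𝓡 k) (𝓡 (2 * r + k)) ∞ i) (hY : IsClosed (range i))
    (hμ : IsMorseBott (n := 2 * r + k) i μ (2 * r)) (hη : IsSmoothForm η)
    (hτ : IsSmoothTwistedForm τ) (h : IsNormalContraction i μ η τ) {K : Set X}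
    (hK : IsCompact K) (h0 : ∀ x ∉ K, η x = 0)
    (hKs : K ⊆ (chartAt (E (2 * r + k)) (i y₁)).source)
    (hKκ : chartAt (E (2 * r + k)) (i y₁) '' K ⊆ κ.target) :
    HasResidueZero (powerIntegral μ η r)
      ((2 * Real.pi ^ r / (r - 1).factorial : ℝ) * twistedIntegral τ) := by
  set c := chartAt (E (2 * r + k)) (i y₁) with hc
  -- the coefficient of `η` in the coordinates `(x, u)`, with the absolute value of the Jacobian
  -- determinant included; it is extended by zero to `g`
  set b : E (2 * r) × E k → ℂ := fun z =>
    coordSign κ z • inCoords i y₁ κ η z (normalAppend (2 * r) (stdVec k)) with hb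
  set g : E (2 * r) × E k → ℂ := κ.source.indicator b with hg
  set L : Set (E (2 * r) × E k) := κ.symm '' (c '' K) with hL
  have hLc : IsCompact L := (hK.image_of_continuousOn (c.continuousOn.mono hKs)).image_of_continuousOn
    (κ.continuousOn_symm.mono hKκ)
  have hLs : L ⊆ κ.source := by
    rintro _ ⟨z, hz, rfl⟩
    exact κ.map_target (hKκ hz)
  have hnK : ∀ z ∈ κ.source, z ∉ L → c.symm (κ z) ∉ K := fun z hz hzL hK' =>
    hzL ⟨κ z, ⟨_, hK', c.right_inv (hκ.mem_target hz)⟩, κ.left_inv hz⟩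
  have hb0 : ∀ z ∈ κ.source, z ∉ L → b z = 0 := fun z hz hzL => by
    simp only [b, inCoords_eq_zero i y₁ κ (h0 _ (hnK z hz hzL)), AlternatingMap.zero_apply,
      smul_zero]
  have hg0 : ∀ z, z ∉ L → g z = 0 := fun z hzL => by
    by_cases hz : z ∈ κ.source
    · simp only [g, indicator_of_mem hz, hb0 z hz hzL]
    · simp only [g, indicator_of_notMem hz]
  have hgs : ContDiff ℝ ∞ g := by
    refine contDiff_iff_contDiffAt.2 fun z => ?_
    by_cases hz : z ∈ κ.source
    · have hsign := sign_eventuallyEq ((hκ.continuousOn_coordDet.continuousAt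
        (κ.open_source.mem_nhds hz))) (hκ.coordDet_ne_zero hz)
      have he : g =ᶠ[𝓝 z] fun z' =>
          coordSign κ z • inCoords i y₁ κ η z' (normalAppend (2 * r) (stdVec k)) := by
        filter_upwards [hsign, κ.open_source.mem_nhds hz] with z' hz' hzs
        simp only [g, indicator_of_mem hzs, b, coordSign, hz']
      exact ((hκ.contDiffOn_inCoords hη _).contDiffAt
        (κ.open_source.mem_nhds hz)).const_smul _ |>.congr_of_eventuallyEq he
    · have he : g =ᶠ[𝓝 z] fun _ => 0 := by
        filter_upwards [hLc.isClosed.isOpen_compl.mem_nhds fun hzL => hz (hLs hzL)] with z' hz'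
          using hg0 z' hz'
      exact contDiffAt_const.congr_of_eventuallyEq he
  have hgc : HasCompactSupport g := HasCompactSupport.intro hLc fun z hz => hg0 z hz
  obtain ⟨Z, hZm, hZ, hZt⟩ := exists_meromorphic_integral_prod hr hgs hgc
  -- the integral of `g` over the submanifold
  have hsurf : ∫ u, g (0, u) = twistedIntegral τ := by
    set K' := i ⁻¹' K with hK'
    have hK'c : IsCompact K' :=
      (Topology.IsClosedEmbedding.mk hi.isEmbedding hY).isCompact_preimage hK
    have hτ0 : ∀ y ∉ K', τ y = 0 := fun y hy =>
      eq_zero_of_isNormalContraction hi.isImmersion hμ h (h0 _ hy)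
    have hKz : ∀ y ∈ K', ∃ u, ((0 : E (2 * r)), u) ∈ κ.source ∧ y = (chartAt (E k) y₁).symm u := by
      intro y hy
      have h1 : κ.symm (c (i y)) ∈ κ.source := κ.map_target (hKκ ⟨_, hy, rfl⟩)
      have h2 : c.symm (κ (κ.symm (c (i y)))) = i y := by
        rw [κ.right_inv (hKκ ⟨_, hy, rfl⟩), c.left_inv (hKs hy)]
      obtain ⟨h3, h4⟩ := hκ.eq_of_apply_eq hμ hi.isEmbedding.injective h1 h2
      exact ⟨_, h3 ▸ h1, h4⟩
    have hKs' : K' ⊆ (chartAt (E k) y₁).source := fun y hy => by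
      obtain ⟨u, hu, rfl⟩ := hKz y hy
      exact (chartAt (E k) y₁).map_target (hκ.zero_mem u hu)
    rw [twistedIntegral, (hτ.isDensity hK'c hτ0).chartIntegral_eq hKs',
      ← setIntegral_eq_integral_of_forall_compl_eq_zero (s := (chartAt (E k) y₁).target)
        fun u hu => indicator_of_notMem (fun h' => hu (hκ.zero_mem u h')) _]
    refine setIntegral_congr_fun (chartAt (E k) y₁).open_target.measurableSet fun u hu => ?_
    by_cases hus : ((0 : E (2 * r)), u) ∈ κ.source
    · simp only [indicator_of_mem hus, b]
      exact (h y₁ κ hκ u hus).symm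
    · simp only [indicator_of_notMem hus]
      have : (chartAt (E k) y₁).symm u ∉ K' := fun hmem => by
        obtain ⟨u', hu', he⟩ := hKz _ hmem
        have := (chartAt (E k) y₁).symm.injOn hu (hκ.zero_mem u' hu') he
        exact hus (this ▸ hu')
      rw [twistedInChart_apply, inChart_apply, hτ0 _ this]
      exact (smul_zero _).symm
  rw [← hsurf]
  refine HasResidueZero.congr (f := fun s => ∫ z, ((‖z.1‖ ^ 2 : ℝ) : ℂ) ^ (s / 2 - r) * g z)
    ⟨Z, hZm, ⟨2 * r, hZ⟩, hZt⟩ (C := 2 * r) fun s hs => ?_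
  have hden := isDensity_powerIntegral hX hμ hη hK h0 hs
  rw [powerIntegral, hden.chartIntegral_eq hKs,
    setIntegral_eq_of_subset_of_forall_sdiff_eq_zero c.open_target.measurableSet hκ.target_subset
      (fun z hz => hden.eq_zero (i y₁) z hz.1 fun hmem =>
        hz.2 (hKκ ⟨_, hmem, c.right_inv hz.1⟩)),
    hκ.integral_target,
    ← setIntegral_eq_integral_of_forall_compl_eq_zero (s := κ.source)
      fun z hz => by simp only [g, indicator_of_notMem hz, mul_zero]]
  refine setIntegral_congr_fun κ.open_source.measurableSet fun z hz => ?_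
  simp only [g, indicator_of_mem hz, b]
  rw [inCoords_normalAppend, hκ.norm_sq z hz, smul_smul, coordSign_mul_coordDet, mul_smul_comm]

/-- The residue of a compactly supported smooth form of top degree, by means of a partition of
unity. -/
theorem hasResidueZero_powerIntegral (hr : 1 ≤ r)
    (hX : IsOrientedAtlas (2 * r + k) X)
    (hi : Manifold.IsSmoothEmbedding (𝓡 k) (𝓡 (2 * r + k)) ∞ i) (hY : IsClosed (range i))
    (hμ : IsMorseBott (n := 2 * r + k) i μ (2 * r)) (hη : IsSmoothForm η)
    (hηc : IsCompactlySupported η)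
    (hτ : IsSmoothTwistedForm τ) (h : IsNormalContraction i μ η τ) :
    HasResidueZero (powerIntegral μ η r)
      ((2 * Real.pi ^ r / (r - 1).factorial : ℝ) * twistedIntegral τ) := by
  obtain ⟨K, hK, h0⟩ := hηc
  -- neighbourhoods on which the residue has been computed
  have hloc : ∀ x : X, ∃ W : Set X, IsOpen W ∧ x ∈ W ∧
      ∀ (η' : DForm (2 * r + k) X (2 * r + k)) (τ' : DForm k Y k) (K' : Set X),
        IsSmoothForm η' → IsSmoothTwistedForm τ' → IsNormalContraction i μ η' τ' →
        IsCompact K' → K' ⊆ W → (∀ x ∉ K', η' x = 0) →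
        HasResidueZero (powerIntegral μ η' r)
          ((2 * Real.pi ^ r / (r - 1).factorial : ℝ) * twistedIntegral τ') := by
    intro x
    by_cases hx : x ∈ range i
    · obtain ⟨y, rfl⟩ := hx
      obtain ⟨κ, hκ⟩ := hμ.exists_adaptedChart rfl hi.isImmersion y
      set c := chartAt (E (2 * r + k)) (i y) with hc
      refine ⟨c.source ∩ c ⁻¹' κ.target,
        c.isOpen_inter_preimage κ.open_target, ⟨mem_chart_source _ _, ?_⟩, ?_⟩
      · have h1 := hκ.apply_zero _ hκ.mem_source
        rw [(chartAt (E k) y).left_inv (mem_chart_source _ _)] at h1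
        rw [mem_preimage, ← h1, c.right_inv (hκ.mem_target hκ.mem_source)]
        exact κ.map_source hκ.mem_source
      · intro η' τ' K' hη' hτ' h' hK' hKW h0'
        refine hκ.hasResidueZero_powerIntegral hr hX hi hY hμ hη' hτ' h' hK' h0'
          (fun x hx => (hKW hx).1) ?_
        rintro _ ⟨x, hx, rfl⟩
        exact (hKW hx).2
    · refine ⟨(chartAt (E (2 * r + k)) x).source ∩ (range i)ᶜ,
        (chartAt (E (2 * r + k)) x).open_source.inter hY.isOpen_compl,
        ⟨mem_chart_source _ _, hx⟩, ?_⟩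
      intro η' τ' K' hη' hτ' h' hK' hKW h0'
      have hdisj : Disjoint K' (range i) :=
        disjoint_left.2 fun x hx hxY => (hKW hx).2 hxY
      have hτ0 : ∀ y, τ' y = 0 := fun y => eq_zero_of_isNormalContraction hi.isImmersion hμ h'
        (h0' _ fun hmem => (hKW hmem).2 (mem_range_self y))
      have hint : twistedIntegral τ' = 0 := by
        have : τ' = fun _ => 0 := funext hτ0
        rw [twistedIntegral, ← chartIntegral_zero (d := k) (M := Y), this]
        congr 1
        funext y₀ u
        rw [twistedInChart_apply, inChart_apply]
        exact smul_zero _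
      rw [hint, mul_zero]
      exact hasResidueZero_powerIntegral_of_disjoint hX hμ hη' hK' h0'
        (fun x hx => (hKW hx).1) hdisj r
  choose W hWo hxW hW using hloc
  obtain ⟨ρ, hρ⟩ := SmoothPartitionOfUnity.exists_isSubordinate (𝓡 (2 * r + k))
    (isClosed_univ (X := X)) W hWo fun x _ => mem_iUnion.2 ⟨x, hxW x⟩
  have hfin : {x : X | (Function.support (ρ x) ∩ K).Nonempty}.Finite :=
    ρ.locallyFinite.finite_nonempty_inter_compact hK
  set t := hfin.toFinset with ht
  have hsum : ∀ x ∈ K, ∑ a ∈ t, ρ a x = 1 := by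
    intro x hx
    rw [← ρ.sum_eq_one (mem_univ x)]
    refine (finsum_eq_sum_of_support_subset _ fun a ha => ?_).symm
    simp only [t, Finite.coe_toFinset, mem_ofPred_eq]
    exact ⟨x, ha, hx⟩
  -- the pieces of `η` and of its contraction
  set ηa : X → DForm (2 * r + k) X (2 * r + k) := fun a x => ρ a x • η x with hηa
  set τa : X → DForm k Y k := fun a y => ρ a (i y) • τ y with hτa
  have hτ0 : ∀ y ∉ i ⁻¹' K, τ y = 0 := fun y hy =>
    eq_zero_of_isNormalContraction hi.isImmersion hμ h (h0 _ hy)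
  have hK'c : IsCompact (i ⁻¹' K) :=
    (Topology.IsClosedEmbedding.mk hi.isEmbedding hY).isCompact_preimage hK
  have hηs : ∀ a, IsSmoothForm (ηa a) := fun a => hη.smul (ρ a).contMDiff
  have hτs : ∀ a, IsSmoothTwistedForm (τa a) := fun a =>
    hτ.smul ((ρ a).contMDiff.comp hi.contMDiff)
  have hrel : ∀ a, IsNormalContraction i μ (ηa a) (τa a) := by
    intro a y₁ κ hκ u hu
    have h1 := h y₁ κ hκ u hu
    have h2 : twistedInChart (τa a) y₁ u (stdVec k) =
        (ρ a (i ((chartAt (E k) y₁).symm u)) : ℂ) * twistedInChart τ y₁ u (stdVec k) :=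
      twistedInChart_smul (fun y => ρ a (i y)) τ y₁ u _
    have h3 : inCoords i y₁ κ (ηa a) (0, u) (normalAppend (2 * r) (stdVec k)) =
        (ρ a ((chartAt (E (2 * r + k)) (i y₁)).symm (κ (0, u))) : ℂ) *
          inCoords i y₁ κ η (0, u) (normalAppend (2 * r) (stdVec k)) := rfl
    rw [h2, h3, h1, hκ.apply_zero u hu, mul_smul_comm]
  have hKa : ∀ a, ∀ x ∉ K ∩ tsupport (ρ a), ηa a x = 0 := by
    intro a x hx
    by_cases hxK : x ∈ K
    · have : ρ a x = 0 := image_eq_zero_of_notMem_tsupport fun h' => hx ⟨hxK, h'⟩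
      simp only [ηa, this, zero_smul]
    · simp only [ηa, h0 x hxK, smul_zero]
  have hKac : ∀ a, IsCompact (K ∩ tsupport (ρ a)) := fun a => hK.inter_right (isClosed_tsupport _)
  have hres : ∀ a ∈ t, HasResidueZero (powerIntegral μ (ηa a) r)
      ((2 * Real.pi ^ r / (r - 1).factorial : ℝ) * twistedIntegral (τa a)) := fun a _ =>
    hW a _ _ _ (hηs a) (hτs a) (hrel a) (hKac a) (inter_subset_right.trans (hρ a)) (hKa a)
  have hηsum : ∀ x, η x = ∑ a ∈ t, ηa a x := by
    intro x
    by_cases hx : x ∈ K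
    · simp only [ηa]
      rw [← Finset.sum_smul, hsum x hx, one_smul]
    · simp only [ηa, h0 x hx, smul_zero, Finset.sum_const_zero]
  have hτsum : twistedIntegral τ = ∑ a ∈ t, twistedIntegral (τa a) := by
    have h1 := (IsDensity.sum t (f := fun a y₀ u => twistedInChart (τa a) y₀ u (stdVec k))
      (K := fun _ => i ⁻¹' K) fun a _ => (hτs a).isDensity hK'c fun y hy => by
        simp only [τa, hτ0 y hy, smul_zero]).2
    refine Eq.trans ?_ h1
    rw [twistedIntegral]
    congr 1
    funext y₀ u
    have h2 : ∀ a, twistedInChart (τa a) y₀ u (stdVec k) =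
        (ρ a (i ((chartAt (E k) y₀).symm u)) : ℂ) * twistedInChart τ y₀ u (stdVec k) :=
      fun a => twistedInChart_smul (fun y => ρ a (i y)) τ y₀ u _
    simp only [h2]
    rw [← Finset.sum_mul]
    by_cases hy : i ((chartAt (E k) y₀).symm u) ∈ K
    · rw [← Complex.ofReal_sum, hsum _ hy, Complex.ofReal_one, one_mul]
    · have : twistedInChart τ y₀ u (stdVec k) = 0 := by
        rw [twistedInChart_apply, inChart_apply, hτ0 _ hy]
        exact smul_zero _
      rw [this, mul_zero]
  rw [hτsum, Finset.mul_sum]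
  refine (HasResidueZero.sum t hres).congr (C := 2 * r) fun s hs => ?_
  have h1 := (IsDensity.sum t (K := fun _ => K) fun a _ => isDensity_powerIntegral hX hμ (hηs a) hK
    (fun x hx => hKa a x fun h' => hx h'.1) hs).2
  refine Eq.trans h1.symm ?_
  rw [powerIntegral]
  congr 1
  funext x₀ z
  have h2 : ∀ a, inChart (ηa a) x₀ z (stdVec (2 * r + k)) =
      (ρ a ((chartAt (E (2 * r + k)) x₀).symm z) : ℂ) * inChart η x₀ z (stdVec (2 * r + k)) :=
    fun a => rfl
  simp only [h2]
  rw [← Finset.mul_sum, ← Finset.sum_mul]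
  by_cases hx : (chartAt (E (2 * r + k)) x₀).symm z ∈ K
  · rw [← Complex.ofReal_sum, hsum _ hx, Complex.ofReal_one, one_mul]
  · have : inChart η x₀ z (stdVec (2 * r + k)) = 0 := by
      rw [inChart_apply, h0 _ hx]
      rfl
    rw [this, mul_zero]

end Residue

/-! ### The residue of a tame form -/

theorem twistedInChart_wedgeCast {d p q : ℕ} {M : Type*} [TopologicalSpace M]
    [ChartedSpace (E d) M] (h : p + q = d) (a : DForm d M p) (b : DForm d M q) (x₀ : M)
    (z : E d) : twistedInChart (fun x => wedgeCast h (a x) (b x)) x₀ z =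
      wedgeCast h (twistedInChart a x₀ z) (inChart b x₀ z) := by
  rw [twistedInChart, inChart_wedgeCast, twistedInChart, wedgeCast_smul_left]

section Extension

variable {n k p j : ℕ} {X Y : Type*} [TopologicalSpace X] [ChartedSpace (E n) X]
  [TopologicalSpace Y] [ChartedSpace (E k) Y] {i : Y → X} {μ : X → ℝ} {m r : ℕ}

/-- For `Re s > 2 r` the form `μ^(s/2) w` is `μ^(s/2-r) ψ`; on the submanifold both powers
vanish, so that the values of `w` there do not matter. -/
theorem cpow_smul_wedgeCast_eq (hr : 1 ≤ r) (hμ : IsMorseBott (n := n) i μ m)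
    {w ψ : DForm n X p} (hψ : IsSmoothExtension i ψ fun x => μ x ^ r • w x) (hX : p + j = n)
    (φ : DForm n X j) {s : ℂ} (hs : 2 * r < s.re) (x : X) :
    ((μ x : ℂ) ^ (s / 2)) • wedgeCast hX (w x) (φ x) =
      ((μ x : ℂ) ^ (s / 2 - r)) • wedgeCast hX (ψ x) (φ x) := by
  have hpos := re_half_sub_pos hs
  by_cases hx : x ∈ range i
  · have h0 : μ x = 0 := (hμ.zero_iff x).2 hx
    have h1 : s / 2 ≠ 0 := fun h => by
      have hr' : (1 : ℝ) ≤ r := by exact_mod_cast hr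
      have : s = 0 := by linear_combination 2 * h
      rw [this, Complex.zero_re] at hs
      linarith
    have h2 : s / 2 - r ≠ 0 := fun h => by
      rw [h, Complex.zero_re] at hpos
      exact lt_irrefl _ hpos
    rw [h0, Complex.ofReal_zero, Complex.zero_cpow h1, Complex.zero_cpow h2, zero_smul, zero_smul]
  · have h0 : μ x ≠ 0 := fun h => hx ((hμ.zero_iff x).1 h)
    have h1 : ψ x = μ x ^ r • w x := hψ.2 x hx
    have h2 : (μ x : ℂ) ^ (s / 2) = (μ x : ℂ) ^ (s / 2 - r) * (μ x : ℂ) ^ r := by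
      rw [← Complex.cpow_natCast, ← Complex.cpow_add _ _ (Complex.ofReal_ne_zero.2 h0),
        sub_add_cancel]
    rw [h1, wedgeCast_smul_left, h2, mul_smul]
    congr 1
    ext v
    simp [Complex.real_smul]

end Extension

section Contraction

variable {m k p q j : ℕ} {X Y : Type*} [TopologicalSpace X] [ChartedSpace (E (m + k)) X]
  [TopologicalSpace Y] [ChartedSpace (E k) Y]
variable [IsManifold (𝓡 (m + k)) ∞ X] [IsManifold (𝓡 k) ∞ Y]
variable {i : Y → X} {μ : X → ℝ}

theorem inCoords_wedgeCast (hX : p + j = m + k) (ψ : DForm (m + k) X p) (φ : DForm (m + k) X j)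
    (y₁ : Y) (κ : E m × E k → E (m + k)) (z : E m × E k) :
    inCoords i y₁ κ (fun x => wedgeCast hX (ψ x) (φ x)) z =
      wedgeCast hX (inCoords i y₁ κ ψ z) (inCoords i y₁ κ φ z) :=
  compLinearMap_wedgeCast hX (formAt ψ _) (formAt φ _) (frameMap i y₁ κ z).toLinearMap

/-- The contraction of `V(μ) ∧ α ∧ φ` with the normal frames is `α ∧ i^*φ`. -/
theorem isNormalContraction_wedgeCast (hX : IsOrientedAtlas (m + k) X) (hm : 1 ≤ m)
    (hi : Manifold.IsImmersion (𝓡 k) (𝓡 (m + k)) ∞ i)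
    (hμ : IsMorseBott (n := m + k) i μ m) {ψ : DForm (m + k) X (m + q)} {α : DForm k Y q}
    (hα : RestrictsTo rfl rfl i μ ψ α) (h₁ : m + q + j = m + k) (h₂ : q + j = k)
    (φ : DForm (m + k) X j) :
    IsNormalContraction i μ (fun x => wedgeCast h₁ (ψ x) (φ x))
      fun y => wedgeCast h₂ (α y) (restrict i φ y) := by
  intro y₁ κ hκ u hu
  obtain ⟨β, h3, h4⟩ := hκ.exists_inCoords_eq_wedge hX hm hi.contMDiff hμ hα hu
  rw [inCoords_wedgeCast, h3, ← wedgeCast_rfl, wedgeCast_assoc rfl h₁ h₂ rfl, wedgeCast_rfl,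
    normalAppend, wedge_normalVol_append, twistedInChart_wedgeCast]
  have h5 : β.compLinearMap (LinearMap.inr ℝ (E m) (E k)) =
      coordSign κ (0, u) • twistedInChart α y₁ u := by
    ext v
    exact h4 v
  have h6 : (inCoords i y₁ κ φ (0, u)).compLinearMap (LinearMap.inr ℝ (E m) (E k)) =
      inChart (restrict i φ) y₁ u := by
    ext v
    exact hκ.inCoords_tangent hi.contMDiff hu φ v
  have h7 := compLinearMap_wedgeCast h₂ β (inCoords i y₁ κ φ (0, u)) (LinearMap.inr ℝ (E m) (E k))
  rw [h5, h6, wedgeCast_smul_left] at h7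
  have h8 : wedgeCast h₂ β (inCoords i y₁ κ φ (0, u)) (fun a => ((0 : E m), stdVec k a)) =
      (coordSign κ (0, u) • wedgeCast h₂ (twistedInChart α y₁ u) (inChart (restrict i φ) y₁ u))
        (stdVec k) := by
    rw [← h7]
    rfl
  rw [h8, AlternatingMap.smul_apply, smul_smul, coordSign_mul_self (hκ.coordDet_ne_zero hu),
    one_smul]

theorem isNormalContraction_zero {η : DForm (m + k) X (m + k)} (h : ∀ y, η (i y) = 0) :
    IsNormalContraction i μ η fun (_ : Y) => 0 := by
  intro y₁ κ hκ u hu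
  rw [inCoords_eq_zero i y₁ κ (by rw [hκ.apply_zero u hu]; exact h _), twistedInChart_apply,
    inChart_apply, AlternatingMap.zero_apply, smul_zero]
  exact smul_zero _

end Contraction

section Residue

variable {r k p q j : ℕ} {X Y : Type*} [TopologicalSpace X] [ChartedSpace (E (2 * r + k)) X]
  [TopologicalSpace Y] [ChartedSpace (E k) Y]
variable [IsManifold (𝓡 (2 * r + k)) ∞ X] [IsManifold (𝓡 k) ∞ Y]
variable [T2Space X] [SigmaCompactSpace X] [T2Space Y] [SigmaCompactSpace Y]
variable {i : Y → X} {μ : X → ℝ}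

theorem IsCompactlySupported.wedgeCast_right {d : ℕ} {M : Type*} [TopologicalSpace M]
    [ChartedSpace (E d) M] (h : p + j = d) (a : DForm d M p) {b : DForm d M j}
    (hb : IsCompactlySupported b) :
    IsCompactlySupported fun x => wedgeCast h (a x) (b x) := by
  obtain ⟨K, hK, h0⟩ := hb
  exact ⟨K, hK, fun x hx => by
    simp only [h0 x hx]; exact wedgeCast_zero_right h _⟩

/-- The residue of `w ∧ φ` from a contraction of `ψ ∧ φ`. -/
theorem hasI0_of_isNormalContraction (hr : 1 ≤ r) (hX : IsOrientedAtlas (2 * r + k) X)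
    (hi : Manifold.IsSmoothEmbedding (𝓡 k) (𝓡 (2 * r + k)) ∞ i) (hY : IsClosed (range i))
    (hμ : IsMorseBott (n := 2 * r + k) i μ (2 * r)) {w ψ : DForm (2 * r + k) X p}
    (hψ : IsSmoothExtension i ψ fun x => μ x ^ r • w x) (h₁ : p + j = 2 * r + k)
    {φ : DForm (2 * r + k) X j} (hφ : IsSmoothForm φ) (hφc : IsCompactlySupported φ)
    {τ : DForm k Y k} (hτ : IsSmoothTwistedForm τ)
    (h : IsNormalContraction i μ (fun x => wedgeCast h₁ (ψ x) (φ x)) τ) :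
    HasI0 μ (fun x => wedgeCast h₁ (w x) (φ x))
      ((2 * Real.pi ^ r / (r - 1).factorial : ℝ) * twistedIntegral τ) := by
  have h2 := hasResidueZero_powerIntegral hr hX hi hY hμ (hψ.1.wedgeCast h₁ hφ)
    (hφc.wedgeCast_right h₁ ψ) hτ h
  refine HasResidueZero.congr h2 (C := 2 * r) fun s hs => ?_
  rw [powerIntegral, formIntegral]
  congr 1
  funext x₀ z
  have h3 := cpow_smul_wedgeCast_eq hr hμ hψ h₁ φ hs ((chartAt (E (2 * r + k)) x₀).symm z)
  have h4 := congrArg (fun f : E (2 * r + k) [⋀^Fin (2 * r + k)]→ₗ[ℝ] ℂ =>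
    f fun a => jac (d := 2 * r + k) x₀ z (stdVec (2 * r + k) a)) h3
  exact h4.symm

theorem chartIntegral_const_mul {d : ℕ} {M : Type*} [TopologicalSpace M] [ChartedSpace (E d) M]
    [IsManifold (𝓡 d) ∞ M] [T2Space M] [SigmaCompactSpace M] (c : ℂ) (f : M → E d → ℂ) :
    chartIntegral (fun x z => c * f x z) = c * chartIntegral f := by
  by_cases hc : c = 0
  · simp only [hc, zero_mul]
    exact chartIntegral_zero
  · have h1 : ∀ x₀ : M, ∫ z in (chartAt (E d) x₀).target,
          ((chartPartition d M x₀ ((chartAt (E d) x₀).symm z) : ℝ) : ℂ) * (c * f x₀ z) =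
        c • ∫ z in (chartAt (E d) x₀).target,
          ((chartPartition d M x₀ ((chartAt (E d) x₀).symm z) : ℝ) : ℂ) * f x₀ z := fun x₀ => by
      rw [smul_eq_mul, ← integral_const_mul]
      congr 1
      funext z
      ring
    rw [chartIntegral, chartIntegral, ← smul_eq_mul c, smul_finsum]
    exact finsum_congr h1

theorem twistedIntegral_smul_wedgeCast (c : ℝ) (h : q + j = k) (α : DForm k Y q)
    (φ : DForm k Y j) :
    twistedIntegral (fun y => wedgeCast h ((c • α) y) (φ y)) =
      c * twistedIntegral fun y => wedgeCast h (α y) (φ y) := by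
  rw [twistedIntegral, twistedIntegral, ← chartIntegral_const_mul]
  congr 1
  funext y₀ u
  have : (fun y => wedgeCast h ((c • α) y) (φ y)) = fun y => (fun _ => c) y •
      (fun y => wedgeCast h (α y) (φ y)) y := funext fun y => wedgeCast_smul_left h c (α y) (φ y)
  rw [this]
  exact twistedInChart_smul (fun _ => c) _ y₀ u _

theorem IsSmoothTwistedForm.const_smul {α : DForm k Y q} (hα : IsSmoothTwistedForm α) (c : ℝ) :
    IsSmoothTwistedForm (c • α) :=
  IsSmoothTwistedForm.smul (f := fun _ => c) contMDiff_const hα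

/-- If `(μ^r w)|_Y = V(μ) ∧ α`, the residue of `w` is a multiple of `α`. -/
theorem RestrictsTo.isResidue (hr : 1 ≤ r) (hX : IsOrientedAtlas (2 * r + k) X)
    (hi : Manifold.IsSmoothEmbedding (𝓡 k) (𝓡 (2 * r + k)) ∞ i) (hY : IsClosed (range i))
    (hμ : IsMorseBott (n := 2 * r + k) i μ (2 * r)) {w ψ : DForm (2 * r + k) X (2 * r + q)}
    (hψ : IsSmoothExtension i ψ fun x => μ x ^ r • w x) {α : DForm k Y q}
    (hα : RestrictsTo rfl rfl i μ ψ α) :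
    IsResidue i μ w ((2 * Real.pi ^ r / ((r - 1).factorial : ℝ)) • α) := by
  have hαs := hα.isSmoothTwistedForm hX (by omega) hi.isImmersion hμ hψ.1
  refine ⟨hαs.const_smul _, fun j h₁ h₂ φ hφ hφc => ?_⟩
  rw [twistedIntegral_smul_wedgeCast]
  exact hasI0_of_isNormalContraction hr hX hi hY hμ hψ h₁ hφ hφc
    (hαs.wedgeCast h₂ (hφ.restrict hi.contMDiff))
    (isNormalContraction_wedgeCast hX (by omega) hi.isImmersion hμ hα h₁ h₂ φ)

/-- If the extension of `μ^r w` vanishes on the submanifold, the residue of `w` is zero. -/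
theorem hasI0_zero (hr : 1 ≤ r) (hX : IsOrientedAtlas (2 * r + k) X)
    (hi : Manifold.IsSmoothEmbedding (𝓡 k) (𝓡 (2 * r + k)) ∞ i) (hY : IsClosed (range i))
    (hμ : IsMorseBott (n := 2 * r + k) i μ (2 * r)) {w ψ : DForm (2 * r + k) X p}
    (hψ : IsSmoothExtension i ψ fun x => μ x ^ r • w x) (h0 : ∀ y, ψ (i y) = 0)
    (h₁ : p + j = 2 * r + k) {φ : DForm (2 * r + k) X j} (hφ : IsSmoothForm φ)
    (hφc : IsCompactlySupported φ) : HasI0 μ (fun x => wedgeCast h₁ (w x) (φ x)) 0 := by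
  have hzero : ∀ (y₀ : Y) (u : E k) (v : Fin k → E k),
      twistedInChart (fun _ : Y => 0) y₀ u v = 0 := fun y₀ u v => by
    rw [twistedInChart_apply, inChart_apply]
    exact smul_zero _
  have h2 := hasI0_of_isNormalContraction hr hX hi hY hμ hψ h₁ hφ hφc
    (τ := fun _ => 0) (fun y₀ v => by simp only [hzero]; exact contDiffOn_const)
    (isNormalContraction_zero fun y => by rw [h0 y]; exact wedgeCast_zero_left h₁ _)
  have h3 : twistedIntegral (fun _ => 0 : DForm k Y k) = 0 := by
    rw [twistedIntegral]
    simp only [hzero]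
    exact chartIntegral_zero
  rwa [h3, mul_zero] at h2

end Residue

/-! ### Twisted forms are determined by their integrals against restrictions -/

section Coordinates

variable {m k j : ℕ} {X Y : Type*} [TopologicalSpace X] [ChartedSpace (E (m + k)) X]
  [TopologicalSpace Y] [ChartedSpace (E k) Y]
variable [IsManifold (𝓡 (m + k)) ∞ X] [IsManifold (𝓡 k) ∞ Y]
variable {i : Y → X} {μ : X → ℝ}

/-- Near `i y₁`, the coordinates of `Y` at `y₁` extend to smooth functions on `X`: in an adapted
chart they are the coordinates `u`, which are multiplied by a bump function. The set `V` meets `i(Y)` only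
in points of the chart at `y₁`. -/
theorem exists_extension_of_coordinates [T2Space X]
    (hi : Manifold.IsSmoothEmbedding (𝓡 k) (𝓡 (m + k)) ∞ i)
    (hμ : IsMorseBott (n := m + k) i μ m) (y₁ : Y) :
    ∃ (f : Fin k → X → ℝ) (V : Set X), (∀ b, ContMDiff (𝓡 (m + k)) 𝓘(ℝ, ℝ) ∞ (f b)) ∧
      IsOpen V ∧ i y₁ ∈ V ∧ V ⊆ (chartAt (E (m + k)) (i y₁)).source ∧
      (∀ y, i y ∈ V → y ∈ (chartAt (E k) y₁).source) ∧
      ∀ u ∈ (chartAt (E k) y₁).target, i ((chartAt (E k) y₁).symm u) ∈ V →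
        ∀ b, f b (i ((chartAt (E k) y₁).symm u)) = u b := by
  obtain ⟨κ, hκ⟩ := hμ.exists_adaptedChart rfl hi.isImmersion y₁
  set c := chartAt (E (m + k)) (i y₁) with hc
  set W := c.source ∩ c ⁻¹' κ.target with hW
  have hWo : IsOpen W := c.isOpen_inter_preimage κ.open_target
  have hy1W : i y₁ ∈ W := by
    have h1 := hκ.apply_zero _ hκ.mem_source
    rw [(chartAt (E k) y₁).left_inv (mem_chart_source _ _)] at h1
    refine ⟨mem_chart_source _ _, ?_⟩
    rw [mem_preimage, ← h1, c.right_inv (hκ.mem_target hκ.mem_source)]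
    exact κ.map_source hκ.mem_source
  obtain ⟨β, -, hβ⟩ := (SmoothBumpFunction.nhds_basis_tsupport (I := 𝓡 (m + k))
    (i y₁)).mem_iff.1 (hWo.mem_nhds hy1W)
  obtain ⟨V₀, hV₀, hV₀o, hV₀y⟩ := eventually_nhds_iff.1 β.eventuallyEq_one
  have hpt : ∀ y, i y ∈ W → ((0 : E m), (κ.symm (c (i y))).2) ∈ κ.source ∧
      y = (chartAt (E k) y₁).symm (κ.symm (c (i y))).2 := by
    intro y hy
    have h1 : κ.symm (c (i y)) ∈ κ.source := κ.map_target hy.2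
    have h2 : c.symm (κ (κ.symm (c (i y)))) = i y := by
      rw [κ.right_inv hy.2, c.left_inv hy.1]
    obtain ⟨h3, h4⟩ := hκ.eq_of_apply_eq hμ hi.isEmbedding.injective h1 h2
    exact ⟨h3 ▸ h1, h4⟩
  refine ⟨fun b x => β x * (κ.symm (c x)).2 b, V₀ ∩ W, fun b => ?_, hV₀o.inter hWo,
    ⟨hV₀y, hy1W⟩, fun x hx => hx.2.1, fun y hy => ?_, fun u hu hV b => ?_⟩
  · refine contMDiff_of_tsupport fun x hx => ?_
    have hxW : x ∈ W := hβ (closure_mono (Function.support_mul_subset_left _ _) hx)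
    refine ContMDiffAt.mul β.contMDiffAt ?_
    have h1 : ContMDiffAt (𝓡 (m + k)) (𝓡 (m + k)) ∞ c x :=
      (contMDiffOn_chart (I := 𝓡 (m + k)) (n := ∞) (x := i y₁)).contMDiffAt
        (c.open_source.mem_nhds hxW.1)
    have h2 : ContDiffAt ℝ ∞ (fun z => (κ.symm z).2 b) (c x) := by
      have h3 : ContDiffAt ℝ ∞ κ.symm (c x) :=
        hκ.contDiffOn_symm.contDiffAt (κ.open_target.mem_nhds hxW.2)
      exact ((EuclideanSpace.proj b : E k →L[ℝ] ℝ).contDiff.contDiffAt).comp (c x)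
        (contDiffAt_snd.comp (c x) h3)
    exact ContMDiffAt.comp x h2.contMDiffAt h1
  · obtain ⟨h1, h2⟩ := hpt y hy.2
    rw [h2]
    exact (chartAt (E k) y₁).map_target (hκ.zero_mem _ h1)
  · obtain ⟨h1, h2⟩ := hpt _ hV.2
    have h3 := (chartAt (E k) y₁).symm.injOn hu (hκ.zero_mem _ h1) h2
    have h4 : β (i ((chartAt (E k) y₁).symm u)) = 1 := hV₀ _ hV.1
    simp only [h4, one_mul]
    rw [← h3]

/-- The form `det (df_b)`, that is `df₁ ∧ ⋯ ∧ df_j`. -/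
def differentialsForm {n : ℕ} {X : Type*} [TopologicalSpace X] [ChartedSpace (E n) X]
    (f : Fin j → X → ℝ) : DForm n X j := fun x =>
  Complex.ofRealCLM.toLinearMap.compAlternatingMap
    ((Matrix.detRowAlternating (n := Fin j) (R := ℝ)).compLinearMap
      (LinearMap.pi fun b =>
        (show E n →L[ℝ] ℝ from mfderiv (𝓡 n) 𝓘(ℝ, ℝ) (f b) x).toLinearMap))

theorem inChart_differentialsForm {n : ℕ} {X : Type*} [TopologicalSpace X] [ChartedSpace (E n) X]
    [IsManifold (𝓡 n) ∞ X] {f : Fin j → X → ℝ}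
    (hf : ∀ b, ContMDiff (𝓡 n) 𝓘(ℝ, ℝ) ∞ (f b)) {x₀ : X} {z : E n}
    (hz : z ∈ (chartAt (E n) x₀).target) (v : Fin j → E n) :
    inChart (differentialsForm f : DForm n X j) x₀ z v =
      ((Matrix.of fun a b => fderiv ℝ (f b ∘ (chartAt (E n) x₀).symm) z (v a)).det : ℂ) := by
  set c := chartAt (E n) x₀ with hc
  have h1 : inChart (differentialsForm f : DForm n X j) x₀ z v =
      ((Matrix.of fun a b => (show E n →L[ℝ] ℝ from mfderiv (𝓡 n) 𝓘(ℝ, ℝ) (f b) (c.symm z))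
        (jac (d := n) x₀ z (v a))).det : ℂ) := rfl
  rw [h1]
  congr 3
  ext a b
  have hm := mfderiv_comp (I := 𝓘(ℝ, E n)) (I' := 𝓡 n) (I'' := 𝓘(ℝ, ℝ)) z (g := f b)
    (f := c.symm) ((hf b _).mdifferentiableAt (by simp))
    ((contMDiffOn_chart_symm (I := 𝓡 n) (n := ∞) (x := x₀)).contMDiffAt
      (c.open_target.mem_nhds hz) |>.mdifferentiableAt (by simp))
  rw [mfderiv_eq_fderiv] at hm
  exact (congrArg (fun L : E n →L[ℝ] ℝ => L (v a)) hm).symm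

theorem isSmoothForm_differentialsForm {n : ℕ} {X : Type*} [TopologicalSpace X]
    [ChartedSpace (E n) X] [IsManifold (𝓡 n) ∞ X] {f : Fin j → X → ℝ}
    (hf : ∀ b, ContMDiff (𝓡 n) 𝓘(ℝ, ℝ) ∞ (f b)) :
    IsSmoothForm (differentialsForm f : DForm n X j) := by
  intro x₀ v
  refine ContDiffOn.congr ?_ fun z hz => inChart_differentialsForm hf hz v
  simp only [Matrix.det_apply]
  refine Complex.ofRealCLM.contDiff.comp_contDiffOn (ContDiffOn.sum fun σ _ =>
    ContDiffOn.const_smul _ (contDiffOn_prod fun a _ => ?_))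
  exact (((contDiffOn_comp_chart_symm (hf _) x₀).fderiv_of_isOpen (m := ∞)
    (chartAt (E n) x₀).open_target (by simp)).clm_apply contDiffOn_const)

/-- The constant form `du_{I 1} ∧ ⋯ ∧ du_{I j}` on `ℝ^k`. -/
def coordForm (I : Fin j → Fin k) : E k [⋀^Fin j]→ₗ[ℝ] ℂ :=
  Complex.ofRealCLM.toLinearMap.compAlternatingMap
    ((Matrix.detRowAlternating (n := Fin j) (R := ℝ)).compLinearMap
      (LinearMap.pi fun b => (EuclideanSpace.proj (I b) : E k →L[ℝ] ℝ).toLinearMap))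

theorem coordForm_apply (I : Fin j → Fin k) (v : Fin j → E k) :
    coordForm I v = ((Matrix.of fun a b => v a (I b)).det : ℂ) := rfl

/-- Restriction of the form `df_{I 1} ∧ ⋯ ∧ df_{I j}` for functions extending the coordinates. -/
theorem inChart_restrict_differentialsForm (hi : ContMDiff (𝓡 k) (𝓡 (m + k)) ∞ i) {y₁ : Y}
    {f : Fin k → X → ℝ} {V : Set X} (hf : ∀ b, ContMDiff (𝓡 (m + k)) 𝓘(ℝ, ℝ) ∞ (f b))
    (hV : IsOpen V) (hVs : V ⊆ (chartAt (E (m + k)) (i y₁)).source)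
    (hfV : ∀ u ∈ (chartAt (E k) y₁).target, i ((chartAt (E k) y₁).symm u) ∈ V →
      ∀ b, f b (i ((chartAt (E k) y₁).symm u)) = u b) (I : Fin j → Fin k)
    {u : E k} (hu : u ∈ (chartAt (E k) y₁).target) (huV : i ((chartAt (E k) y₁).symm u) ∈ V) :
    inChart (restrict i (differentialsForm (fun b => f (I b)) : DForm (m + k) X j)) y₁ u =
      coordForm I := by
  have huD : u ∈ localDomain (m + k) k i y₁ := ⟨hu, hVs huV⟩
  ext v
  rw [inChart_restrict hi huD, inChart_differentialsForm (fun b => hf (I b))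
    (localMap_mem_target huD), coordForm_apply]
  congr 3
  ext a b
  have hopen := isOpen_localDomain (n := m + k) (k := k) hi.continuous y₁
  have hιd : DifferentiableAt ℝ (localMap (m + k) k i y₁) u :=
    ((contDiffOn_localMap hi y₁).contDiffAt (hopen.mem_nhds huD)).differentiableAt (by simp)
  have hfd : DifferentiableAt ℝ (f (I b) ∘ (chartAt (E (m + k)) (i y₁)).symm)
      (localMap (m + k) k i y₁ u) :=
    ((contDiffOn_comp_chart_symm (hf (I b)) (i y₁)).contDiffAt
      ((chartAt (E (m + k)) (i y₁)).open_target.mem_nhds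
        (localMap_mem_target huD))).differentiableAt (by simp)
  have h1 := fderiv_comp u hfd hιd
  have h2 : (f (I b) ∘ (chartAt (E (m + k)) (i y₁)).symm) ∘ localMap (m + k) k i y₁ =ᶠ[𝓝 u]
      (EuclideanSpace.proj (I b) : E k →L[ℝ] ℝ) := by
    have h3 : ContinuousAt (fun u => i ((chartAt (E k) y₁).symm u)) u :=
      ContinuousAt.comp (f := (chartAt (E k) y₁).symm) hi.continuous.continuousAt
        ((chartAt (E k) y₁).continuousAt_symm hu)
    filter_upwards [h3.eventually (hV.mem_nhds huV), hopen.mem_nhds huD] with u' h4 h5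
    simp only [Function.comp_apply]
    rw [symm_localMap h5]
    exact hfV u' h5.1 h4 (I b)
  rw [h2.fderiv_eq, ContinuousLinearMap.fderiv] at h1
  exact (congrArg (fun L : E k →L[ℝ] ℝ => L (v a)) h1).symm

/-- A coefficient of a form vanishes if the product of the form and the complementary coordinate
form does. -/
theorem exists_wedge_coordForm {q : ℕ} (I : Fin q → Fin k) (hI : Function.Injective I) :
    ∃ (j : ℕ) (h : q + j = k) (I' : Fin j → Fin k), ∀ a : E k [⋀^Fin q]→ₗ[ℝ] ℂ,
      wedgeCast h a (coordForm I') (stdVec k) = 0 → a (fun b => stdVec k (I b)) = 0 := by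
  have hqk : q ≤ k := by
    simpa using Fintype.card_le_of_injective I hI
  obtain ⟨j, rfl⟩ := Nat.exists_eq_add_of_le hqk
  have hcard : Fintype.card ((Set.range I)ᶜ : Set (Fin (q + j))) = j := by
    rw [Fintype.card_compl_set, Set.card_range_of_injective hI]
    simp
  let e₁ : Fin q ≃ Set.range I := Equiv.ofInjective I hI
  let e₂ : Fin j ≃ ((Set.range I)ᶜ : Set (Fin (q + j))) := (Fintype.equivFinOfCardEq hcard).symm
  let π : Equiv.Perm (Fin (q + j)) := finSumFinEquiv.symm.trans
    ((Equiv.sumCongr e₁ e₂).trans (Equiv.Set.sumCompl (Set.range I)))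
  have hπl : ∀ a, π (Fin.castAdd j a) = I a := fun a => by simp [π, e₁]
  have hπr : ∀ b, π (Fin.natAdd q b) = e₂ b := fun b => by simp [π]
  refine ⟨j, rfl, fun b => e₂ b, fun a ha => ?_⟩
  set I' : Fin j → Fin (q + j) := fun b => e₂ b with hI'
  have hI'i : Function.Injective I' := Subtype.val_injective.comp e₂.injective
  have hII' : ∀ b c, I b ≠ I' c := fun b c h => (e₂ c).2 ⟨b, h⟩
  rw [wedgeCast_rfl] at ha
  have h1 := (wedge a (coordForm I')).map_perm (stdVec (q + j)) π
  rw [ha, smul_zero] at h1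
  have h2 : stdVec (q + j) ∘ π =
      Fin.append (fun b => stdVec (q + j) (I b)) fun c => stdVec (q + j) (I' c) := by
    funext b
    refine Fin.addCases (fun b => ?_) (fun b => ?_) b
    · rw [Function.comp_apply, hπl, Fin.append_left]
    · rw [Function.comp_apply, hπr, Fin.append_right]
  rw [h2, wedge_append_of_right] at h1
  · have h3 : coordForm I' (fun c => stdVec (q + j) (I' c)) = 1 := by
      rw [coordForm_apply]
      have : (Matrix.of fun c b => (stdVec (q + j) (I' c)) (I' b)) = 1 := by
        ext c b
        simp [stdVec, Matrix.one_apply, hI'i.eq_iff, eq_comm]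
      rw [this, Matrix.det_one, Complex.ofReal_one]
    rwa [h3, mul_one] at h1
  · intro w b c hw
    rw [coordForm_apply, Matrix.det_eq_zero_of_row_eq_zero c, Complex.ofReal_zero]
    intro d
    simp [hw, stdVec, (hII' b d).symm]

end Coordinates

section Uniqueness

variable {m k q : ℕ} {X Y : Type*} [TopologicalSpace X] [ChartedSpace (E (m + k)) X]
  [TopologicalSpace Y] [ChartedSpace (E k) Y]
variable [IsManifold (𝓡 (m + k)) ∞ X] [IsManifold (𝓡 k) ∞ Y]
variable [T2Space X] [SigmaCompactSpace X] [T2Space Y] [SigmaCompactSpace Y]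
variable {i : Y → X} {μ : X → ℝ}

/-- A smooth twisted form whose integrals against restrictions of compactly supported smooth forms
vanish is zero. If a coefficient is nonzero at a point, it is tested against the complementary
coordinate form, extended to `X` and multiplied by a bump function on whose support the quotient of
the coefficient by its value at the point has positive real part. -/
theorem eq_zero_of_twistedIntegral_eq_zero
    (hi : Manifold.IsSmoothEmbedding (𝓡 k) (𝓡 (m + k)) ∞ i) (hY : IsClosed (range i))
    (hμ : IsMorseBott (n := m + k) i μ m) {δ : DForm k Y q} (hδ : IsSmoothTwistedForm δ)
    (h0 : ∀ (j : ℕ) (h : q + j = k) (φ : DForm (m + k) X j), IsSmoothForm φ →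
      IsCompactlySupported φ → twistedIntegral (fun y => wedgeCast h (δ y) (restrict i φ y)) = 0)
    (y₁ : Y) : δ y₁ = 0 := by
  set u₁ := chartAt (E k) y₁ y₁ with hu₁
  set T := (chartAt (E k) y₁).target with hT
  have hTo : IsOpen T := (chartAt (E k) y₁).open_target
  have hu₁T : u₁ ∈ T := mem_chart_target _ _
  have hy₁ : (chartAt (E k) y₁).symm u₁ = y₁ :=
    (chartAt (E k) y₁).left_inv (mem_chart_source _ _)
  refine eq_of_twistedInChart_eq (τ' := fun _ => 0) fun v => ?_
  suffices hz : twistedInChart δ y₁ u₁ = 0 by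
    rw [hz, twistedInChart_apply, inChart_apply]
    exact (smul_zero _).symm
  refine (EuclideanSpace.basisFun (Fin k) ℝ).toBasis.ext_alternating fun I hI => ?_
  obtain ⟨j, h, I', hII'⟩ := exists_wedge_coordForm I hI
  have hstd : (fun b => (EuclideanSpace.basisFun (Fin k) ℝ).toBasis (I b)) =
      fun b => stdVec k (I b) := by
    funext b; simp [stdVec]
  rw [hstd, AlternatingMap.zero_apply]
  refine hII' _ ?_
  by_contra hne
  set D : E k → ℂ := fun u => wedgeCast h (twistedInChart δ y₁ u) (coordForm I') (stdVec k) with hD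
  have hDc : ContinuousOn D T :=
    (contDiffOn_wedgeCast_apply h (fun v => hδ y₁ v) (fun v => contDiffOn_const) _).continuousOn
  -- normalized by its value at the centre, the coefficient has positive real part near the centre
  have hnear : ∀ᶠ u in 𝓝 u₁, 0 < ((D u₁)⁻¹ * D u).re := by
    have h1 : ContinuousAt (fun u => ((D u₁)⁻¹ * D u).re) u₁ :=
      Complex.continuous_re.continuousAt.comp
        (continuousAt_const.mul (hDc.continuousAt (hTo.mem_nhds hu₁T)))
    refine h1.eventually (lt_mem_nhds ?_)
    change 0 < ((D u₁)⁻¹ * D u₁).re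
    rw [inv_mul_cancel₀ hne]
    simp
  obtain ⟨f, V, hfs, hVo, hyV, hVs, hVY, hfV⟩ := exists_extension_of_coordinates hi hμ y₁
  have hnearY : ∀ᶠ y in 𝓝 y₁, 0 < ((D u₁)⁻¹ * D (chartAt (E k) y₁ y)).re :=
    ((chartAt (E k) y₁).continuousAt (mem_chart_source _ _)).eventually hnear
  obtain ⟨V', hV', hV'Y⟩ : ∃ V' ∈ 𝓝 (i y₁), ∀ y, i y ∈ V' →
      0 < ((D u₁)⁻¹ * D (chartAt (E k) y₁ y)).re := by
    have := hi.isEmbedding.isInducing.nhds_eq_comap y₁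
    rw [Filter.Eventually, this, mem_comap] at hnearY
    obtain ⟨t, ht, hts⟩ := hnearY
    exact ⟨t, ht, fun y hy => hts hy⟩
  obtain ⟨χ, -, hχ⟩ := (SmoothBumpFunction.nhds_basis_tsupport (I := 𝓡 (m + k))
    (i y₁)).mem_iff.1 (Filter.inter_mem (hVo.mem_nhds hyV) hV')
  set φ : DForm (m + k) X j := fun x => χ x • differentialsForm (fun b => f (I' b)) x with hφ
  have hφs : IsSmoothForm φ :=
    (isSmoothForm_differentialsForm fun b => hfs (I' b)).smul χ.contMDiff
  have hφ0 : ∀ x ∉ tsupport χ, φ x = 0 := fun x hx => by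
    simp only [φ, image_eq_zero_of_notMem_tsupport hx, zero_smul]
  have hint := h0 j h φ hφs ⟨_, χ.hasCompactSupport, hφ0⟩
  set τ : DForm k Y k := fun y => wedgeCast h (δ y) (restrict i φ y) with hτ
  have hτs : IsSmoothTwistedForm τ := hδ.wedgeCast h (hφs.restrict hi.contMDiff)
  set K := i ⁻¹' tsupport χ with hK
  have hKc : IsCompact K := (Topology.IsClosedEmbedding.mk hi.isEmbedding hY).isCompact_preimage
    χ.hasCompactSupport
  have hτ0 : ∀ y ∉ K, τ y = 0 := fun y hy => by
    have : (restrict i φ : DForm k Y j) y = 0 := by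
      rw [restrict, hφ0 _ hy]
      rfl
    simp only [τ, this]
    exact wedgeCast_zero_right h _
  have hKs : K ⊆ (chartAt (E k) y₁).source := fun y hy => hVY y (hχ hy).1
  have hden := hτs.isDensity hKc hτ0
  have hcoef : ∀ u ∈ T, twistedInChart τ y₁ u (stdVec k) =
      (χ (i ((chartAt (E k) y₁).symm u)) : ℂ) * D u := by
    intro u hu
    by_cases hmem : (chartAt (E k) y₁).symm u ∈ K
    · have h1 : inChart (restrict i φ) y₁ u =
          χ (i ((chartAt (E k) y₁).symm u)) • coordForm I' := by
        rw [← inChart_restrict_differentialsForm hi.contMDiff hfs hVo hVs hfV I' hu (hχ hmem).1]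
        rfl
      rw [twistedInChart_wedgeCast, h1, wedgeCast_smul_right, AlternatingMap.smul_apply,
        Complex.real_smul]
    · have h1 : χ (i ((chartAt (E k) y₁).symm u)) = 0 :=
        image_eq_zero_of_notMem_tsupport hmem
      rw [h1, Complex.ofReal_zero, zero_mul, twistedInChart_apply, inChart_apply, hτ0 _ hmem]
      exact smul_zero _
  rw [twistedIntegral, hden.chartIntegral_eq hKs] at hint
  set G : E k → ℂ := fun u => twistedInChart τ y₁ u (stdVec k) with hG
  have hGint : IntegrableOn G T := integrableOn_chart_target y₁ (hden.continuousOn y₁) hKc hKs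
    (hden.eq_zero y₁)
  have hre : ∫ u in T, ((D u₁)⁻¹ * G u).re = 0 := by
    have h1 := integral_re (𝕜 := ℂ) (hGint.const_mul (D u₁)⁻¹)
    have h2 : ∫ u in T, (D u₁)⁻¹ * G u = 0 := by
      rw [integral_const_mul, hint, mul_zero]
    refine h1.trans ?_
    rw [h2]
    simp
  have hGre : ∀ u ∈ T, ((D u₁)⁻¹ * G u).re =
      χ (i ((chartAt (E k) y₁).symm u)) * ((D u₁)⁻¹ * D u).re := fun u hu => by
    simp only [G]
    rw [hcoef u hu, mul_left_comm, Complex.re_ofReal_mul]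
  have hnn : 0 ≤ᵐ[volume.restrict T] fun u => ((D u₁)⁻¹ * G u).re := by
    refine (ae_restrict_iff' hTo.measurableSet).2 (Eventually.of_forall fun u hu => ?_)
    change 0 ≤ ((D u₁)⁻¹ * G u).re
    rw [hGre u hu]
    by_cases hmem : (chartAt (E k) y₁).symm u ∈ K
    · refine mul_nonneg χ.nonneg ?_
      have := hV'Y _ (hχ hmem).2
      rw [(chartAt (E k) y₁).right_inv hu] at this
      exact this.le
    · rw [image_eq_zero_of_notMem_tsupport hmem, zero_mul]
  have hpos := (setIntegral_pos_iff_support_of_nonneg_ae hnn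
    (hGint.const_mul (D u₁)⁻¹).re).2 ?_
  · exact hpos.ne' hre
  · have hev : ∀ᶠ u in 𝓝 u₁, u ∈ (Function.support fun u => ((D u₁)⁻¹ * G u).re) ∩ T := by
      have h3 : ContinuousAt (fun u => i ((chartAt (E k) y₁).symm u)) u₁ :=
        ContinuousAt.comp (f := (chartAt (E k) y₁).symm) hi.contMDiff.continuous.continuousAt
          ((chartAt (E k) y₁).continuousAt_symm hu₁T)
      have h4 : ∀ᶠ x in 𝓝 (i ((chartAt (E k) y₁).symm u₁)), χ x = 1 := by
        rw [hy₁]; exact χ.eventuallyEq_one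
      filter_upwards [h3.eventually h4, hTo.mem_nhds hu₁T, hnear] with u h5 h6 h7
      refine ⟨?_, h6⟩
      rw [Function.mem_support, hGre u h6, h5, one_mul]
      exact h7.ne'
    exact Measure.measure_pos_of_mem_nhds _ hev

end Uniqueness

section Uniqueness

variable {m k p q : ℕ} {X Y : Type*} [TopologicalSpace X] [ChartedSpace (E (m + k)) X]
  [TopologicalSpace Y] [ChartedSpace (E k) Y]
variable [IsManifold (𝓡 (m + k)) ∞ X] [IsManifold (𝓡 k) ∞ Y]
variable [T2Space X] [SigmaCompactSpace X] [T2Space Y] [SigmaCompactSpace Y]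
variable {i : Y → X} {μ : X → ℝ}

theorem IsSmoothTwistedForm.sub {α β : DForm k Y q} (hα : IsSmoothTwistedForm α)
    (hβ : IsSmoothTwistedForm β) : IsSmoothTwistedForm (α - β) := by
  intro y₀ v
  have : ∀ u, twistedInChart (α - β) y₀ u v =
      twistedInChart α y₀ u v - twistedInChart β y₀ u v := fun u => by
    simp only [twistedInChart_apply, ← smul_sub]
    rfl
  simp only [this]
  exact (hα y₀ v).sub (hβ y₀ v)

/-- The residue of a form is unique: two residues have the same integrals, by uniqueness of
meromorphic continuation. -/
theorem IsResidue.unique (hi : Manifold.IsSmoothEmbedding (𝓡 k) (𝓡 (m + k)) ∞ i)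
    (hY : IsClosed (range i)) (hμ : IsMorseBott (n := m + k) i μ m) (hpq : m + q = p)
    {w : DForm (m + k) X p} {ρ ρ' : DForm k Y q} (hρ : IsResidue i μ w ρ)
    (hρ' : IsResidue i μ w ρ') : ρ = ρ' := by
  refine sub_eq_zero.1 (funext fun y₁ => ?_)
  refine eq_zero_of_twistedIntegral_eq_zero hi hY hμ (hρ.1.sub hρ'.1)
    (fun j h φ hφ hφc => ?_) y₁
  have hX : p + j = m + k := by omega
  have heq : twistedIntegral (fun y => wedgeCast h (ρ y) (restrict i φ y)) =
      twistedIntegral fun y => wedgeCast h (ρ' y) (restrict i φ y) :=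
    HasResidueZero.unique (hρ.2 j hX h φ hφ hφc) (hρ'.2 j hX h φ hφ hφc)
  have hφr : IsSmoothForm (restrict i φ : DForm k Y j) := hφ.restrict hi.contMDiff
  obtain ⟨K, hK, h0⟩ := hφc
  have hKc : IsCompact (i ⁻¹' K) :=
    (Topology.IsClosedEmbedding.mk hi.isEmbedding hY).isCompact_preimage hK
  have hφ0 : ∀ y ∉ i ⁻¹' K, (restrict i φ : DForm k Y j) y = 0 := fun y hy => by
    rw [restrict, h0 _ hy]
    rfl
  have hw0 : ∀ (σ : DForm k Y q), ∀ y ∉ i ⁻¹' K, wedgeCast h (σ y) (restrict i φ y) = 0 :=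
    fun σ y hy => by rw [hφ0 y hy]; exact wedgeCast_zero_right h _
  have h1 := (((hρ.1.sub hρ'.1).wedgeCast h hφr).isDensity hKc (hw0 _)).chartIntegral_add
    ((hρ'.1.wedgeCast h hφr).isDensity hKc (hw0 _))
  have h2 : twistedIntegral (fun y => wedgeCast h (ρ y) (restrict i φ y)) =
      twistedIntegral (fun y => wedgeCast h ((ρ - ρ') y) (restrict i φ y)) +
        twistedIntegral fun y => wedgeCast h (ρ' y) (restrict i φ y) := by
    refine Eq.trans ?_ h1
    rw [twistedIntegral]
    congr 1
    funext y₀ u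
    simp only [twistedInChart_wedgeCast]
    have h3 : twistedInChart (ρ - ρ') y₀ u = twistedInChart ρ y₀ u - twistedInChart ρ' y₀ u := by
      simp only [twistedInChart, ← smul_sub]
      rfl
    rw [h3, wedgeCast_sub_left, AlternatingMap.sub_apply, sub_add_cancel]
  rw [heq] at h2
  exact add_eq_right.1 h2.symm

end Uniqueness

end MorseBottResidue

end

theorem mainTheorem7 {n k r : ℕ} (hr : 1 ≤ r) (hn : 2 * r + k = n)
    {X : Type*} [TopologicalSpace X] [T2Space X] [SigmaCompactSpace X]
    [ChartedSpace (MorseBottResidue.E n) X] [IsManifold (𝓡 n) ∞ X]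
    (hX : MorseBottResidue.IsOrientedAtlas n X)
    {Y : Type*} [TopologicalSpace Y] [T2Space Y] [SigmaCompactSpace Y]
    [ChartedSpace (MorseBottResidue.E k) Y] [IsManifold (𝓡 k) ∞ Y]
    {i : Y → X} (hi : Manifold.IsSmoothEmbedding (𝓡 k) (𝓡 n) ∞ i) (hY : IsClosed (Set.range i))
    {μ : X → ℝ} (hμ : MorseBottResidue.IsMorseBott (n := n) i μ (2 * r))
    {p : ℕ} {w : MorseBottResidue.DForm n X p} (hw : MorseBottResidue.IsTame i μ r w)
    {ψ : MorseBottResidue.DForm n X p}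
    (hψ : MorseBottResidue.IsSmoothExtension i ψ fun x => μ x ^ r • w x) :
    (∀ (q : ℕ) (hq : 2 * r + q = p),
      (∃ α : MorseBottResidue.DForm k Y q, MorseBottResidue.IsSmoothTwistedForm α ∧
        MorseBottResidue.RestrictsTo hn hq i μ ψ α) ∧
      ∀ α : MorseBottResidue.DForm k Y q, MorseBottResidue.RestrictsTo hn hq i μ ψ α →
        ∀ ρ : MorseBottResidue.DForm k Y q,
          MorseBottResidue.IsResidue i μ w ρ ↔
            ρ = (2 * Real.pi ^ r / ((r - 1).factorial : ℝ)) • α) ∧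
    (p < 2 * r → (∀ y, ψ (i y) = 0) ∧
      ∀ (j : ℕ) (hj : p + j = n) (φ : MorseBottResidue.DForm n X j),
        MorseBottResidue.IsSmoothForm φ → MorseBottResidue.IsCompactlySupported φ →
          MorseBottResidue.HasI0 μ (fun x => MorseBottResidue.wedgeCast hj (w x) (φ x)) 0) := by
  subst hn
  refine ⟨fun q hq => ?_, fun hp => ?_⟩
  · subst hq
    refine ⟨?_, fun α hα ρ => ⟨fun hρ => ?_, fun hρ => ?_⟩⟩
    · obtain ⟨α, hα⟩ := MorseBottResidue.exists_restrictsTo hX (by omega) hi.isImmersion hμ hr hψ hw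
      exact ⟨α, hα.isSmoothTwistedForm hX (by omega) hi.isImmersion hμ hψ.1, hα⟩
    · exact hρ.unique hi hY hμ rfl (hα.isResidue hr hX hi hY hμ hψ)
    · rw [hρ]
      exact hα.isResidue hr hX hi hY hμ hψ
  · have h0 := MorseBottResidue.eq_zero_of_isTame hi.isImmersion hμ hr hp hψ hw
    exact ⟨h0, fun j hj φ hφ hφc =>
      MorseBottResidue.hasI0_zero hr hX hi hY hμ hψ h0 hj hφ hφc⟩
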